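/- Let $n\ge 2$, let $\mathbb{B}$ be the open unit ball of $\mathbb{R}^n$, $\nu$ the Lebesgue measure on $\mathbb{B}$ normalized by $\nu(\mathbb{B})=1$, and $h(\mathbb{B})$ the space of complex-valued harmonic functions on $\mathbb{B}$. Notation. For $k\in\{0,1,2,\dots\}$ and $\alpha\in\mathbb{R}$, with $(a)_k=\Gamma(a+k)/\Gamma(a)$, put $$\gamma_k(\alpha)=\frac{(1+n/2+\alpha)_k}{(n/2)_k}\ \text{ if } \alpha>-(1+n/2),\qquad \gamma_k(\alpha)=\frac{((1)_k)^2}{(1-(n/2+\alpha))_k\,(n/2)_k}\ \text{ if } \alpha\le-(1+n/2).$$ For $s,t\in\mathbb{R}$ and $f\in h(\mathbb{B})$ with homogeneous expansion $f=\sum_{k\ge0}f_k$ ($f_k$ a homogeneous harmonic polynomial of degree $k$), let $$D^t_sf=\sum_{k\ge0}\frac{\gamma_k(s+t)}{\gamma_k(s)}f_k,\qquad I^t_sf(x)=(1-|x|^2)^tD^t_sf(x).$$ Spaces. Let $\alpha\in\mathbb{R}$. - For $1\le p<\infty$, the harmonic Bergman–Besov space $b^p_\alpha$ consists of all $f\in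 h(\mathbb{B})$ such that $\int_{\mathbb{B}}|I^t_sf(x)|^p(1-|x|^2)^{\alpha}\,d\nu(x)<\infty$ for some $s,t\in\mathbb{R}$ with $\alpha+pt>-1$. - The weighted harmonic Bloch space $b^\infty_\alpha$ consists of all $f\in h(\mathbb{B})$ such that $\|f\|_{\alpha,s,t}:=\sup_{x\in\mathbb{B}}(1-|x|^2)^\alpha|I^t_sf(x)|<\infty$ for some $s,t\in\mathbb{R}$ with $\alpha+t>0$. - The weighted harmonic little Bloch space $b^\infty_{\alpha0}$ consists of all $f\in b^\infty_\alpha$ such that $\lim_{|x|\to1^-}(1-|x|^2)^\alpha|I^t_sf(x)|=0$ for some $s,t\in\mathbb{R}$ with $\alpha+t>0$. Theorem. Let $1\le p<\infty$, $\alpha\in\mathbb{R}$ and $\beta\le p\alpha-n$. Let $s,t\in\mathbb{R}$ with $\alpha+t>0$, and let $s',t'\in\mathbb{R}$ with $\alpha+t'>0$. For $f\in b^\infty_\alpha$ the following are equivalent: (i) $f\in b^\infty_{\alpha0}$. (ii) $f$ belongs to the closure of $b^p_\beta$ in $b^\infty_\alpha$ with respect to the norm $\|\cdot\|_{\alpha,s',t'}$;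 that is, for every $\varepsilon>0$ there is $g\in b^p_\beta$ with $\|f-g\|_{\alpha,s',t'}<\varepsilon$. (iii) For every $\varepsilon>0$, $$\int_{\Omega^{\alpha,t}_\varepsilon(f)}(1-|x|^2)^{-n}\,d\nu(x)<\infty,\qquad\text{where }\ \Omega^{\alpha,t}_\varepsilon(f)=\{x\in\mathbb{B}:(1-|x|^2)^\alpha|I^t_sf(x)|\ge\varepsilon\}.$$ -/

import Mathlib

open Filter Topology MeasureTheory
open scoped ENNReal Nat

noncomputable section

namespace HarmonicBloch

/-- The Euclidean space of dimension `n`. -/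
abbrev E (n : ℕ) : Type := EuclideanSpace ℝ (Fin n)

/-- The open unit ball `𝔹` of `ℝⁿ`. -/
def unitBall (n : ℕ) : Set (E n) := Metric.ball 0 1

/-- `h(𝔹)`: the complex-valued functions that are harmonic on the unit ball. A function on `𝔹` is
represented by a function on `ℝⁿ`, whose values outside `𝔹` play no role. -/
def harmonicSpace (n : ℕ) : Set (E n → ℂ) :=
  {f | InnerProductSpace.HarmonicOnNhd f (unitBall n)}

/-- Normalized Lebesgue measure `ν` on the unit ball. -/
def nu (n : ℕ) : Measure (E n) :=
  (volume (unitBall n))⁻¹ • volume.restrict (unitBall n)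

open Classical in
/-- The constant `V_α`: it makes `ν_α` a probability measure if `α > -1`, and is `1` otherwise. -/
def weightConst (n : ℕ) (α : ℝ) : ℝ :=
  if -1 < α then ∫ x, (1 - ‖x‖ ^ 2) ^ α ∂(nu n) else 1

/-- The weighted measure `dν_α(x) = V_α⁻¹ (1 - |x|²)^α dν(x)` on the unit ball. -/
def nuWeighted (n : ℕ) (α : ℝ) : Measure (E n) :=
  (nu n).withDensity fun x => ENNReal.ofReal ((weightConst n α)⁻¹ * (1 - ‖x‖ ^ 2) ^ α)

/-- The Pochhammer symbol `(a)_b = Γ(a + b) / Γ(a)`. -/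
def poch (a b : ℝ) : ℝ := Real.Gamma (a + b) / Real.Gamma a

open Classical in
/-- The coefficients `γ_k(α)` of the extended reproducing kernels `R_α = ∑ γ_k(α) Z_k`. Every
Pochhammer symbol occurring here has a positive base. -/
def gammaCoeff (n : ℕ) (k : ℕ) (α : ℝ) : ℝ :=
  if -(1 + (n : ℝ) / 2) < α then
    poch (1 + (n : ℝ) / 2 + α) k / poch ((n : ℝ) / 2) k
  else
    (poch 1 k) ^ 2 / (poch (1 - ((n : ℝ) / 2 + α)) k * poch ((n : ℝ) / 2) k)

/-- The term `f_k` of degree `k` in the homogeneous expansion `f = ∑ f_k` of a harmonic function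
on the ball: the homogeneous part of degree `k` of its Taylor series at the origin,
`f_k(x) = (1 / k!) f^{(k)}(0)(x, …, x)`. -/
def homogPart {n : ℕ} (f : E n → ℂ) (k : ℕ) (x : E n) : ℂ :=
  ((k ! : ℝ)⁻¹) • iteratedFDeriv ℝ k f 0 (fun _ => x)

/-- The radial differential operator `D^t_s f = ∑_k (γ_k(s + t) / γ_k(s)) f_k`. For `f` harmonic on
the ball, the series converges absolutely at each point of the ball. -/
def radialD {n : ℕ} (s t : ℝ) (f : E n → ℂ) (x : E n) : ℂ :=
  ∑' k : ℕ, (gammaCoeff n k (s + t) / gammaCoeff n k s) • homogPart f k x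

/-- `I^t_s f(x) = (1 - |x|²)^t D^t_s f(x)`. -/
def radialI {n : ℕ} (s t : ℝ) (f : E n → ℂ) (x : E n) : ℂ :=
  ((1 - ‖x‖ ^ 2) ^ t : ℝ) • radialD s t f x

/-- The harmonic Bergman–Besov space `b^p_α`: the `f ∈ h(𝔹)` with `I^t_s f ∈ L^p(ν_α)` for some
`s, t` with `α + p t > -1`. -/
def bergmanBesov (n : ℕ) (p α : ℝ) : Set (E n → ℂ) :=
  {f | f ∈ harmonicSpace n ∧
    ∃ s t : ℝ, -1 < α + p * t ∧ MemLp (radialI s t f) (ENNReal.ofReal p) (nuWeighted n α)}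

/-- The norm `sup_{x ∈ 𝔹} (1 - |x|²)^α |I^t_s f(x)|`, with value `∞` if the supremum is infinite. -/
def blochNorm {n : ℕ} (α s t : ℝ) (f : E n → ℂ) : ℝ≥0∞ :=
  ⨆ x ∈ unitBall n, ENNReal.ofReal ((1 - ‖x‖ ^ 2) ^ α * ‖radialI s t f x‖)

/-- The weighted harmonic Bloch space `b^∞_α`: the `f ∈ h(𝔹)` for which
`(1 - |x|²)^α I^t_s f(x)` is bounded on `𝔹` for some `s, t` with `α + t > 0`. -/
def bloch (n : ℕ) (α : ℝ) : Set (E n → ℂ) :=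
  {f | f ∈ harmonicSpace n ∧ ∃ s t : ℝ, 0 < α + t ∧ blochNorm α s t f < ∞}

/-- The weighted harmonic little Bloch space `b^∞_{α0}`: the `f ∈ b^∞_α` for which
`(1 - |x|²)^α |I^t_s f(x)| → 0` as `|x| → 1⁻`, for some `s, t` with `α + t > 0`. -/
def littleBloch (n : ℕ) (α : ℝ) : Set (E n → ℂ) :=
  {f | f ∈ bloch n α ∧ ∃ s t : ℝ, 0 < α + t ∧
    Tendsto (fun x : E n => (1 - ‖x‖ ^ 2) ^ α * ‖radialI s t f x‖)
      (comap (fun x : E n => ‖x‖) (𝓝[<] 1)) (𝓝 0)}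

/-- The closure of `A` in `b^∞_α` for the norm `blochNorm α s t`. -/
def blochClosure {n : ℕ} (α s t : ℝ) (A : Set (E n → ℂ)) : Set (E n → ℂ) :=
  {f | f ∈ bloch n α ∧ ∀ ε : ℝ, 0 < ε → ∃ g ∈ A, blochNorm α s t (f - g) < ENNReal.ofReal ε}

/-- The level set `{x ∈ 𝔹 : (1 - |x|²)^α |I^t_s f(x)| ≥ ε}`. -/
def levelSet {n : ℕ} (α s t ε : ℝ) (f : E n → ℂ) : Set (E n) :=
  {x | x ∈ unitBall n ∧ ε ≤ (1 - ‖x‖ ^ 2) ^ α * ‖radialI s t f x‖}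

end HarmonicBloch

end

noncomputable section

namespace HarmonicBloch

open InnerProductSpace Metric
open scoped ContDiff Laplacian

set_option linter.unusedSectionVars false

/-! ### A smooth radial weight with an explicit potential -/

section Kernel

variable {V : Type*} [NormedAddCommGroup V] [InnerProductSpace ℝ V]

/-! The operator D^t_s multiplies the degree-k part of f by γ_k(s+t)/γ_k(s), which is a product of
Gamma quotients Γ(k+a)/Γ(k+b) of total order t. The key fact is that such a multiplier of order τ
turns growth ε(1-|x|)^(-A) near the sphere into growth Cε(1-|x|)^(-(A+τ)), provided the exponents
stay positive, with C independent of f and ε (`Transfer`, `transfer_gamma_ratio`,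
`exists_growth_radialD_of_growth`). Raising the order by one is a radial derivative, bounded by an
interior Lipschitz estimate. Lowering it is an average of dilates against a Beta weight. Since C
does not depend on ε, both O and o bounds pass from one admissible pair (s,t) to any other. Thus
"for some s,t" becomes "for all s,t", and all conditions can be compared with `VanishesAtSphere`.

(i) ⇒ (iii): the level sets lie in compact subsets of the ball. (iii) ⇒ (i): if the weighted size of
D^t_s f at x is at least a fixed ε, the Lipschitz estimate keeps it at least some ε' on a ball of
radius η(1-|x|). Such balls carry (1-|x|²)^(-n) dν-mass bounded below, which is impossible
arbitrarily near the sphere when the level set has finite mass (`exists_ball_subset_levelSet`,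
`vanishesAtSphere_of_lintegral_levelSet`).

(i) ⇒ (ii): the dilates f(r·) lie in every b^p_β and converge to f in norm
(`exists_dilation_close`). (ii) ⇒ (i): the sub-mean-value inequality for |w|^p, with small tails of
a convergent integral, shows that b^p_β functions satisfy the little-o condition when β ≤ pα-n
(`vanishesAtSphere_of_mem_bergmanBesov`). This condition is closed in the norm.

The harmonic function theory rests on one Green identity with a smooth radial weight, so no surface
measure enters. It gives the mean value property, smoothness, orthogonality of different degrees,
and geometric convergence of the homogeneous expansion (`exists_norm_homogPart_le`). After that only
the weighted mean value property of the series D^t_s f is used (`HasMeanValue`), not its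
harmonicity. -/

/-- A smooth radial function supported in the closed unit ball. -/
def bumpPotential (y : V) : ℝ := expNegInvGlue (1 - ‖y‖ ^ 2)

/-- The smooth radial kernel with `∇ bumpPotential y = -2 bumpKernel y • y`. -/
def bumpKernel (y : V) : ℝ := deriv expNegInvGlue (1 - ‖y‖ ^ 2)

lemma deriv_expNegInvGlue (x : ℝ) : deriv expNegInvGlue x = (x⁻¹) ^ 2 * expNegInvGlue x := by
  simpa using (expNegInvGlue.hasDerivAt_polynomial_eval_inv_mul 1 x).deriv

lemma contDiff_bumpPotential : ContDiff ℝ ∞ (bumpPotential : V → ℝ) :=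
  (expNegInvGlue.contDiff (n := ⊤)).comp (contDiff_const.sub (contDiff_norm_sq ℝ))

lemma contDiff_bumpKernel : ContDiff ℝ ∞ (bumpKernel : V → ℝ) := by
  have h : ContDiff ℝ ∞ (deriv expNegInvGlue) :=
    (contDiff_infty_iff_deriv.1 (expNegInvGlue.contDiff (n := ⊤))).2
  exact h.comp (contDiff_const.sub (contDiff_norm_sq ℝ))

lemma continuous_bumpKernel : Continuous (bumpKernel : V → ℝ) := contDiff_bumpKernel.continuous

lemma bumpKernel_nonneg (y : V) : 0 ≤ bumpKernel y := expNegInvGlue.monotone.deriv_nonneg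

lemma bumpKernel_neg (y : V) : bumpKernel (-y) = bumpKernel y := by simp [bumpKernel]

lemma bumpKernel_pos {y : V} (hy : ‖y‖ < 1) : 0 < bumpKernel y := by
  have h : 0 < 1 - ‖y‖ ^ 2 := by nlinarith [norm_nonneg y]
  rw [bumpKernel, deriv_expNegInvGlue]
  have := expNegInvGlue.pos_of_pos h
  positivity

lemma bumpKernel_eq_zero {y : V} (hy : 1 ≤ ‖y‖) : bumpKernel y = 0 := by
  have h : 1 - ‖y‖ ^ 2 ≤ 0 := by nlinarith
  rw [bumpKernel, deriv_expNegInvGlue, expNegInvGlue.zero_of_nonpos h, mul_zero]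

lemma bumpPotential_eq_zero {y : V} (hy : 1 ≤ ‖y‖) : bumpPotential y = 0 :=
  expNegInvGlue.zero_of_nonpos (by nlinarith)

lemma support_bumpKernel_subset :
    Function.support (bumpKernel : V → ℝ) ⊆ closedBall 0 1 := by
  intro y hy
  by_contra h
  exact hy (bumpKernel_eq_zero (by simpa using le_of_lt (by simpa using h)))

lemma support_bumpPotential_subset :
    Function.support (bumpPotential : V → ℝ) ⊆ closedBall 0 1 := by
  intro y hy
  by_contra h
  exact hy (bumpPotential_eq_zero (by simpa using le_of_lt (by simpa using h)))

lemma tsupport_bumpPotential_subset : tsupport (bumpPotential : V → ℝ) ⊆ closedBall 0 1 :=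
  closure_minimal support_bumpPotential_subset isClosed_closedBall

lemma fderiv_bumpPotential (y v : V) :
    fderiv ℝ bumpPotential y v = -2 * bumpKernel y * inner ℝ y v := by
  have h1 : HasDerivAt expNegInvGlue (bumpKernel y) (1 - ‖y‖ ^ 2) :=
    ((expNegInvGlue.contDiff (n := 1)).differentiable (by simp) _).hasDerivAt
  have h2 : HasFDerivAt (fun y : V => 1 - ‖y‖ ^ 2) (-((2 : ℕ) • (innerSL ℝ y : V →L[ℝ] ℝ))) y :=
    (hasStrictFDerivAt_norm_sq y).hasFDerivAt.const_sub 1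
  have h3 := h1.comp_hasFDerivAt y h2
  have h4 : HasFDerivAt bumpPotential (bumpKernel y • -((2 : ℕ) • (innerSL ℝ y : V →L[ℝ] ℝ))) y := h3
  rw [h4.fderiv]
  simp
  ring

variable [FiniteDimensional ℝ V]

lemma hasCompactSupport_bumpKernel : HasCompactSupport (bumpKernel : V → ℝ) :=
  HasCompactSupport.intro (isCompact_closedBall 0 1) fun y hy =>
    bumpKernel_eq_zero (by simpa using le_of_lt (by simpa using hy))

lemma exists_bumpKernel_le : ∃ C : ℝ, 0 < C ∧ ∀ y : V, bumpKernel y ≤ C := by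
  obtain ⟨C, hC⟩ := hasCompactSupport_bumpKernel.exists_bound_of_continuous
    (continuous_bumpKernel (V := V))
  refine ⟨max C 1, by positivity, fun y => ?_⟩
  exact (le_abs_self _).trans ((hC y).trans (le_max_left _ _))

variable [MeasurableSpace V] [BorelSpace V]

variable (V) in
/-- The total mass of `bumpKernel`. -/
def bumpMass : ℝ := ∫ y : V, bumpKernel y

lemma integrable_bumpKernel : Integrable (bumpKernel : V → ℝ) :=
  continuous_bumpKernel.integrable_of_hasCompactSupport hasCompactSupport_bumpKernel

lemma bumpMass_pos : 0 < bumpMass V :=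
  continuous_bumpKernel.integral_pos_of_hasCompactSupport_nonneg_nonzero
    hasCompactSupport_bumpKernel bumpKernel_nonneg (x := 0) (bumpKernel_pos (by simp)).ne'

/-- The weight vanishes off the ball, so arbitrary values of `g` there do no harm. -/
lemma integrable_smul_of_continuousOn_closedBall {F : Type*} [NormedAddCommGroup F]
    [NormedSpace ℝ F] {w : V → ℝ} (hw : Continuous w) (hs : Function.support w ⊆ closedBall 0 1)
    {g : V → F} (hg : ContinuousOn g (closedBall 0 1)) : Integrable fun y => w y • g y := by
  have h : Function.support (fun y => w y • g y) ⊆ closedBall 0 1 :=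
    (Function.support_smul_subset_left w g).trans hs
  rw [← integrableOn_iff_integrable_of_support_subset h]
  exact (hw.continuousOn.smul hg).integrableOn_compact (isCompact_closedBall 0 1)

end Kernel

/-! ### Green's identity -/

section Green

variable {V : Type*} [NormedAddCommGroup V] [InnerProductSpace ℝ V] [FiniteDimensional ℝ V]

lemma laplacian_eq_sum_fderiv_fderiv {F : Type*} [NormedAddCommGroup F] [NormedSpace ℝ F]
    {f : V → F} {x : V} (hf : ContDiffAt ℝ 2 f x) :
    Δ f x = ∑ i, fderiv ℝ (fun z => fderiv ℝ f z (stdOrthonormalBasis ℝ V i)) x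
      (stdOrthonormalBasis ℝ V i) := by
  rw [laplacian_eq_iteratedFDeriv_stdOrthonormalBasis]
  refine Finset.sum_congr rfl fun i _ => ?_
  have h : DifferentiableAt ℝ (fderiv ℝ f) x :=
    (hf.fderiv_right (m := 1) (by norm_num)).differentiableAt (by simp)
  rw [iteratedFDeriv_two_apply, fderiv_clm_apply h (differentiableAt_const _)]
  simp

lemma apply_eq_sum_inner {F : Type*} [NormedAddCommGroup F] [NormedSpace ℝ F]
    (L : V →L[ℝ] F) (y : V) :
    L y = ∑ i, inner ℝ y (stdOrthonormalBasis ℝ V i) • L (stdOrthonormalBasis ℝ V i) := by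
  conv_lhs => rw [← (stdOrthonormalBasis ℝ V).sum_repr' y]
  simp [real_inner_comm]

variable [MeasurableSpace V] [BorelSpace V]

/-- Integration by parts without boundary terms: the kernel times y is -1/2 times the gradient of
the compactly supported potential. Summed over an orthonormal basis, this is a weighted divergence
theorem. -/
lemma integral_bumpKernel_inner_smul {X : V → ℂ}
    (hX : ∀ x ∈ closedBall (0 : V) 1, ContDiffAt ℝ 1 X x) (v : V) :
    ∫ y, bumpKernel y • (inner ℝ y v • X y) = (1 / 2 : ℝ) • ∫ y, bumpPotential y • fderiv ℝ X y v := by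
  have hc : ContinuousOn X (closedBall 0 1) := fun x hx => (hX x hx).continuousAt.continuousWithinAt
  have hd : ContinuousOn (fun y => fderiv ℝ X y v) (closedBall 0 1) := fun x hx =>
    (((hX x hx).fderiv_right (m := 0) (by norm_num)).continuousAt.clm_apply
      continuousAt_const).continuousWithinAt
  have h1 : Integrable fun y => fderiv ℝ (bumpPotential : V → ℝ) y v • X y := by
    have : Integrable fun y : V => bumpKernel y • ((-2 * inner ℝ y v) • X y) :=
      integrable_smul_of_continuousOn_closedBall continuous_bumpKernel support_bumpKernel_subset
        (ContinuousOn.smul (f := fun y : V => -2 * inner ℝ y v) (by fun_prop) hc)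
    refine this.congr (Eventually.of_forall fun y => ?_)
    simp only [fderiv_bumpPotential, smul_smul]
    ring_nf
  have key := integral_smul_fderiv_eq_neg_fderiv_smul_of_integrable (μ := volume)
    (f := (bumpPotential : V → ℝ)) (g := X) (v := v) h1
    (integrable_smul_of_continuousOn_closedBall contDiff_bumpPotential.continuous
      support_bumpPotential_subset hd)
    (integrable_smul_of_continuousOn_closedBall contDiff_bumpPotential.continuous
      support_bumpPotential_subset hc)
    (fun x _ => contDiff_bumpPotential.differentiable (by simp) x)
    (fun x hx => (hX x (tsupport_bumpPotential_subset hx)).differentiableAt (by simp))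
  rw [key, ← integral_neg, ← integral_smul]
  refine integral_congr_ae (Eventually.of_forall fun y => ?_)
  simp only [fderiv_bumpPotential, smul_smul, ← neg_smul]
  ring_nf

/-- Green's identity with a radial weight. -/
theorem integral_bumpKernel_green {f h : V → ℂ} (hf : HarmonicOnNhd f (closedBall 0 1))
    (hh : HarmonicOnNhd h (closedBall 0 1)) :
    ∫ y, bumpKernel y • (h y * fderiv ℝ f y y - f y * fderiv ℝ h y y) = 0 := by
  set e := stdOrthonormalBasis ℝ V with he
  let X : Fin (Module.finrank ℝ V) → V → ℂ := fun i y =>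
    h y * fderiv ℝ f y (e i) - f y * fderiv ℝ h y (e i)
  have hD {g : V → ℂ} (hg : HarmonicOnNhd g (closedBall 0 1)) (i) (x : V)
      (hx : x ∈ closedBall (0 : V) 1) : ContDiffAt ℝ 1 (fun y => fderiv ℝ g y (e i)) x :=
    ((hg x hx).1.fderiv_right (m := 1) (by norm_num)).clm_apply contDiffAt_const
  have hX : ∀ i, ∀ x ∈ closedBall (0 : V) 1, ContDiffAt ℝ 1 (X i) x := fun i x hx =>
    (((hh x hx).1.of_le (by norm_num)).mul (hD hf i x hx)).sub
      (((hf x hx).1.of_le (by norm_num)).mul (hD hh i x hx))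
  have h1 : ∀ y, bumpKernel y • (h y * fderiv ℝ f y y - f y * fderiv ℝ h y y) =
      ∑ i, bumpKernel y • (inner ℝ y (e i) • X i y) := by
    intro y
    rw [← Finset.smul_sum, apply_eq_sum_inner (fderiv ℝ f y), apply_eq_sum_inner (fderiv ℝ h y),
      Finset.mul_sum, Finset.mul_sum, ← Finset.sum_sub_distrib]
    congr 1
    refine Finset.sum_congr rfl fun i _ => ?_
    simp only [X, Complex.real_smul]
    ring
  -- div(h∇f - f∇h) = hΔf - fΔh: the products of first derivatives cancel.
  have hdiv : ∀ y ∈ closedBall (0 : V) 1, ∑ i, fderiv ℝ (X i) y (e i) = 0 := by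
    intro y hy
    have hfy := hf y hy
    have hhy := hh y hy
    have e1 : ∀ i, fderiv ℝ (X i) y (e i) =
        h y * fderiv ℝ (fun z => fderiv ℝ f z (e i)) y (e i) -
          f y * fderiv ℝ (fun z => fderiv ℝ h z (e i)) y (e i) := by
      intro i
      have a1 := (hfy.1.differentiableAt (by simp))
      have a2 := (hhy.1.differentiableAt (by simp))
      have a3 := (hD hf i y hy).differentiableAt (by simp)
      have a4 := (hD hh i y hy).differentiableAt (by simp)
      have b := (a2.hasFDerivAt.mul a3.hasFDerivAt).sub (a1.hasFDerivAt.mul a4.hasFDerivAt)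
      rw [show fderiv ℝ (X i) y = _ from b.fderiv]
      simp
      ring
    simp_rw [e1, Finset.sum_sub_distrib, ← Finset.mul_sum]
    rw [← laplacian_eq_sum_fderiv_fderiv hfy.1, ← laplacian_eq_sum_fderiv_fderiv hhy.1,
      hfy.2.self_of_nhds, hhy.2.self_of_nhds]
    simp
  simp_rw [h1]
  rw [integral_finsetSum]
  · simp_rw [integral_bumpKernel_inner_smul (hX _)]
    rw [← Finset.smul_sum, ← integral_finsetSum]
    · simp_rw [← Finset.smul_sum]
      rw [integral_eq_zero_of_ae, smul_zero]
      refine Eventually.of_forall fun y => ?_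
      by_cases hy : y ∈ closedBall (0 : V) 1
      · simp [hdiv y hy]
      · have : bumpPotential y = 0 := by
          by_contra hne
          exact hy (support_bumpPotential_subset hne)
        simp [this]
    · intro i _
      refine integrable_smul_of_continuousOn_closedBall contDiff_bumpPotential.continuous
        support_bumpPotential_subset fun x hx => ?_
      exact (((hX i x hx).fderiv_right (m := 0) (by norm_num)).continuousAt.clm_apply
        continuousAt_const).continuousWithinAt
  · intro i _
    refine integrable_smul_of_continuousOn_closedBall continuous_bumpKernel
      support_bumpKernel_subset fun x hx => ?_
    exact (ContinuousAt.smul (f := fun y : V => inner ℝ y (e i)) (by fun_prop) (hX i x hx).continuousAt).continuousWithinAt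

end Green

/-! ### Dilates of harmonic functions and the mean value property -/

section Dilation

variable {V : Type*} [NormedAddCommGroup V] [InnerProductSpace ℝ V] [FiniteDimensional ℝ V]

lemma hasFDerivAt_comp_dilation {f : V → ℂ} {x₀ y : V} {r : ℝ}
    (hf : DifferentiableAt ℝ f (x₀ + r • y)) :
    HasFDerivAt (fun z => f (x₀ + r • z)) (r • fderiv ℝ f (x₀ + r • y)) y := by
  have h1 : HasFDerivAt (fun z : V => x₀ + r • z) (r • ContinuousLinearMap.id ℝ V) y :=
    ((hasFDerivAt_id y).const_smul r).const_add x₀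
  have h2 : HasFDerivAt (fun z => f (x₀ + r • z))
      ((fderiv ℝ f (x₀ + r • y)).comp (r • ContinuousLinearMap.id ℝ V)) y :=
    hf.hasFDerivAt.comp y h1
  rwa [ContinuousLinearMap.comp_smul, ContinuousLinearMap.comp_id] at h2

lemma harmonicAt_comp_dilation {f : V → ℂ} {x₀ y : V} {r : ℝ} (hf : HarmonicAt f (x₀ + r • y)) :
    HarmonicAt (fun z => f (x₀ + r • z)) y := by
  have hcont : ContinuousAt (fun z : V => x₀ + r • z) y := by fun_prop
  refine ⟨hf.1.comp y (by fun_prop), ?_⟩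
  have hev : ∀ᶠ z in 𝓝 y, HarmonicAt f (x₀ + r • z) := hcont.eventually hf.eventually
  filter_upwards [hev.eventually_nhds] with z hz
  have hz0 := hz.self_of_nhds
  have e1 : ∀ v : V, (fun w => fderiv ℝ (fun z => f (x₀ + r • z)) w v) =ᶠ[𝓝 z]
      fun w => r • fderiv ℝ f (x₀ + r • w) v := by
    intro v
    filter_upwards [hz] with w hw
    rw [(hasFDerivAt_comp_dilation (hw.1.differentiableAt (by simp))).fderiv]
    simp
  have e2 : ∀ v : V, fderiv ℝ (fun w => fderiv ℝ (fun z => f (x₀ + r • z)) w v) z v =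
      r • r • fderiv ℝ (fun w => fderiv ℝ f w v) (x₀ + r • z) v := by
    intro v
    have hd : DifferentiableAt ℝ (fun w => fderiv ℝ f w v) (x₀ + r • z) :=
      ((hz0.1.fderiv_right (m := 1) (by norm_num)).clm_apply contDiffAt_const).differentiableAt
        (by simp)
    rw [(e1 v).fderiv_eq]
    have := ((hasFDerivAt_comp_dilation hd).const_smul r).fderiv
    rw [show (fun w => r • (fderiv ℝ f (x₀ + r • w)) v) =
      r • (fun w => (fderiv ℝ f (x₀ + r • w)) v) from rfl, this]
    simp
  rw [laplacian_eq_sum_fderiv_fderiv (f := fun z => f (x₀ + r • z)) (hz0.1.comp z (by fun_prop))]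
  simp_rw [e2, ← Finset.smul_sum]
  rw [← laplacian_eq_sum_fderiv_fderiv hz0.1, hz0.2.self_of_nhds]
  simp

variable [MeasurableSpace V] [BorelSpace V]

lemma add_smul_mem_closedBall {x₀ y : V} {r R : ℝ} (hr : |r| ≤ R) (hy : y ∈ closedBall (0 : V) 1) :
    x₀ + r • y ∈ closedBall x₀ R := by
  have h1 : ‖y‖ ≤ 1 := by simpa using hy
  rw [mem_closedBall, dist_eq_norm, add_sub_cancel_left, norm_smul, Real.norm_eq_abs]
  nlinarith [abs_nonneg r, norm_nonneg y]

/-- Differentiation under the integral. The range |r| < R includes r = 0, where the mean value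
property needs continuity. -/
lemma hasDerivAt_integral_bumpKernel_dilation {f g : V → ℂ} {x₀ : V} {R : ℝ}
    (hf : ContDiffOn ℝ 1 f (ball x₀ R)) (hg : ContinuousOn g (closedBall 0 1)) {r : ℝ}
    (hr : |r| < R) :
    HasDerivAt (fun s : ℝ => ∫ y, bumpKernel y • (g y * f (x₀ + s • y)))
      (∫ y, bumpKernel y • (g y * fderiv ℝ f (x₀ + r • y) y)) r := by
  -- An intermediate radius gives a compact ball on which the derivative of `f` is bounded uniformly
  -- for nearby dilations.
  obtain ⟨R', hR'1, hR'2⟩ := exists_between hr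
  have hsub : closedBall x₀ R' ⊆ ball x₀ R := closedBall_subset_ball hR'2
  have hmaps : ∀ s ∈ ball r (R' - |r|), ∀ y ∈ closedBall (0 : V) 1,
      x₀ + s • y ∈ closedBall x₀ R' := by
    intro s hs y hy
    refine add_smul_mem_closedBall ?_ hy
    have : |s - r| < R' - |r| := by simpa [Real.dist_eq] using hs
    have := abs_sub_abs_le_abs_sub s r
    linarith
  have hcf : ContinuousOn f (closedBall x₀ R') := hf.continuousOn.mono hsub
  have hcd : ContinuousOn (fderiv ℝ f) (closedBall x₀ R') :=
    (hf.continuousOn_fderiv_of_isOpen isOpen_ball (by simp)).mono hsub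
  obtain ⟨C₁, hC₁⟩ := (isCompact_closedBall x₀ R').exists_bound_of_continuousOn hcd
  obtain ⟨C₂, hC₂⟩ := (isCompact_closedBall (0 : V) 1).exists_bound_of_continuousOn hg
  have hint : ∀ s ∈ ball r (R' - |r|),
      Integrable fun y => bumpKernel y • (g y * f (x₀ + s • y)) := by
    intro s hs
    refine integrable_smul_of_continuousOn_closedBall continuous_bumpKernel
      support_bumpKernel_subset (hg.mul (hcf.comp (by fun_prop) fun y hy => hmaps s hs y hy))
  have hrmem : r ∈ ball r (R' - |r|) := mem_ball_self (by linarith)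
  refine (hasDerivAt_integral_of_dominated_loc_of_deriv_le
    (F := fun s y => bumpKernel y • (g y * f (x₀ + s • y)))
    (F' := fun s y => bumpKernel y • (g y * fderiv ℝ f (x₀ + s • y) y))
    (bound := fun y => bumpKernel y * (C₂ * C₁)) (ball_mem_nhds r (by linarith : 0 < R' - |r|))
    ?_ (hint r hrmem) ?_ ?_ ?_ ?_).2
  · filter_upwards [ball_mem_nhds r (by linarith : 0 < R' - |r|)] with s hs
    exact (hint s hs).aestronglyMeasurable
  · refine (integrable_smul_of_continuousOn_closedBall continuous_bumpKernel
      support_bumpKernel_subset (hg.mul ?_)).aestronglyMeasurable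
    exact (hcd.comp (f := fun y : V => x₀ + r • y) (by fun_prop)
      fun y hy => hmaps r hrmem y hy).clm_apply continuousOn_id
  · refine Eventually.of_forall fun y s hs => ?_
    by_cases hy : y ∈ closedBall (0 : V) 1
    · rw [norm_smul, Real.norm_of_nonneg (bumpKernel_nonneg y), norm_mul]
      have hy1 : ‖y‖ ≤ 1 := by simpa using hy
      have h1 := hC₁ _ (hmaps s hs y hy)
      have h2 := hC₂ y hy
      refine mul_le_mul_of_nonneg_left ?_ (bumpKernel_nonneg y)
      refine mul_le_mul h2 ?_ (norm_nonneg _) ((norm_nonneg _).trans h2)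
      refine (ContinuousLinearMap.le_opNorm _ _).trans ?_
      exact (mul_le_of_le_one_right (norm_nonneg _) hy1).trans h1
    · have : bumpKernel y = 0 := by
        by_contra hne
        exact hy (support_bumpKernel_subset hne)
      simp [this]
  · exact integrable_bumpKernel.mul_const _
  · refine Eventually.of_forall fun y s hs => ?_
    by_cases hy : y ∈ closedBall (0 : V) 1
    · have hd : DifferentiableAt ℝ f (x₀ + s • y) :=
        (hf.differentiableOn (by simp)).differentiableAt
          (isOpen_ball.mem_nhds (hsub (hmaps s hs y hy)))
      have h1 : HasDerivAt (fun s : ℝ => x₀ + s • y) y s := by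
        simpa using ((hasDerivAt_id s).smul_const y).const_add x₀
      have h2 := hd.hasFDerivAt.comp_hasDerivAt s h1
      exact (h2.const_mul (g y)).const_smul (bumpKernel y)
    · have : bumpKernel y = 0 := by
        by_contra hne
        exact hy (support_bumpKernel_subset hne)
      simpa [this] using hasDerivAt_const s (0 : ℂ)

/-- The weighted pairing of the dilates of a harmonic function with a homogeneous harmonic function
is homogeneous in the dilation parameter. -/
theorem exists_integral_bumpKernel_eq_const_mul_pow {f h : V → ℂ} {x₀ : V} {R : ℝ} (k : ℕ)
    (hf : HarmonicOnNhd f (ball x₀ R)) (hh : HarmonicOnNhd h Set.univ)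
    (hk : ∀ y, fderiv ℝ h y y = k * h y) :
    ∃ c : ℂ, ∀ r ∈ Set.Ioo 0 R,
      ∫ y, bumpKernel y • (h y * f (x₀ + r • y)) = c * (r : ℂ) ^ k := by
  set J : ℝ → ℂ := fun r => ∫ y, bumpKernel y • (h y * f (x₀ + r • y)) with hJ
  have hhc : ContinuousOn h (closedBall 0 1) := (hh.mono (Set.subset_univ _)).continuousOn
  -- Green's identity moves the radial derivative from the dilate of `f` to `h`, where Euler's
  -- relation `hk` turns it into the factor k.
  have hder : ∀ r ∈ Set.Ioo 0 R, HasDerivAt J (k / r * J r) r := by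
    intro r hr
    have habs : |r| < R := by rw [abs_of_pos hr.1]; exact hr.2
    have h1 := hasDerivAt_integral_bumpKernel_dilation (hf.contDiffOn.of_le (by norm_num)) hhc habs
    convert h1 using 1
    have hF : HarmonicOnNhd (fun z => f (x₀ + r • z)) (closedBall 0 1) := fun y hy =>
      harmonicAt_comp_dilation (hf _ (closedBall_subset_ball habs (add_smul_mem_closedBall le_rfl hy)))
    have hG := integral_bumpKernel_green hF (hh.mono (Set.subset_univ _))
    have hfd : ∀ y ∈ closedBall (0 : V) 1,
        fderiv ℝ (fun z => f (x₀ + r • z)) y = r • fderiv ℝ f (x₀ + r • y) := fun y hy =>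
      (hasFDerivAt_comp_dilation ((hf _ (closedBall_subset_ball habs
        (add_smul_mem_closedBall le_rfl hy))).1.differentiableAt (by simp))).fderiv
    have hpt : ∀ y : V, bumpKernel y • (h y * fderiv ℝ (fun z => f (x₀ + r • z)) y y -
        f (x₀ + r • y) * fderiv ℝ h y y) = (r : ℂ) * (bumpKernel y • (h y * fderiv ℝ f (x₀ + r • y) y)) -
          k * (bumpKernel y • (h y * f (x₀ + r • y))) := by
      intro y
      by_cases hy : y ∈ closedBall (0 : V) 1
      · rw [hfd y hy, hk]
        simp
        ring
      · have : bumpKernel y = 0 := by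
          by_contra hne
          exact hy (support_bumpKernel_subset hne)
        simp [this]
    simp_rw [hpt] at hG
    have hmem : ∀ y ∈ closedBall (0 : V) 1, x₀ + r • y ∈ ball x₀ R := fun y hy =>
      closedBall_subset_ball habs (add_smul_mem_closedBall le_rfl hy)
    have i1 : Integrable fun y : V => bumpKernel y • (h y * fderiv ℝ f (x₀ + r • y) y) := by
      refine integrable_smul_of_continuousOn_closedBall continuous_bumpKernel
        support_bumpKernel_subset (hhc.mul ?_)
      exact ((hf.contDiffOn.continuousOn_fderiv_of_isOpen isOpen_ball (by simp)).comp
        (f := fun y : V => x₀ + r • y) (by fun_prop) hmem).clm_apply continuousOn_id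
    have i2 : Integrable fun y : V => bumpKernel y • (h y * f (x₀ + r • y)) :=
      integrable_smul_of_continuousOn_closedBall continuous_bumpKernel
        support_bumpKernel_subset (hhc.mul (hf.continuousOn.comp (by fun_prop) hmem))
    rw [integral_sub (i1.const_mul _) (i2.const_mul _), integral_const_mul, integral_const_mul,
      sub_eq_zero] at hG
    have hr0 : (r : ℂ) ≠ 0 := by exact_mod_cast hr.1.ne'
    rw [div_mul_eq_mul_div, div_eq_iff hr0, ← hG, mul_comm]
  rcases le_or_gt R 0 with hR | hR
  · exact ⟨0, fun r hr => absurd (hr.1.trans hr.2) (not_lt.2 hR)⟩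
  have hder2 : ∀ r ∈ Set.Ioo 0 R, HasDerivAt (fun r : ℝ => J r * ((r : ℂ) ^ k)⁻¹) 0 r := by
    intro r hr
    have hr0 : (r : ℂ) ≠ 0 := by exact_mod_cast hr.1.ne'
    have h2 : HasDerivAt (fun r : ℝ => ((r : ℂ) ^ k)) (k * (r : ℂ) ^ (k - 1) * 1) r :=
      (Complex.ofRealCLM.hasDerivAt (x := r)).pow k
    have h3 := (hder r hr).mul (h2.inv (pow_ne_zero k hr0))
    have h4 : (k / r * J r * ((r : ℂ) ^ k)⁻¹ +
        J r * (-(k * (r : ℂ) ^ (k - 1) * 1) / ((r : ℂ) ^ k) ^ 2)) = 0 := by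
      rcases k with _ | k
      · simp
      · push_cast
        field_simp
        ring
    rw [← h4]
    exact h3
  refine ⟨J (R / 2) * (((R / 2 : ℝ) : ℂ) ^ k)⁻¹, fun r hr => ?_⟩
  have hconst : J r * ((r : ℂ) ^ k)⁻¹ = J (R / 2) * (((R / 2 : ℝ) : ℂ) ^ k)⁻¹ :=
    isOpen_Ioo.is_const_of_deriv_eq_zero isPreconnected_Ioo
      (fun s hs => (hder2 s hs).differentiableAt.differentiableWithinAt)
      (fun s hs => (hder2 s hs).deriv) hr ⟨by positivity, by linarith⟩
  have hr0 : (r : ℂ) ≠ 0 := by exact_mod_cast hr.1.ne'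
  rw [← hconst, inv_mul_cancel_right₀ (pow_ne_zero k hr0)]

/-- The mean value property with the radial weight `bumpKernel`. -/
theorem mean_value_of_harmonicOnNhd {f : V → ℂ} {x₀ : V} {R r : ℝ}
    (hf : HarmonicOnNhd f (ball x₀ R)) (hr : 0 ≤ r) (hrR : r < R) :
    ∫ y, bumpKernel y • f (x₀ + r • y) = bumpMass V • f x₀ := by
  have h1 : ∫ y : V, bumpKernel y • f (x₀ + (0 : ℝ) • y) = bumpMass V • f x₀ := by
    simp [bumpMass, integral_mul_const, integral_complex_ofReal]
  rcases hr.eq_or_lt with rfl | hr0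
  · exact h1
  -- Pairing with the constant 1, of degree 0, makes the average independent of the radius. Letting
  -- the radius tend to 0 identifies the constant.
  obtain ⟨c, hc⟩ := exists_integral_bumpKernel_eq_const_mul_pow (h := fun _ => 1) 0 hf
    (harmonicOnNhd_const 1) (by simp)
  simp only [one_mul, pow_zero, mul_one] at hc
  have h2 : ContinuousAt (fun s : ℝ => ∫ y, bumpKernel y • f (x₀ + s • y)) 0 := by
    have := (hasDerivAt_integral_bumpKernel_dilation (g := fun _ => 1) (r := 0)
      (hf.contDiffOn.of_le (by norm_num)) continuousOn_const (by simpa using hr0.trans hrR)).continuousAt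
    simpa using this
  have h3 : Tendsto (fun s : ℝ => ∫ y, bumpKernel y • f (x₀ + s • y)) (𝓝[>] 0) (𝓝 c) := by
    refine tendsto_const_nhds.congr' ?_
    filter_upwards [Ioo_mem_nhdsGT (hr0.trans hrR)] with s hs
    exact (hc s hs).symm
  rw [hc r ⟨hr0, hrR⟩, ← h1]
  exact tendsto_nhds_unique h3 (h2.tendsto.mono_left nhdsWithin_le_nhds)

end Dilation

open scoped ContDiff Laplacian Convolution

/-! ### Smoothness of harmonic functions -/

section Smooth

variable {V : Type*} [NormedAddCommGroup V] [InnerProductSpace ℝ V] [FiniteDimensional ℝ V]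
  [MeasurableSpace V] [BorelSpace V]

lemma integral_bumpKernel_smul_eq {F : Type*} [NormedAddCommGroup F] [NormedSpace ℝ F]
    (g : V → F) (x : V) {r : ℝ} (hr : 0 < r) :
    ∫ y, bumpKernel y • g (x + r • y) =
      (r ^ Module.finrank ℝ V)⁻¹ • ∫ z, bumpKernel (r⁻¹ • (z - x)) • g z := by
  have h1 : ∀ y : V, bumpKernel y • g (x + r • y) =
      (fun z => bumpKernel (r⁻¹ • z) • g (x + z)) (r • y) := fun y => by
    simp [smul_smul, hr.ne']
  rw [integral_congr_ae (Eventually.of_forall h1),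
    Measure.integral_comp_smul_of_nonneg volume (fun z => bumpKernel (r⁻¹ • z) • g (x + z)) r
      (hR := hr.le)]
  congr 1
  rw [← integral_add_left_eq_self (fun z => bumpKernel (r⁻¹ • (z - x)) • g z) x]
  simp only [add_sub_cancel_left]

/-- Harmonic functions are smooth. -/
theorem contDiffAt_of_harmonicAt {f : V → ℂ} {x₀ : V} (hf : HarmonicAt f x₀) :
    ContDiffAt ℝ ∞ f x₀ := by
  obtain ⟨R, hR, hball⟩ := Metric.eventually_nhds_iff_ball.1 hf.eventually
  have hfR : HarmonicOnNhd f (ball x₀ R) := hball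
  set d := R / 3 with hd
  have hd0 : 0 < d := by positivity
  -- For x within d of x₀ the average of radius d only sees values inside this ball. Hence f agrees
  -- near x₀ with a constant times the convolution of an integrable function with a smooth kernel.
  set F : V → ℂ := (closedBall x₀ (2 * d)).indicator f with hF
  have hFint : Integrable F := by
    rw [hF, integrable_indicator_iff isClosed_closedBall.measurableSet]
    exact (hfR.continuousOn.mono (closedBall_subset_ball (by linarith))).integrableOn_compact
      (isCompact_closedBall _ _)
  set g : V → ℝ := fun z => bumpKernel (d⁻¹ • z) with hg
  have hgs : ContDiff ℝ ∞ g := contDiff_bumpKernel.comp (contDiff_const_smul d⁻¹)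
  have hgc : HasCompactSupport g :=
    hasCompactSupport_bumpKernel.comp_homeomorph (Homeomorph.smulOfNeZero d⁻¹ (by positivity))
  have hconv : ContDiff ℝ ∞ (F ⋆[(ContinuousLinearMap.lsmul ℝ ℝ).flip, volume] g) :=
    hgc.contDiff_convolution_right _ hFint.locallyIntegrable hgs
  have hev : f =ᶠ[𝓝 x₀] fun x => ((bumpMass V)⁻¹ * (d ^ Module.finrank ℝ V)⁻¹) •
      (F ⋆[(ContinuousLinearMap.lsmul ℝ ℝ).flip, volume] g) x := by
    filter_upwards [ball_mem_nhds x₀ hd0] with x hx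
    have hx' : dist x x₀ < d := hx
    have hsub : ball x (2 * d) ⊆ ball x₀ R := ball_subset_ball' (by linarith)
    have hmv := mean_value_of_harmonicOnNhd (hfR.mono hsub) hd0.le (by linarith : d < 2 * d)
    have h2 : ∫ y, bumpKernel y • f (x + d • y) = ∫ y, bumpKernel y • F (x + d • y) := by
      refine integral_congr_ae (Eventually.of_forall fun y => ?_)
      by_cases hy : y ∈ closedBall (0 : V) 1
      · have : x + d • y ∈ closedBall x₀ (2 * d) :=
          closedBall_subset_closedBall' (by linarith)
            (add_smul_mem_closedBall (abs_of_pos hd0).le hy)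
        simp [hF, this]
      · have : bumpKernel y = 0 := by
          by_contra hne
          exact hy (support_bumpKernel_subset hne)
        simp [this]
    rw [h2, integral_bumpKernel_smul_eq F x hd0] at hmv
    have h3 : (F ⋆[(ContinuousLinearMap.lsmul ℝ ℝ).flip, volume] g) x =
        ∫ z, bumpKernel (d⁻¹ • (z - x)) • F z := by
      rw [convolution_def]
      refine integral_congr_ae (Eventually.of_forall fun z => ?_)
      have : bumpKernel (d⁻¹ • (x - z)) = bumpKernel (d⁻¹ • (z - x)) := by
        rw [← bumpKernel_neg, ← smul_neg, neg_sub]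
      simp [hg, this]
    rw [h3, mul_smul, hmv, smul_smul, inv_mul_cancel₀ bumpMass_pos.ne', one_smul]
  have hsm := (contDiff_const (c := (bumpMass V)⁻¹ * (d ^ Module.finrank ℝ V)⁻¹)).smul hconv
  exact hsm.contDiffAt.congr_of_eventuallyEq hev

end Smooth

/-! ### Homogeneous parts and their derivatives -/

section HomogPart

variable {n : ℕ} {f g : E n → ℂ} {k : ℕ} {x v : E n}

lemma two_le_infty : (2 : WithTop ℕ∞) ≤ ((⊤ : ℕ∞) : WithTop ℕ∞) := by
  exact WithTop.coe_le_coe.2 (le_top : (2 : ℕ∞) ≤ (⊤ : ℕ∞))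

lemma homogPart_zero : homogPart f 0 x = f 0 := by simp [homogPart]

lemma homogPart_congr (h : f =ᶠ[𝓝 0] g) (k : ℕ) : homogPart f k = homogPart g k := by
  ext x
  simp [homogPart, (h.iteratedFDeriv ℝ k).self_of_nhds]

lemma homogPart_smul (f : E n → ℂ) (k : ℕ) (r : ℝ) (x : E n) :
    homogPart f k (r • x) = r ^ k • homogPart f k x := by
  have h := (iteratedFDeriv ℝ k f 0).map_smul_univ (fun _ => r) (fun _ => x)
  simp only [Finset.prod_const, Finset.card_univ, Fintype.card_fin] at h
  simp only [homogPart, h]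
  rw [smul_comm]

lemma contDiff_homogPart (f : E n → ℂ) (k : ℕ) : ContDiff ℝ ∞ (homogPart f k) :=
  ContDiff.smul (f := fun _ => ((k ! : ℝ)⁻¹)) contDiff_const
    ((iteratedFDeriv ℝ k f 0).contDiff.comp (contDiff_pi.2 fun _ => contDiff_id))

lemma continuous_homogPart (f : E n → ℂ) (k : ℕ) : Continuous (homogPart f k) :=
  (contDiff_homogPart f k).continuous

lemma homogPart_sub (hf : ContDiffAt ℝ ∞ f 0) (hg : ContDiffAt ℝ ∞ g 0) :
    homogPart (f - g) k x = homogPart f k x - homogPart g k x := by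
  have h1 : ContDiffAt ℝ k f 0 := hf.of_le (by exact_mod_cast le_top)
  have h2 : ContDiffAt ℝ k g 0 := hg.of_le (by exact_mod_cast le_top)
  simp [homogPart, iteratedFDeriv_sub_apply h1 h2, smul_sub]

lemma homogPart_sum {ι : Type*} (s : Finset ι) {F : ι → E n → ℂ}
    (hF : ∀ i ∈ s, ContDiffAt ℝ ∞ (F i) 0) :
    homogPart (fun y => ∑ i ∈ s, F i y) k x = ∑ i ∈ s, homogPart (F i) k x := by
  have h : ∀ i ∈ s, ContDiffAt ℝ k (F i) 0 := fun i hi => (hF i hi).of_le (by exact_mod_cast le_top)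
  have := iteratedFDeriv_fun_sum_apply (𝕜 := ℝ) h
  simp [homogPart, this, Finset.mul_sum]

lemma homogPart_comp_smul {r : ℝ} (hr : r ≠ 0) :
    homogPart (fun y => f (r • y)) k x = r ^ k • homogPart f k x := by
  have h := (ContinuousLinearEquiv.smulLeft (Units.mk0 r hr) :
    E n ≃L[ℝ] E n).iteratedFDerivWithin_comp_right f uniqueDiffOn_univ (x := 0)
    (Set.mem_univ _) k
  rw [Set.preimage_univ, iteratedFDerivWithin_univ, iteratedFDerivWithin_univ] at h
  have h2 : homogPart (fun y => f (r • y)) k x = homogPart f k (r • x) := by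
    simp only [homogPart]
    congr 1
    have := congrArg (fun A => A fun _ => x) h
    simp only [ContinuousMultilinearMap.compContinuousLinearMap_apply, map_zero] at this
    exact this
  rw [h2, homogPart_smul]

lemma contDiffAt_fderiv_apply {x₀ : E n} (hf : ContDiffAt ℝ ∞ f x₀) (v : E n) :
    ContDiffAt ℝ ∞ (fun y => fderiv ℝ f y v) x₀ :=
  (hf.fderiv_right (m := ∞) le_rfl).clm_apply contDiffAt_const

lemma homogPart_fderiv_apply (hf : ContDiffAt ℝ ∞ f 0) :
    homogPart (fun y => fderiv ℝ f y v) k x =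
      ((k ! : ℝ)⁻¹) • iteratedFDeriv ℝ k (fderiv ℝ f) 0 (fun _ => x) v := by
  have h1 : ContDiffAt ℝ k (fderiv ℝ f) 0 :=
    (hf.fderiv_right (m := ∞) le_rfl).of_le (by exact_mod_cast le_top)
  have h2 := (ContinuousLinearMap.apply ℝ ℂ v).iteratedFDeriv_comp_left h1 (i := k) le_rfl
  have h3 : (⇑(ContinuousLinearMap.apply ℝ ℂ v) ∘ fderiv ℝ f) = fun y => fderiv ℝ f y v := rfl
  rw [h3] at h2
  simp [homogPart, h2]

/-- Euler's relation as a recursion on the degree: it replaces a part of `f` by a lower part of a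
directional derivative, which drives the inductions below. -/
lemma homogPart_succ (hf : ContDiffAt ℝ ∞ f 0) :
    homogPart f (k + 1) x = ((k : ℝ) + 1)⁻¹ • homogPart (fun y => fderiv ℝ f y x) k x := by
  rw [homogPart_fderiv_apply hf, homogPart, iteratedFDeriv_succ_apply_right, smul_smul,
    Nat.factorial_succ]
  push_cast
  rw [mul_inv]
  rfl

lemma homogPart_fderiv_apply_eq_sum (hf : ContDiffAt ℝ ∞ f 0) :
    homogPart (fun y => fderiv ℝ f y v) k x = ∑ i, inner ℝ v (stdOrthonormalBasis ℝ (E n) i) •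
      homogPart (fun y => fderiv ℝ f y (stdOrthonormalBasis ℝ (E n) i)) k x := by
  rw [homogPart_fderiv_apply hf, apply_eq_sum_inner, Finset.smul_sum]
  refine Finset.sum_congr rfl fun i _ => ?_
  rw [homogPart_fderiv_apply hf, smul_comm]

lemma fderiv_fderiv_apply_comm {x₀ : E n} (hf : ContDiffAt ℝ ∞ f x₀) (v w : E n) :
    (fun y => fderiv ℝ (fun z => fderiv ℝ f z v) y w) =ᶠ[𝓝 x₀]
      fun y => fderiv ℝ (fun z => fderiv ℝ f z w) y v := by
  have h2 : ContDiffAt ℝ 2 f x₀ := hf.of_le two_le_infty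
  filter_upwards [h2.eventually (by simp)] with y hy
  have hd : DifferentiableAt ℝ (fderiv ℝ f) y :=
    (hy.fderiv_right (m := 1) (by norm_num)).differentiableAt (by simp)
  have hs := hy.isSymmSndFDerivAt (by simp)
  rw [fderiv_clm_apply hd (differentiableAt_const _), fderiv_clm_apply hd (differentiableAt_const _)]
  simpa using hs.eq w v

/-- The product rule applied to the recursion of `homogPart_succ`, with the direction x expanded in
an orthonormal basis. -/
lemma fderiv_homogPart_succ_eq_sum (hf : ContDiffAt ℝ ∞ f 0) (k : ℕ) (x v : E n) :
    fderiv ℝ (homogPart f (k + 1)) x v = ((k : ℝ) + 1)⁻¹ •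
      (homogPart (fun y => fderiv ℝ f y v) k x + ∑ i, inner ℝ x (stdOrthonormalBasis ℝ (E n) i) •
        fderiv ℝ (homogPart (fun y => fderiv ℝ f y (stdOrthonormalBasis ℝ (E n) i)) k) x v) := by
  set e := stdOrthonormalBasis ℝ (E n) with he
  have hformula : homogPart f (k + 1) = fun x => ((k : ℝ) + 1)⁻¹ •
      ∑ i, inner ℝ x (e i) • homogPart (fun y => fderiv ℝ f y (e i)) k x := by
    ext x
    rw [homogPart_succ hf, homogPart_fderiv_apply_eq_sum hf]
  have hinner : ∀ i, HasFDerivAt (fun x : E n => inner ℝ x (e i)) (innerSL ℝ (e i)) x := by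
    intro i
    have : (fun x : E n => inner ℝ x (e i)) = innerSL ℝ (e i) := by
      ext x; simp [real_inner_comm]
    rw [this]
    exact (innerSL ℝ (e i)).hasFDerivAt
  have hterm : ∀ i, HasFDerivAt
      (fun x => inner ℝ x (e i) • homogPart (fun y => fderiv ℝ f y (e i)) k x)
      (inner ℝ x (e i) • fderiv ℝ (homogPart (fun y => fderiv ℝ f y (e i)) k) x +
        (innerSL ℝ (e i)).smulRight (homogPart (fun y => fderiv ℝ f y (e i)) k x)) x := by
    intro i
    have hi := ((contDiff_homogPart (fun y => fderiv ℝ f y (e i)) k).differentiable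
      (by simp) x).hasFDerivAt
    exact (hinner i).smul hi
  have hsum := (HasFDerivAt.fun_sum (u := Finset.univ) fun i _ => hterm i).const_smul
    (((k : ℝ) + 1)⁻¹)
  have hsum' := hsum.congr_of_eventuallyEq (f₁ := homogPart f (k + 1)) (by rw [hformula]; rfl)
  rw [hsum'.fderiv, homogPart_fderiv_apply_eq_sum hf (v := v), ← Finset.sum_add_distrib]
  simp only [smul_apply, sum_apply, add_apply,
    ContinuousLinearMap.smulRight_apply, innerSL_apply_apply]
  congr 1
  refine Finset.sum_congr rfl fun i _ => ?_
  rw [add_comm, real_inner_comm]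

/-- Differentiation commutes with taking homogeneous parts. -/
theorem fderiv_homogPart_succ (hf : ContDiffAt ℝ ∞ f 0) (k : ℕ) (x v : E n) :
    fderiv ℝ (homogPart f (k + 1)) x v = homogPart (fun y => fderiv ℝ f y v) k x := by
  induction k generalizing f with
  | zero =>
    have (g : E n → ℂ) : homogPart g 0 = fun _ => g 0 := by
      ext x; exact homogPart_zero
    simp [fderiv_homogPart_succ_eq_sum hf, this]
  | succ k ih =>
    set e := stdOrthonormalBasis ℝ (E n) with he
    -- By induction and symmetry of second derivatives the sum over i becomes a directional
    -- derivative of ∂_v f along x. By `homogPart_succ` it contributes k+1 copies of the (k+1)-part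
    -- of ∂_v f, which join the one already present.
    have h1 : ∀ i, fderiv ℝ (homogPart (fun y => fderiv ℝ f y (e i)) (k + 1)) x v =
        homogPart (fun y => fderiv ℝ (fun z => fderiv ℝ f z v) y (e i)) k x := fun i => by
      rw [ih (contDiffAt_fderiv_apply hf _), homogPart_congr (fderiv_fderiv_apply_comm hf (e i) v) k]
    rw [fderiv_homogPart_succ_eq_sum hf, ← he]
    simp_rw [h1]
    rw [he, ← homogPart_fderiv_apply_eq_sum (contDiffAt_fderiv_apply hf v)]
    have h2 := homogPart_succ (k := k) (x := x) (contDiffAt_fderiv_apply hf v)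
    have hk : ((k : ℝ) + 1) ≠ 0 := by positivity
    have h3 := (eq_inv_smul_iff₀ hk).1 h2
    have hk2 : (((k + 1 : ℕ) : ℝ) + 1) ≠ 0 := by positivity
    rw [← h3, inv_smul_eq_iff₀ hk2]
    push_cast
    module

/-- Euler's identity for homogeneous parts. -/
lemma fderiv_homogPart_self (hf : ContDiffAt ℝ ∞ f 0) (k : ℕ) (x : E n) :
    fderiv ℝ (homogPart f k) x x = k * homogPart f k x := by
  rcases k with _ | k
  · have : homogPart f 0 = fun _ => f 0 := by
      ext x; exact homogPart_zero
    simp [this]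
  · have hk : ((k : ℝ) + 1) ≠ 0 := by positivity
    rw [fderiv_homogPart_succ hf, (eq_inv_smul_iff₀ hk).1 (homogPart_succ (k := k) (x := x) hf) |>.symm]
    simp

/-- The homogeneous parts of a harmonic function are harmonic. -/
theorem harmonicOnNhd_homogPart (hf : HarmonicAt f 0) (k : ℕ) :
    HarmonicOnNhd (homogPart f k) Set.univ := by
  have hs : ContDiffAt ℝ ∞ f 0 := contDiffAt_of_harmonicAt hf
  have hzero : ∀ g : E n → ℂ, homogPart g 0 = fun _ => g 0 := fun g => by
    ext x; exact homogPart_zero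
  have hlap : Δ (homogPart f k) = 0 := by
    ext x
    rw [laplacian_eq_sum_fderiv_fderiv
      ((contDiff_homogPart f k).contDiffAt.of_le two_le_infty)]
    -- In degree at least 2 the Laplacian of the part is the part of Δf two degrees lower, which is
    -- 0. Degrees 0 and 1 have no second derivatives.
    rcases k with _ | _ | k
    · simp [hzero]
    · have h1 : ∀ v, (fun z => fderiv ℝ (homogPart f (0 + 1)) z v) = fun _ => fderiv ℝ f 0 v := by
        intro v; ext z
        rw [fderiv_homogPart_succ hs, hzero]
      simp_rw [h1]
      simp
    · have h1 : ∀ v, (fun z => fderiv ℝ (homogPart f (k + 1 + 1)) z v) =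
          homogPart (fun y => fderiv ℝ f y v) (k + 1) := by
        intro v; ext z
        rw [fderiv_homogPart_succ hs]
      simp_rw [h1, fderiv_homogPart_succ (contDiffAt_fderiv_apply hs _)]
      rw [← homogPart_sum _ fun i _ => contDiffAt_fderiv_apply (contDiffAt_fderiv_apply hs _) _]
      have h2 : (fun y => ∑ i, fderiv ℝ (fun z => fderiv ℝ f z (stdOrthonormalBasis ℝ (E n) i)) y
          (stdOrthonormalBasis ℝ (E n) i)) =ᶠ[𝓝 0] fun _ => (0 : ℂ) := by
        filter_upwards [hf.eventually] with y hy
        rw [← laplacian_eq_sum_fderiv_fderiv hy.1, hy.2.self_of_nhds]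
        rfl
      rw [homogPart_congr h2]
      rcases k with _ | k
      · simp [hzero]
      · simp [homogPart]
  intro x _
  exact ⟨(contDiff_homogPart f k).contDiffAt.of_le two_le_infty, by rw [hlap]⟩

end HomogPart

/-! ### Taylor's formula -/

section Taylor

variable {n : ℕ} {f g : E n → ℂ} {k : ℕ} {x v : E n}

lemma opNorm_le_sum_norm_apply (L : E n →L[ℝ] ℂ) :
    ‖L‖ ≤ ∑ i, ‖L (stdOrthonormalBasis ℝ (E n) i)‖ := by
  refine L.opNorm_le_bound (by positivity) fun y => ?_
  rw [apply_eq_sum_inner L y, Finset.sum_mul]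
  refine (norm_sum_le _ _).trans (Finset.sum_le_sum fun i _ => ?_)
  rw [norm_smul, mul_comm]
  refine mul_le_mul_of_nonneg_left ?_ (norm_nonneg _)
  refine (norm_inner_le_norm _ _).trans ?_
  simp

/-- Taylor's formula with homogeneous parts. -/
theorem isBigO_sub_sum_homogPart (hf : ContDiffAt ℝ ∞ f 0) (k : ℕ) :
    (fun y => f y - ∑ j ∈ Finset.range k, homogPart f j y) =O[𝓝 0] fun y => ‖y‖ ^ k := by
  induction k generalizing f with
  | zero => simpa using hf.continuousAt.norm.isBoundedUnder_le.isBigO_one ℝ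
  | succ k ih =>
    set r : E n → ℂ := fun y => f y - ∑ j ∈ Finset.range (k + 1), homogPart f j y with hr
    have hd : ∀ᶠ y in 𝓝 (0 : E n), DifferentiableAt ℝ r y := by
      have h1 : ContDiffAt ℝ 2 f 0 := hf.of_le two_le_infty
      filter_upwards [h1.eventually (by simp)] with y hy
      exact (hy.differentiableAt (by simp)).sub (DifferentiableAt.fun_sum fun j _ =>
        (contDiff_homogPart f j).differentiable (by simp) y)
    -- A derivative of the remainder is the remainder of a derivative, one order lower. The mean
    -- value inequality then gains the missing factor ‖y‖.
    have hdr : ∀ v, (fun y => fderiv ℝ r y v) =O[𝓝 0] fun y => ‖y‖ ^ k := by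
      intro v
      refine (ih (contDiffAt_fderiv_apply hf v)).congr' ?_ EventuallyEq.rfl
      have h1 : ContDiffAt ℝ 2 f 0 := hf.of_le two_le_infty
      filter_upwards [h1.eventually (by simp)] with y hy
      have hj : ∀ j ∈ Finset.range (k + 1), DifferentiableAt ℝ (homogPart f j) y := fun j _ =>
        (contDiff_homogPart f j).differentiable (by simp) y
      have e := ((hy.differentiableAt (by simp)).hasFDerivAt.sub
        (HasFDerivAt.fun_sum fun j hj' => (hj j hj').hasFDerivAt)).fderiv
      have e' : fderiv ℝ r y v = fderiv ℝ f y v -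
          ∑ j ∈ Finset.range (k + 1), fderiv ℝ (homogPart f j) y v := by
        have := congrArg (fun L => L v) e
        simp only [sub_apply, sum_apply] at this
        exact this
      have h0 : homogPart f 0 = fun _ => f 0 := by ext x; exact homogPart_zero
      rw [e', Finset.sum_range_succ']
      simp_rw [fderiv_homogPart_succ hf, h0]
      simp
    have hdr' : (fun y => fderiv ℝ r y) =O[𝓝 0] fun y => ‖y‖ ^ k := by
      refine Asymptotics.IsBigO.trans (Asymptotics.isBigO_of_le _ fun y => ?_)
        (Asymptotics.IsBigO.sum (s := Finset.univ) fun i _ =>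
          (hdr (stdOrthonormalBasis ℝ (E n) i)).norm_left)
      rw [Finset.sum_apply]
      exact (opNorm_le_sum_norm_apply _).trans (le_abs_self _)
    obtain ⟨C, hC0, hC⟩ := hdr'.exists_pos
    obtain ⟨ρ, hρ, hball⟩ := Metric.eventually_nhds_iff_ball.1 (hd.and hC.bound)
    have hr0 : r 0 = 0 := by
      have : ∀ j, homogPart f (j + 1) 0 = 0 := fun j => by
        have := homogPart_smul f (j + 1) 0 0
        simpa using this
      simp [hr, Finset.sum_range_succ', this, homogPart_zero]
    refine Asymptotics.IsBigO.of_bound C ?_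
    filter_upwards [ball_mem_nhds (0 : E n) hρ] with y hy
    have hsub : closedBall (0 : E n) ‖y‖ ⊆ ball 0 ρ := closedBall_subset_ball (by simpa using hy)
    have hm := (convex_closedBall (0 : E n) ‖y‖).norm_image_sub_le_of_norm_fderiv_le
      (𝕜 := ℝ) (f := r) (C := C * ‖y‖ ^ k) (x := 0) (y := y)
      (fun z hz => (hball z (hsub hz)).1) (fun z hz => ?_) (by simp) (by simp)
    · rw [hr0, sub_zero, sub_zero, mul_assoc, ← pow_succ] at hm
      simpa using hm
    · have h1 := (hball z (hsub hz)).2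
      have hz' : ‖z‖ ≤ ‖y‖ := by simpa using hz
      refine h1.trans ?_
      rw [norm_pow, norm_norm]
      gcongr

end Taylor

/-! ### Orthogonality of different degrees -/

section Orthogonality

variable {n : ℕ} {f h : E n → ℂ} {k : ℕ}

lemma integrable_bumpKernel_smul {g : E n → ℂ} (hg : ContinuousOn g (closedBall 0 1)) :
    Integrable fun y => bumpKernel y • g y :=
  integrable_smul_of_continuousOn_closedBall continuous_bumpKernel support_bumpKernel_subset hg

/-- Under dilation by r the pairing scales like r^k by Green's identity and like r^j by homogeneity.
Comparing r = 1 with r = 2 forces it to vanish. -/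
lemma integral_bumpKernel_mul_homogPart_eq_zero (hf : HarmonicAt f 0)
    (hh : HarmonicOnNhd h Set.univ) (hk : ∀ y, fderiv ℝ h y y = k * h y) {j : ℕ} (hjk : j ≠ k) :
    ∫ y, bumpKernel y • (h y * homogPart f j y) = 0 := by
  obtain ⟨c, hc⟩ := exists_integral_bumpKernel_eq_const_mul_pow (x₀ := 0) (R := 3) k
    ((harmonicOnNhd_homogPart hf j).mono (Set.subset_univ _)) hh hk
  have h1 := hc 1 (by norm_num)
  have h2 := hc 2 (by norm_num)
  simp only [zero_add, one_smul, Complex.ofReal_one, one_pow, mul_one] at h1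
  have h3 : ∀ y : E n, bumpKernel y • (h y * homogPart f j (0 + (2 : ℝ) • y)) =
      ((2 : ℂ) ^ j) * (bumpKernel y • (h y * homogPart f j y)) := fun y => by
    rw [zero_add, homogPart_smul]
    simp
    ring
  simp_rw [h3] at h2
  rw [integral_const_mul, h1, mul_comm] at h2
  rw [h1]
  by_contra hc0
  have h4 := mul_left_cancel₀ hc0 h2
  push_cast at h4
  have h5 : (2 : ℕ) ^ j = 2 ^ k := by exact_mod_cast h4
  exact hjk (Nat.pow_right_injective le_rfl h5)

/-- The pairing is already known to be c r^k, so only c is unknown, and it can be read off as r → 0.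
Taylor's formula suffices for that; convergence of the expansion is not needed and is in fact
deduced from this. -/
theorem integral_bumpKernel_mul_dilation {R : ℝ} (hf : HarmonicOnNhd f (ball 0 R))
    (hh : HarmonicOnNhd h Set.univ) (hk : ∀ y, fderiv ℝ h y y = k * h y) {r : ℝ}
    (hr : r ∈ Set.Ioo 0 R) :
    ∫ y, bumpKernel y • (h y * f (r • y)) =
      (∫ y, bumpKernel y • (h y * homogPart f k y)) * (r : ℂ) ^ k := by
  obtain ⟨c, hc⟩ := exists_integral_bumpKernel_eq_const_mul_pow k hf hh hk
  simp only [zero_add] at hc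
  have hR : 0 < R := hr.1.trans hr.2
  have hf0 : HarmonicAt f 0 := hf 0 (mem_ball_self hR)
  set I := ∫ y, bumpKernel y • (h y * homogPart f k y) with hI
  suffices hcI : c = I by rw [hc r hr, hcI]
  have hhc : Continuous h := continuousOn_univ.1 hh.continuousOn
  obtain ⟨M, hM⟩ := (isCompact_closedBall (0 : E n) 1).exists_bound_of_continuousOn hhc.continuousOn
  have hM0 : 0 ≤ M := (norm_nonneg _).trans (hM 0 (by simp))
  obtain ⟨C, hC0, hC⟩ := (isBigO_sub_sum_homogPart (contDiffAt_of_harmonicAt hf0) (k + 1)).exists_pos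
  obtain ⟨d, hd, hball⟩ := Metric.eventually_nhds_iff_ball.1 hC.bound
  -- Orthogonality removes all Taylor terms but degree k. The remainder is O(s^(k+1)), and division
  -- by s^k leaves O(s).
  have key : ∀ s ∈ Set.Ioo 0 (min R d), ‖c - I‖ ≤ bumpMass (E n) * (M * C) * s := by
    intro s hs
    have hsR : s < R := hs.2.trans_le (min_le_left _ _)
    have hsd : s < d := hs.2.trans_le (min_le_right _ _)
    have hmem : ∀ y ∈ closedBall (0 : E n) 1, s • y ∈ closedBall (0 : E n) s := fun y hy => by
      simpa using add_smul_mem_closedBall (x₀ := 0) (abs_of_pos hs.1).le hy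
    have i0 : Integrable fun y => bumpKernel y • (h y * f (s • y)) :=
      integrable_bumpKernel_smul (hhc.continuousOn.mul (hf.continuousOn.comp (by fun_prop)
        fun y hy => closedBall_subset_ball hsR (hmem y hy)))
    have ij : ∀ j, Integrable fun y => bumpKernel y • (h y * homogPart f j (s • y)) := fun j =>
      integrable_bumpKernel_smul (hhc.mul
        ((continuous_homogPart f j).comp (by fun_prop))).continuousOn
    have e1 : ∫ y, bumpKernel y • (h y *
        (f (s • y) - ∑ j ∈ Finset.range (k + 1), homogPart f j (s • y))) =
        (c - I) * (s : ℂ) ^ k := by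
      have : ∀ y, bumpKernel y • (h y *
        (f (s • y) - ∑ j ∈ Finset.range (k + 1), homogPart f j (s • y))) =
          bumpKernel y • (h y * f (s • y)) -
            ∑ j ∈ Finset.range (k + 1), bumpKernel y • (h y * homogPart f j (s • y)) := fun y => by
        rw [mul_sub, smul_sub, Finset.mul_sum, Finset.smul_sum]
      simp_rw [this]
      rw [integral_sub i0 (integrable_finsetSum _ fun j _ => ij j),
        integral_finsetSum _ fun j _ => ij j, hc s ⟨hs.1, hsR⟩, sub_mul]
      congr 1
      have h3 : ∀ j, ∫ y, bumpKernel y • (h y * homogPart f j (s • y)) =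
          (s : ℂ) ^ j * ∫ y, bumpKernel y • (h y * homogPart f j y) := fun j => by
        rw [← integral_const_mul]
        refine integral_congr_ae (Eventually.of_forall fun y => ?_)
        simp only [homogPart_smul, Complex.real_smul]
        push_cast
        ring
      rw [Finset.sum_eq_single k]
      · rw [h3, mul_comm]
      · intro j _ hj
        rw [h3, integral_bumpKernel_mul_homogPart_eq_zero hf0 hh hk hj, mul_zero]
      · simp
    have e2 : ‖(c - I) * (s : ℂ) ^ k‖ ≤ ∫ y : E n, bumpKernel y * (M * (C * s ^ (k + 1))) := by
      rw [← e1]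
      refine norm_integral_le_of_norm_le (integrable_bumpKernel.mul_const _)
        (Eventually.of_forall fun y => ?_)
      by_cases hy : y ∈ closedBall (0 : E n) 1
      · rw [norm_smul, Real.norm_of_nonneg (bumpKernel_nonneg y), norm_mul]
        refine mul_le_mul_of_nonneg_left ?_ (bumpKernel_nonneg y)
        have hsy : ‖s • y‖ ≤ s := by simpa using hmem y hy
        refine mul_le_mul (hM y hy) ?_ (norm_nonneg _) hM0
        refine (hball (s • y) (by simpa using hsy.trans_lt hsd)).trans ?_
        rw [norm_pow, norm_norm]
        gcongr
      · have : bumpKernel y = 0 := by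
          by_contra hne
          exact hy (support_bumpKernel_subset hne)
        simp [this]
    rw [integral_mul_const, norm_mul, norm_pow, Complex.norm_real, Real.norm_of_nonneg hs.1.le,
      pow_succ] at e2
    have hsk : 0 < s ^ k := pow_pos hs.1 k
    refine le_of_mul_le_mul_right (e2.trans_eq ?_) hsk
    rw [bumpMass]
    ring
  have hlim : Tendsto (fun s : ℝ => bumpMass (E n) * (M * C) * s) (𝓝[>] 0) (𝓝 0) := by
    have : Continuous fun s : ℝ => bumpMass (E n) * (M * C) * s := by fun_prop
    simpa using (this.tendsto 0).mono_left nhdsWithin_le_nhds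
  have hle : ‖c - I‖ ≤ 0 := ge_of_tendsto hlim (by
    filter_upwards [Ioo_mem_nhdsGT (lt_min hR hd)] with s hs using key s hs)
  exact sub_eq_zero.1 (norm_le_zero_iff.1 hle)

end Orthogonality

/-! ### Geometric bounds for the homogeneous parts -/

section Bound

variable {n : ℕ} {f : E n → ℂ}

/-- Pairing the dilate of f with the conjugate of f_k gives s^k times the weighted L² norm squared
of f_k, and this is at most M times its weighted L¹ norm. -/
lemma integral_bumpKernel_norm_homogPart_le {s M : ℝ} (hs : s ∈ Set.Ioo (0 : ℝ) 1)
    (hf : HarmonicOnNhd f (ball 0 1)) (hM : ∀ y ∈ closedBall 0 s, ‖f y‖ ≤ M) (k : ℕ) :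
    ∫ y, bumpKernel y * ‖homogPart f k y‖ ≤
      ((M ^ 2 + 1) * bumpMass (E n)) * (s⁻¹) ^ k := by
  have hf0 : HarmonicAt f 0 := hf 0 (mem_ball_self one_pos)
  have hM0 : 0 ≤ M := (norm_nonneg _).trans (hM 0 (by simpa using hs.1.le))
  set h : E n → ℂ := fun y => (starRingEnd ℂ) (homogPart f k y) with hh
  have hharm : HarmonicOnNhd h Set.univ :=
    (harmonicOnNhd_homogPart hf0 k).comp_CLM (Complex.conjCLE : ℂ →L[ℝ] ℂ)
  have hEuler : ∀ y, fderiv ℝ h y y = k * h y := by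
    intro y
    have h1 := (Complex.conjCLE : ℂ →L[ℝ] ℂ).hasFDerivAt.comp y
      ((contDiff_homogPart f k).differentiable (by simp) y).hasFDerivAt
    have h2 : fderiv ℝ h y = _ := h1.fderiv
    rw [h2]
    simp [fderiv_homogPart_self (contDiffAt_of_harmonicAt hf0), hh]
  have hcont : Continuous fun y => ‖homogPart f k y‖ := (continuous_homogPart f k).norm
  have i1 : Integrable fun y => bumpKernel y * ‖homogPart f k y‖ :=
    integrable_smul_of_continuousOn_closedBall continuous_bumpKernel support_bumpKernel_subset
      hcont.continuousOn
  have i2 : Integrable fun y => bumpKernel y * ‖homogPart f k y‖ ^ 2 :=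
    integrable_smul_of_continuousOn_closedBall continuous_bumpKernel support_bumpKernel_subset
      (hcont.pow 2).continuousOn
  have i0 : Integrable (bumpKernel : E n → ℝ) := integrable_bumpKernel
  set S := ∫ y, bumpKernel y * ‖homogPart f k y‖ ^ 2 with hS
  set T := ∫ y, bumpKernel y * ‖homogPart f k y‖ with hT
  have hpair := integral_bumpKernel_mul_dilation hf hharm hEuler hs
  have e1 : ∫ y, bumpKernel y • (h y * homogPart f k y) = (S : ℂ) := by
    rw [hS, ← integral_complex_ofReal]
    refine integral_congr_ae (Eventually.of_forall fun y => ?_)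
    simp only [hh, Complex.conj_mul', Complex.real_smul]
    push_cast
    ring
  have hS0 : 0 ≤ S := integral_nonneg fun y => mul_nonneg (bumpKernel_nonneg y) (by positivity)
  have hsk : 0 < s ^ k := pow_pos hs.1 k
  have e2 : S * s ^ k ≤ M * T := by
    have h1 : ‖∫ y, bumpKernel y • (h y * f (s • y))‖ ≤ ∫ y, M * (bumpKernel y * ‖homogPart f k y‖) := by
      refine norm_integral_le_of_norm_le (i1.const_mul _) (Eventually.of_forall fun y => ?_)
      by_cases hy : y ∈ closedBall (0 : E n) 1
      · rw [norm_smul, Real.norm_of_nonneg (bumpKernel_nonneg y), norm_mul, mul_comm M, mul_assoc]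
        refine mul_le_mul_of_nonneg_left ?_ (bumpKernel_nonneg y)
        rw [hh, RCLike.norm_conj]
        refine mul_le_mul_of_nonneg_left (hM _ ?_) (norm_nonneg _)
        simpa using add_smul_mem_closedBall (x₀ := 0) (abs_of_pos hs.1).le hy
      · have : bumpKernel y = 0 := by
          by_contra hne
          exact hy (support_bumpKernel_subset hne)
        simp [this]
    rw [hpair, e1, norm_mul, norm_pow, Complex.norm_real, Complex.norm_real,
      Real.norm_of_nonneg hs.1.le, Real.norm_of_nonneg hS0, integral_const_mul] at h1
    exact h1
  have hinv : s ^ k * (s⁻¹) ^ k = 1 := by rw [← mul_pow, mul_inv_cancel₀ hs.1.ne', one_pow]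
  have hu0 : 0 < (s⁻¹) ^ k := pow_pos (inv_pos.2 hs.1) k
  -- Young's inequality, balanced by s^k. With m = M it absorbs T and bounds S; with m = 1 it then
  -- bounds T.
  have young : ∀ m : ℝ, m * T ≤ (1 / 2) * (s ^ k * S + (s⁻¹) ^ k * m ^ 2 * bumpMass (E n)) := by
    intro m
    have h1 : ∫ y : E n, m * (bumpKernel y * ‖homogPart f k y‖) ≤
        ∫ y : E n, ((1 / 2) * s ^ k * (bumpKernel y * ‖homogPart f k y‖ ^ 2) +
          (1 / 2) * (s⁻¹) ^ k * m ^ 2 * bumpKernel y) := by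
      refine integral_mono (i1.const_mul _) ((i2.const_mul _).add (i0.const_mul _)) fun y => ?_
      have hb := bumpKernel_nonneg y
      set a := ‖homogPart f k y‖
      set u := (s⁻¹) ^ k
      set w := s ^ k
      have h3 : m * a ≤ 1 / 2 * w * a ^ 2 + 1 / 2 * u * m ^ 2 := by
        have h4 : 0 ≤ u * (w * a - m) ^ 2 := by positivity
        have h5 : u * (w * a - m) ^ 2 = (w * u) * w * a ^ 2 - 2 * (w * u) * a * m + u * m ^ 2 := by
          ring
        rw [h5, hinv] at h4
        linarith
      have h6 := mul_le_mul_of_nonneg_left h3 hb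
      simp only
      nlinarith
    rw [integral_const_mul, integral_add (i2.const_mul _) (i0.const_mul _), integral_const_mul,
      integral_const_mul] at h1
    refine h1.trans_eq ?_
    rw [bumpMass]
    ring
  have hm := (bumpMass_pos (V := E n)).le
  have y1 := young M
  have y2 := young 1
  have h7 : s ^ k * S ≤ (s⁻¹) ^ k * M ^ 2 * bumpMass (E n) := by nlinarith
  have h8 : 0 ≤ (s⁻¹) ^ k * M ^ 2 * bumpMass (E n) := by positivity
  have h9 : 0 ≤ (s⁻¹) ^ k * bumpMass (E n) := by positivity
  nlinarith

/-- The homogeneous expansion of a harmonic function on the unit ball converges geometrically on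
smaller balls. -/
theorem exists_norm_homogPart_le (hf : HarmonicOnNhd f (ball 0 1)) {ρ : ℝ}
    (hρ : ρ ∈ Set.Ioo (0 : ℝ) 1) :
    ∃ C : ℝ, 0 ≤ C ∧ ∀ k x, ‖homogPart f k x‖ ≤ C * (‖x‖ / ρ) ^ k := by
  have hf0 : HarmonicAt f 0 := hf 0 (mem_ball_self one_pos)
  -- One factor s^(-k) comes from the integral estimate and another from scaling x to norm s;
  -- together they give ρ^(-k).
  set s := √ρ with hsdef
  have hs0 : 0 < s := Real.sqrt_pos.2 hρ.1
  have hs1 : s < 1 := by rw [hsdef, Real.sqrt_lt' one_pos]; simpa using hρ.2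
  have hss : s * s = ρ := Real.mul_self_sqrt hρ.1.le
  obtain ⟨M, hM⟩ := (isCompact_closedBall (0 : E n) s).exists_bound_of_continuousOn
    (hf.continuousOn.mono (closedBall_subset_ball hs1))
  have hT := integral_bumpKernel_norm_homogPart_le ⟨hs0, hs1⟩ hf hM
  set d := (1 - s) / 2 with hd
  have hd0 : 0 < d := by rw [hd]; linarith
  obtain ⟨B, hB0, hB⟩ := exists_bumpKernel_le (V := E n)
  obtain ⟨z₀, hz₀, hmin⟩ := (isCompact_closedBall (0 : E n) (s + d)).exists_isMinOn
    ⟨0, by simp; positivity⟩ (continuous_bumpKernel (V := E n)).continuousOn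
  have hκ0 : 0 < bumpKernel z₀ := bumpKernel_pos (by
    have : ‖z₀‖ ≤ s + d := by simpa using hz₀
    rw [hd] at this; linarith)
  set B' := B / bumpKernel z₀ with hB'
  have hB'0 : 0 < B' := by positivity
  -- The shifted kernel vanishes off the ball of radius s + d < 1, on which the fixed kernel is
  -- bounded below. So the weighted integral controls point values through the mean value property.
  have hcomp : ∀ x ∈ closedBall (0 : E n) s, ∀ z, bumpKernel (d⁻¹ • (z - x)) ≤ B' * bumpKernel z := by
    intro x hx z
    by_cases hz : z ∈ closedBall (0 : E n) (s + d)
    · have h1 : bumpKernel z₀ ≤ bumpKernel z := hmin hz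
      calc bumpKernel (d⁻¹ • (z - x)) ≤ B := hB _
        _ = B' * bumpKernel z₀ := by rw [hB', div_mul_cancel₀ _ hκ0.ne']
        _ ≤ B' * bumpKernel z := by gcongr
    · have h1 : 1 ≤ ‖d⁻¹ • (z - x)‖ := by
        have h2 : s + d < ‖z‖ := by simpa using hz
        have h3 : ‖x‖ ≤ s := by simpa using hx
        have h4 := norm_sub_norm_le z x
        rw [norm_smul, Real.norm_of_nonneg (by positivity), inv_mul_eq_div, le_div_iff₀ hd0]
        linarith
      rw [bumpKernel_eq_zero h1]
      exact mul_nonneg hB'0.le (bumpKernel_nonneg z)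
  set A := (bumpMass (E n))⁻¹ * ((d ^ Module.finrank ℝ (E n))⁻¹ *
    (B' * ((M ^ 2 + 1) * bumpMass (E n)))) with hA
  have hm := bumpMass_pos (V := E n)
  have hA0 : 0 ≤ A := by positivity
  have hsmall : ∀ k, ∀ x ∈ closedBall (0 : E n) s, ‖homogPart f k x‖ ≤ A * (s⁻¹) ^ k := by
    intro k x hx
    have hmv := mean_value_of_harmonicOnNhd (x₀ := x) (R := d + 1)
      ((harmonicOnNhd_homogPart hf0 k).mono (Set.subset_univ _)) hd0.le (by linarith)
    rw [integral_bumpKernel_smul_eq _ x hd0] at hmv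
    have i1 : Integrable fun y => bumpKernel y * ‖homogPart f k y‖ :=
      integrable_smul_of_continuousOn_closedBall continuous_bumpKernel support_bumpKernel_subset
        (continuous_homogPart f k).norm.continuousOn
    have h1 : ‖∫ z, bumpKernel (d⁻¹ • (z - x)) • homogPart f k z‖ ≤
        ∫ z, B' * (bumpKernel z * ‖homogPart f k z‖) := by
      refine norm_integral_le_of_norm_le (i1.const_mul _) (Eventually.of_forall fun z => ?_)
      rw [norm_smul, Real.norm_of_nonneg (bumpKernel_nonneg _), ← mul_assoc]
      exact mul_le_mul_of_nonneg_right (hcomp x hx z) (norm_nonneg _)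
    rw [integral_const_mul] at h1
    have h2 := congrArg norm hmv
    rw [norm_smul, norm_smul, Real.norm_of_nonneg hm.le, Real.norm_of_nonneg (by positivity)] at h2
    have h3 : ‖homogPart f k x‖ = (bumpMass (E n))⁻¹ * ((d ^ Module.finrank ℝ (E n))⁻¹ *
        ‖∫ z, bumpKernel (d⁻¹ • (z - x)) • homogPart f k z‖) := by
      rw [h2, inv_mul_cancel_left₀ hm.ne']
    rw [h3, hA, mul_assoc, mul_assoc, mul_assoc B']
    have h4 := h1.trans (mul_le_mul_of_nonneg_left (hT k) hB'0.le)
    gcongr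
  refine ⟨A, hA0, fun k x => ?_⟩
  rcases eq_or_ne x 0 with rfl | hx
  · rcases k with _ | k
    · simpa using hsmall 0 0 (by simpa using hs0.le)
    · have := homogPart_smul f (k + 1) 0 0
      simp at this
      simp [this]
  · have hx0 : 0 < ‖x‖ := norm_pos_iff.2 hx
    have h1 : x = (‖x‖ / s) • ((s / ‖x‖) • x) := by
      rw [smul_smul, div_mul_div_cancel₀ hs0.ne', div_self hx0.ne', one_smul]
    have h2 : (s / ‖x‖) • x ∈ closedBall (0 : E n) s := by
      rw [mem_closedBall_zero_iff, norm_smul, Real.norm_of_nonneg (by positivity),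
        div_mul_cancel₀ _ hx0.ne']
    have h3 := hsmall k _ h2
    calc ‖homogPart f k x‖ = (‖x‖ / s) ^ k * ‖homogPart f k ((s / ‖x‖) • x)‖ := by
          conv_lhs => rw [h1, homogPart_smul, norm_smul, Real.norm_of_nonneg (by positivity)]
      _ ≤ (‖x‖ / s) ^ k * (A * (s⁻¹) ^ k) := by gcongr
      _ = A * (‖x‖ / ρ) ^ k := by
          rw [← hss, mul_left_comm, ← mul_pow]
          congr 2
          field_simp

end Bound

/-! ### Multipliers of polynomial growth -/

section PolyBdd

/-- A sequence of multipliers of at most polynomial growth. -/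
def PolyBdd (m : ℕ → ℝ) : Prop := ∃ (C : ℝ) (N : ℕ), ∀ k, |m k| ≤ C * ((k : ℝ) + 1) ^ N

lemma PolyBdd.mul {m₁ m₂ : ℕ → ℝ} (h₁ : PolyBdd m₁) (h₂ : PolyBdd m₂) :
    PolyBdd fun k => m₁ k * m₂ k := by
  obtain ⟨C₁, N₁, h₁⟩ := h₁
  obtain ⟨C₂, N₂, h₂⟩ := h₂
  refine ⟨C₁ * C₂, N₁ + N₂, fun k => ?_⟩
  rw [abs_mul, pow_add, mul_mul_mul_comm]
  exact mul_le_mul (h₁ k) (h₂ k) (abs_nonneg _) ((abs_nonneg _).trans (h₁ k))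

lemma polyBdd_of_abs_le {m : ℕ → ℝ} {C : ℝ} (h : ∀ k, |m k| ≤ C) : PolyBdd m :=
  ⟨C, 0, fun k => by simpa using h k⟩

lemma polyBdd_const (c : ℝ) : PolyBdd fun _ => c := polyBdd_of_abs_le fun _ => le_rfl

lemma polyBdd_add_const (d : ℝ) : PolyBdd fun k => (k : ℝ) + d := by
  refine ⟨1 + |d|, 1, fun k => ?_⟩
  have hk : (0 : ℝ) ≤ k := Nat.cast_nonneg k
  have := abs_add_le (k : ℝ) d
  rw [abs_of_nonneg hk] at this
  rw [pow_one]
  nlinarith [abs_nonneg d]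

lemma polyBdd_natCast : PolyBdd fun k => (k : ℝ) := by simpa using polyBdd_add_const 0

end PolyBdd

/-! ### Multiplier series of a harmonic function -/

section MultSeries

variable {n : ℕ} {f : E n → ℂ} {m : ℕ → ℝ}

/-- The function obtained from the harmonic function `f = ∑ f_k` by the multipliers `m`. -/
def multSeries (m : ℕ → ℝ) (f : E n → ℂ) (x : E n) : ℂ := ∑' k, m k • homogPart f k x

lemma exists_summable_norm_mult_le (hf : f ∈ harmonicSpace n) (hm : PolyBdd m) {s : ℝ}
    (hs : s < 1) :
    ∃ b : ℕ → ℝ, Summable b ∧ ∀ k, ∀ x ∈ closedBall (0 : E n) s, ‖m k • homogPart f k x‖ ≤ b k := by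
  obtain ⟨C, N, hC⟩ := hm
  obtain ⟨s', hs1, hs2⟩ := exists_between (max_lt hs one_pos)
  have hs'0 : 0 < s' := (le_max_right _ _).trans_lt hs1
  have hss' : s ≤ s' := (le_max_left _ _).trans hs1.le
  obtain ⟨ρ, hρ1, hρ2⟩ := exists_between hs2
  have hρ0 : 0 < ρ := hs'0.trans hρ1
  obtain ⟨A, hA0, hA⟩ := exists_norm_homogPart_le hf ⟨hρ0, hρ2⟩
  set q := s' / ρ with hq
  have hq0 : 0 < q := by positivity
  have hq1 : q < 1 := (div_lt_one hρ0).2 hρ1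
  have hsum : Summable fun k : ℕ => (k : ℝ) ^ N * q ^ k :=
    summable_pow_mul_geometric_of_norm_lt_one N (by rwa [Real.norm_of_nonneg hq0.le])
  have hsum' := ((summable_nat_add_iff 1).2 hsum).mul_left (C * A * q⁻¹)
  refine ⟨_, hsum', fun k x hx => ?_⟩
  have hx' : ‖x‖ ≤ s' := (by simpa using hx : ‖x‖ ≤ s).trans hss'
  have hC0 : 0 ≤ C * ((k : ℝ) + 1) ^ N := (abs_nonneg _).trans (hC k)
  calc ‖m k • homogPart f k x‖ ≤ (C * ((k : ℝ) + 1) ^ N) * (A * (‖x‖ / ρ) ^ k) := by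
        rw [norm_smul, Real.norm_eq_abs]
        exact mul_le_mul (hC k) (hA k x) (norm_nonneg _) hC0
    _ ≤ (C * ((k : ℝ) + 1) ^ N) * (A * q ^ k) := by
        refine mul_le_mul_of_nonneg_left ?_ hC0
        rw [hq]
        gcongr
    _ = C * A * q⁻¹ * (((k + 1 : ℕ) : ℝ) ^ N * q ^ (k + 1)) := by
        push_cast
        rw [pow_succ]
        field_simp

lemma summable_norm_mult (hf : f ∈ harmonicSpace n) (hm : PolyBdd m) {x : E n} (hx : ‖x‖ < 1) :
    Summable fun k => ‖m k • homogPart f k x‖ := by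
  obtain ⟨b, hb, hle⟩ := exists_summable_norm_mult_le hf hm hx
  exact hb.of_nonneg_of_le (fun _ => norm_nonneg _) fun k => hle k x (by simp)

lemma summable_mult (hf : f ∈ harmonicSpace n) (hm : PolyBdd m) {x : E n} (hx : ‖x‖ < 1) :
    Summable fun k => m k • homogPart f k x :=
  (summable_norm_mult hf hm hx).of_norm

lemma continuousOn_multSeries (hf : f ∈ harmonicSpace n) (hm : PolyBdd m) :
    ContinuousOn (multSeries m f) (ball 0 1) := by
  intro x hx
  have hx1 : ‖x‖ < 1 := by simpa using hx
  obtain ⟨s, hs1, hs2⟩ := exists_between hx1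
  obtain ⟨b, hb, hle⟩ := exists_summable_norm_mult_le hf hm hs2
  have h1 : ContinuousOn (multSeries m f) (closedBall 0 s) :=
    continuousOn_tsum (fun k => ((continuous_homogPart f k).const_smul (m k)).continuousOn) hb hle
  exact (h1.continuousAt (closedBall_mem_nhds_of_mem (by simpa using hs1))).continuousWithinAt

lemma multSeries_smul (m : ℕ → ℝ) (f : E n → ℂ) (r : ℝ) (x : E n) :
    multSeries m f (r • x) = ∑' k, r ^ k • (m k • homogPart f k x) := by
  simp only [multSeries, homogPart_smul, smul_smul, mul_comm]

lemma multSeries_comp_smul {r : ℝ} (hr : r ≠ 0) (m : ℕ → ℝ) (f : E n → ℂ) (x : E n) :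
    multSeries m (fun y => f (r • y)) x = multSeries m f (r • x) := by
  simp only [multSeries, homogPart_comp_smul hr, homogPart_smul]

lemma multSeries_sub {g : E n → ℂ} (hf : f ∈ harmonicSpace n) (hg : g ∈ harmonicSpace n)
    (hm : PolyBdd m) {x : E n} (hx : ‖x‖ < 1) :
    multSeries m (f - g) x = multSeries m f x - multSeries m g x := by
  have h0 : (0 : E n) ∈ unitBall n := mem_ball_self one_pos
  simp only [multSeries, homogPart_sub (contDiffAt_of_harmonicAt (hf 0 h0))
    (contDiffAt_of_harmonicAt (hg 0 h0)), smul_sub]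
  exact (summable_mult hf hm hx).tsum_sub (summable_mult hg hm hx)

/-- The weighted mean value property on the unit ball. -/
structure HasMeanValue (w : E n → ℂ) : Prop where
  continuousOn : ContinuousOn w (ball 0 1)
  mean_value : ∀ (x : E n) (r : ℝ), 0 ≤ r → ‖x‖ + r < 1 →
    ∫ y, bumpKernel y • w (x + r • y) = bumpMass (E n) • w x

/-- The mean value property of each harmonic term passes to the sum by locally uniform absolute
convergence. -/
lemma hasMeanValue_multSeries (hf : f ∈ harmonicSpace n) (hm : PolyBdd m) :
    HasMeanValue (multSeries m f) := by
  refine ⟨continuousOn_multSeries hf hm, fun x r hr hxr => ?_⟩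
  have hf0 : HarmonicAt f 0 := hf 0 (mem_ball_self one_pos)
  obtain ⟨b, hb, hle⟩ := exists_summable_norm_mult_le hf hm hxr
  have hmem : ∀ y ∈ closedBall (0 : E n) 1, x + r • y ∈ closedBall (0 : E n) (‖x‖ + r) :=
    fun y hy => closedBall_subset_closedBall' (by rw [dist_zero_right]; linarith)
      (add_smul_mem_closedBall (abs_of_nonneg hr).le hy)
  set F : ℕ → E n → ℂ := fun k y => bumpKernel y • (m k • homogPart f k (x + r • y)) with hF
  have hFi : ∀ k, Integrable (F k) := fun k =>
    integrable_bumpKernel_smul (((continuous_homogPart f k).comp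
      (by fun_prop : Continuous fun y : E n => x + r • y)).const_smul (m k)).continuousOn
  have hFn : ∀ k, ∫ y, ‖F k y‖ ≤ bumpMass (E n) * b k := by
    intro k
    rw [bumpMass, ← integral_mul_const]
    refine integral_mono (hFi k).norm (integrable_bumpKernel.mul_const _) fun y => ?_
    simp only [hF]
    by_cases hy : y ∈ closedBall (0 : E n) 1
    · rw [norm_smul, Real.norm_of_nonneg (bumpKernel_nonneg y)]
      exact mul_le_mul_of_nonneg_left (hle k _ (hmem y hy)) (bumpKernel_nonneg y)
    · have : bumpKernel y = 0 := by
        by_contra hne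
        exact hy (support_bumpKernel_subset hne)
      simp [this]
  have hs := hasSum_integral_of_summable_integral_norm hFi
    ((hb.mul_left (bumpMass (E n))).of_nonneg_of_le (fun k => integral_nonneg fun _ => norm_nonneg _)
      hFn)
  have h1 : ∀ k, ∫ y, F k y = bumpMass (E n) • (m k • homogPart f k x) := by
    intro k
    have := mean_value_of_harmonicOnNhd (x₀ := x) (R := r + 1)
      ((harmonicOnNhd_homogPart hf0 k).mono (Set.subset_univ _)) hr (by linarith)
    simp only [hF]
    simp_rw [smul_comm _ (m k)]
    rw [integral_smul, this]
  have h2 : ∀ y, ∑' k, F k y = bumpKernel y • multSeries m f (x + r • y) := fun y => by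
    simp only [hF, multSeries]
    rw [tsum_const_smul'']
  simp_rw [h2, h1] at hs
  rw [← hs.tsum_eq, multSeries, tsum_const_smul'']

end MultSeries

/-! ### Interior Lipschitz estimate -/

section MeanValue

variable {n : ℕ}

lemma exists_lipschitz_bumpKernel :
    ∃ L : ℝ, 0 < L ∧ ∀ y e : E n, |bumpKernel (y - e) - bumpKernel y| ≤ L * ‖e‖ := by
  obtain ⟨L, hL⟩ := (contDiff_bumpKernel (V := E n)).lipschitzWith_of_hasCompactSupport
    hasCompactSupport_bumpKernel (by simp)
  refine ⟨L + 1, by positivity, fun y e => ?_⟩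
  have h := hL.dist_le_mul (y - e) y
  rw [Real.dist_eq, dist_eq_norm] at h
  have h2 : ‖y - e - y‖ = ‖e‖ := by rw [sub_right_comm, sub_self, zero_sub, norm_neg]
  rw [h2] at h
  exact h.trans (by gcongr; linarith)

/-- An interior Lipschitz estimate for functions with the mean value property. -/
theorem exists_norm_sub_le_of_hasMeanValue (n : ℕ) :
    ∃ C : ℝ, 0 < C ∧ ∀ w : E n → ℂ, HasMeanValue w → ∀ (x x' : E n) (d M : ℝ), 0 < d →
      ‖x' - x‖ ≤ d → ‖x‖ + 2 * d < 1 → (∀ z ∈ closedBall x (2 * d), ‖w z‖ ≤ M) →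
        ‖w x' - w x‖ ≤ C * M * (‖x' - x‖ / d) := by
  obtain ⟨L, hL0, hL⟩ := exists_lipschitz_bumpKernel (n := n)
  set v : ℝ := volume.real (closedBall (0 : E n) 2) with hv
  have hm := bumpMass_pos (V := E n)
  have hv0 : 0 < v := by
    rw [hv, Measure.real]
    exact ENNReal.toReal_pos (measure_closedBall_pos _ _ (by norm_num)).ne'
      (isCompact_closedBall _ _).measure_lt_top.ne
  refine ⟨(bumpMass (E n))⁻¹ * (L * v), by positivity, fun w hw x x' d M hd hxx hx hM => ?_⟩
  have hM0 : 0 ≤ M := (norm_nonneg _).trans (hM x (by simp; positivity))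
  set e : E n := d⁻¹ • (x' - x) with he
  have hne : ‖e‖ = ‖x' - x‖ / d := by
    rw [he, norm_smul, Real.norm_of_nonneg (by positivity), inv_mul_eq_div]
  have hne1 : ‖e‖ ≤ 1 := by rw [hne]; exact (div_le_one hd).2 hxx
  have hx'e : x' = x + d • e := by rw [he, smul_smul, mul_inv_cancel₀ hd.ne', one_smul]; abel
  have hx' : ‖x'‖ + d < 1 := by
    have := norm_add_le x (x' - x)
    rw [add_sub_cancel] at this
    linarith
  have h1 := hw.mean_value x d hd.le (by linarith)
  have h2 := hw.mean_value x' d hd.le hx'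
  have hint : ∀ z : E n, ‖z‖ + d < 1 → Integrable fun y => bumpKernel y • w (z + d • y) :=
    fun z hz => integrable_bumpKernel_smul (hw.continuousOn.comp (by fun_prop) fun y hy => by
      have := closedBall_subset_closedBall' (x := z) (y := (0 : E n)) (ε₁ := d) (ε₂ := ‖z‖ + d)
        (by rw [dist_zero_right, add_comm]) (add_smul_mem_closedBall (abs_of_pos hd).le hy)
      exact closedBall_subset_ball hz this)
  -- Both values of w become averages of the same function against two translates of the kernel, so
  -- the Lipschitz bound falls on the kernel. As ‖e‖ ≤ 1, both translates live in the ball of radius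
  -- 2.
  have h3 : ∀ y, bumpKernel (y - e) • w (x + d • y) =
      (fun y => bumpKernel y • w (x' + d • y)) (y - e) := fun y => by
    simp only [hx'e, smul_sub]
    congr 2
    abel
  have h4 : ∫ y, bumpKernel (y - e) • w (x + d • y) = bumpMass (E n) • w x' := by
    rw [← h2, integral_congr_ae (Eventually.of_forall h3)]
    exact integral_sub_right_eq_self (fun y => bumpKernel y • w (x' + d • y)) e
  have i4 : Integrable fun y => bumpKernel (y - e) • w (x + d • y) :=
    ((hint x' hx').comp_sub_right e).congr (Eventually.of_forall fun y => (h3 y).symm)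
  have h5 : bumpMass (E n) • (w x' - w x) =
      ∫ y, (bumpKernel (y - e) - bumpKernel y) • w (x + d • y) := by
    rw [smul_sub, ← h4, ← h1, ← integral_sub i4 (hint x (by linarith))]
    simp_rw [sub_smul]
  have h6 : ‖bumpMass (E n) • (w x' - w x)‖ ≤ L * ‖e‖ * M * v := by
    rw [h5]
    have hb : ∀ y, ‖(bumpKernel (y - e) - bumpKernel y) • w (x + d • y)‖ ≤
        (closedBall (0 : E n) 2).indicator (fun _ => L * ‖e‖ * M) y := by
      intro y
      by_cases hy : y ∈ closedBall (0 : E n) 2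
      · rw [Set.indicator_of_mem hy, norm_smul, Real.norm_eq_abs]
        refine mul_le_mul (hL y e) (hM _ ?_) (norm_nonneg _) (by positivity)
        have : ‖y‖ ≤ 2 := by simpa using hy
        rw [mem_closedBall, dist_eq_norm, add_sub_cancel_left, norm_smul,
          Real.norm_of_nonneg hd.le]
        nlinarith
      · have hy2 : 2 < ‖y‖ := by simpa using hy
        have h7 : 1 ≤ ‖y - e‖ := by
          have := norm_sub_norm_le y e
          linarith
        rw [bumpKernel_eq_zero h7, bumpKernel_eq_zero (by linarith : 1 ≤ ‖y‖)]
        simp [hy]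
    have hi : Integrable ((closedBall (0 : E n) 2).indicator fun _ => L * ‖e‖ * M) := by
      rw [integrable_indicator_iff isClosed_closedBall.measurableSet]
      exact integrableOn_const (isCompact_closedBall _ _).measure_lt_top.ne
    refine (norm_integral_le_of_norm_le hi (Eventually.of_forall hb)).trans_eq ?_
    rw [integral_indicator isClosed_closedBall.measurableSet, setIntegral_const, smul_eq_mul,
      mul_comm]
  rw [norm_smul, Real.norm_of_nonneg hm.le] at h6
  rw [← hne]
  calc ‖w x' - w x‖ = (bumpMass (E n))⁻¹ * (bumpMass (E n) * ‖w x' - w x‖) := by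
        rw [inv_mul_cancel_left₀ hm.ne']
    _ ≤ (bumpMass (E n))⁻¹ * (L * ‖e‖ * M * v) := by gcongr
    _ = _ := by ring

end MeanValue

/-! ### Growth exponents and multipliers that shift them -/

section Growth

variable {n : ℕ}

/-- The filter of points of the ball tending to the sphere. -/
def nearSphere (n : ℕ) : Filter (E n) := comap (fun x : E n => ‖x‖) (𝓝[<] 1)

lemma eventually_nearSphere_iff {P : E n → Prop} :
    (∀ᶠ x in nearSphere n, P x) ↔ ∃ ρ : ℝ, ρ < 1 ∧ ∀ x : E n, ρ < ‖x‖ → ‖x‖ < 1 → P x := by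
  rw [nearSphere, eventually_comap]
  constructor
  · intro h
    obtain ⟨ρ, hρ, hsub⟩ := (mem_nhdsLT_iff_exists_Ioo_subset (a := (1 : ℝ))).1 h
    exact ⟨ρ, hρ, fun x h1 h2 => hsub ⟨h1, h2⟩ x rfl⟩
  · rintro ⟨ρ, hρ, h⟩
    filter_upwards [Ioo_mem_nhdsLT hρ] with t ht x hx
    subst hx
    exact h x ht.1 ht.2

/-- `w` grows at most like `ε (1 - |x|)^(-A)` near the sphere. -/
def Growth (w : E n → ℂ) (A ε : ℝ) : Prop :=
  ∀ᶠ x in nearSphere n, ‖w x‖ ≤ ε * (1 - ‖x‖) ^ (-A)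

/-- The multiplier `μ` changes the growth exponent from `A` to `A'`, with uniform constants. -/
def Transfer (n : ℕ) (μ : ℕ → ℝ) (A A' : ℝ) : Prop :=
  PolyBdd μ ∧ ∃ C : ℝ, 0 < C ∧ ∀ f ∈ harmonicSpace n, ∀ m, PolyBdd m → ∀ ε : ℝ, 0 < ε →
    Growth (multSeries m f) A ε → Growth (multSeries (fun k => μ k * m k) f) A' (C * ε)

lemma Transfer.comp {μ₁ μ₂ : ℕ → ℝ} {A₁ A₂ A₃ : ℝ} (h₁ : Transfer n μ₁ A₁ A₂)
    (h₂ : Transfer n μ₂ A₂ A₃) : Transfer n (fun k => μ₂ k * μ₁ k) A₁ A₃ := by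
  obtain ⟨hp₁, C₁, hC₁, h₁⟩ := h₁
  obtain ⟨hp₂, C₂, hC₂, h₂⟩ := h₂
  refine ⟨hp₂.mul hp₁, C₂ * C₁, by positivity, fun f hf m hm ε hε hg => ?_⟩
  have := h₂ f hf _ (hp₁.mul hm) _ (by positivity) (h₁ f hf m hm ε hε hg)
  simpa only [mul_assoc] using this

lemma Transfer.one (A : ℝ) : Transfer n (fun _ => 1) A A :=
  ⟨polyBdd_const 1, 1, one_pos, fun f _ m _ ε _ hg => by simpa using hg⟩

lemma transfer_const {c : ℝ} (hc : c ≠ 0) (A : ℝ) : Transfer n (fun _ => c) A A := by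
  refine ⟨polyBdd_const c, |c|, by positivity, fun f _ m _ ε _ hg => ?_⟩
  have h1 : ∀ x, multSeries (fun k => c * m k) f x = c • multSeries m f x := fun x => by
    simp only [multSeries, mul_smul]
    exact tsum_const_smul'' c
  filter_upwards [hg] with x hx
  rw [h1, norm_smul, Real.norm_eq_abs, mul_assoc]
  gcongr

lemma Transfer.congr_exponent {μ : ℕ → ℝ} {A A' B B' : ℝ} (h : Transfer n μ A A') (hA : A = B)
    (hA' : A' = B') : Transfer n μ B B' := hA ▸ hA' ▸ h

end Growth

/-! ### Raising the exponent by radial differentiation -/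

section Differentiation

variable {n : ℕ}

lemma hasDerivAt_multSeries_ray {f : E n → ℂ} {m : ℕ → ℝ} (hf : f ∈ harmonicSpace n)
    (hm : PolyBdd m) {x : E n} (hx : ‖x‖ < 1) :
    HasDerivAt (fun r : ℝ => multSeries m f (r • x)) (multSeries (fun k => k * m k) f x) 1 := by
  -- Absolute convergence at the slightly larger point τx dominates the differentiated series for
  -- all r < τ, an interval containing 1.
  obtain ⟨τ, hτ1, hτ2⟩ : ∃ τ : ℝ, 1 < τ ∧ τ * ‖x‖ < 1 := by
    have h1 : ∀ᶠ τ : ℝ in 𝓝[>] 1, τ * ‖x‖ < 1 := by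
      have : Tendsto (fun τ : ℝ => τ * ‖x‖) (𝓝 1) (𝓝 (1 * ‖x‖)) := tendsto_id.mul_const _
      rw [one_mul] at this
      exact nhdsWithin_le_nhds (this.eventually_lt_const hx)
    obtain ⟨τ, h2, h3⟩ := (h1.and self_mem_nhdsWithin).exists
    exact ⟨τ, h3, h2⟩
  have hτ0 : 0 < τ := one_pos.trans hτ1
  have hsum := summable_norm_mult hf (polyBdd_natCast.mul hm) (x := τ • x)
    (by rwa [norm_smul, Real.norm_of_nonneg hτ0.le])
  have h1 := hasDerivAt_tsum_of_isPreconnected (t := Set.Ioo 0 τ) hsum isOpen_Ioo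
    isPreconnected_Ioo (g := fun k (r : ℝ) => r ^ k • (m k • homogPart f k x))
    (g' := fun k (r : ℝ) => ((k : ℝ) * r ^ (k - 1)) • (m k • homogPart f k x)) (y₀ := 1) (y := 1)
    (fun k r _ => (hasDerivAt_pow k r).smul_const _) ?_ ⟨one_pos, hτ1⟩ ?_ ⟨one_pos, hτ1⟩
  · have h2 : (fun r : ℝ => multSeries m f (r • x)) =
        fun r => ∑' k, r ^ k • (m k • homogPart f k x) := by
      ext r; exact multSeries_smul m f r x
    rw [h2]
    have h4 : multSeries (fun k => k * m k) f x =
        ∑' k : ℕ, ((k : ℝ) * 1 ^ (k - 1)) • (m k • homogPart f k x) := by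
      simp only [multSeries, one_pow, mul_one, smul_smul]
    rw [h4]
    exact h1
  · intro k r hr
    rw [homogPart_smul, norm_smul, norm_smul, norm_smul, norm_smul, norm_mul, norm_mul, norm_pow,
      norm_pow, Real.norm_of_nonneg hr.1.le, Real.norm_of_nonneg hτ0.le]
    have h3 : r ^ (k - 1) ≤ τ ^ k :=
      (pow_le_pow_left₀ hr.1.le hr.2.le _).trans (pow_le_pow_right₀ hτ1.le (Nat.sub_le _ _))
    calc ‖(k : ℝ)‖ * r ^ (k - 1) * (‖m k‖ * ‖homogPart f k x‖)
        ≤ ‖(k : ℝ)‖ * τ ^ k * (‖m k‖ * ‖homogPart f k x‖) := by gcongr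
      _ = _ := by ring
  · simpa using summable_mult hf hm hx

/-- A Cauchy estimate: the multiplier k is the radial derivative, and the Lipschitz bound at scale
1-|x| costs one power of 1-|x|. -/
lemma exists_transfer_natCast_mul (n : ℕ) (A : ℝ) (hA : 0 < A) :
    ∃ C : ℝ, 0 < C ∧ ∀ f ∈ harmonicSpace n, ∀ m, PolyBdd m → ∀ ε : ℝ, 0 < ε →
      Growth (multSeries m f) A ε → Growth (multSeries (fun k => k * m k) f) (A + 1) (C * ε) := by
  obtain ⟨C, hC0, hC⟩ := exists_norm_sub_le_of_hasMeanValue n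
  refine ⟨C * (4 * 2 ^ A), by positivity, fun f hf m hm ε hε hg => ?_⟩
  obtain ⟨ρ, hρ, hgρ⟩ := eventually_nearSphere_iff.1 hg
  -- Beyond this radius the ball about x of radius (1-|x|)/2 stays in |z| > ρ.
  refine eventually_nearSphere_iff.2 ⟨(2 * ρ + 1) / 3, by linarith, fun x hx1 hx2 => ?_⟩
  set u := 1 - ‖x‖ with hu
  have hu0 : 0 < u := by linarith
  set M := ε * (u / 2) ^ (-A) with hM
  have hM0 : 0 ≤ M := by positivity
  have hsup : ∀ z ∈ closedBall x (2 * (u / 4)), ‖multSeries m f z‖ ≤ M := by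
    intro z hz
    have h1 : ‖z - x‖ ≤ u / 2 := by
      have := mem_closedBall.1 hz
      rw [dist_eq_norm] at this
      linarith
    have h2 := norm_sub_norm_le z x
    have h3 := norm_sub_norm_le x z
    rw [norm_sub_rev] at h3
    refine (hgρ z (by linarith) (by linarith)).trans ?_
    refine mul_le_mul_of_nonneg_left ?_ hε.le
    exact Real.rpow_le_rpow_of_nonpos (by linarith) (by linarith) (by linarith)
  have hlip := hC _ (hasMeanValue_multSeries hf hm) x
  have hd := hasDerivAt_multSeries_ray hf hm hx2
  have hb : ‖multSeries (fun k => k * m k) f x‖ ≤ C * M / (u / 4) := by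
    refine hd.le_of_lip' (by positivity) ?_
    filter_upwards [ball_mem_nhds (1 : ℝ) (by positivity : 0 < u / 4)] with r hr
    have hr' : |r - 1| < u / 4 := by simpa [Real.dist_eq] using hr
    have e1 : ‖r • x - x‖ = |r - 1| * ‖x‖ := by
      rw [← Real.norm_eq_abs, ← norm_smul, sub_smul, one_smul]
    have e2 : ‖r • x - x‖ ≤ |r - 1| := by
      rw [e1]; exact mul_le_of_le_one_right (abs_nonneg _) hx2.le
    have h1 := hlip (r • x) (u / 4) M (by positivity) (e2.trans hr'.le) (by linarith) hsup
    rw [one_smul]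
    refine h1.trans ?_
    rw [Real.norm_eq_abs, div_mul_eq_mul_div, ← mul_div_assoc]
    gcongr
  refine hb.trans_eq ?_
  have e3 : (u / 2) ^ (-A) = 2 ^ A * u ^ (-A) := by
    rw [Real.div_rpow hu0.le (by norm_num), Real.rpow_neg (by norm_num : (0 : ℝ) ≤ 2), div_inv_eq_mul,
      mul_comm]
  have e4 : u ^ (-(A + 1)) = u ^ (-A) / u := by
    rw [neg_add, ← sub_eq_add_neg, Real.rpow_sub_one hu0.ne']
  rw [hM, e3, e4]
  field_simp

lemma transfer_add_const {d A : ℝ} (hd : 0 ≤ d) (hA : 0 < A) :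
    Transfer n (fun k => (k : ℝ) + d) A (A + 1) := by
  obtain ⟨C, hC0, hC⟩ := exists_transfer_natCast_mul n A hA
  refine ⟨polyBdd_add_const d, C + d, by positivity, fun f hf m hm ε hε hg => ?_⟩
  have h0 : ∀ᶠ x in nearSphere n, ‖x‖ < 1 :=
    eventually_nearSphere_iff.2 ⟨0, one_pos, fun x _ h => h⟩
  filter_upwards [hC f hf m hm ε hε hg, hg, h0] with x h1 h2 hx
  have hs1 := summable_mult hf (polyBdd_natCast.mul hm) hx
  have hs2 := summable_mult hf ((polyBdd_const d).mul hm) hx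
  have e1 : multSeries (fun k => ((k : ℝ) + d) * m k) f x =
      multSeries (fun k => k * m k) f x + d • multSeries m f x := by
    simp only [multSeries, add_mul, add_smul]
    rw [hs1.tsum_add hs2]
    congr 1
    simp only [mul_smul]
    exact tsum_const_smul'' d
  have hu : (1 - ‖x‖) ^ (-A) ≤ (1 - ‖x‖) ^ (-(A + 1)) :=
    Real.rpow_le_rpow_of_exponent_ge (by linarith) (by linarith [norm_nonneg x]) (by linarith)
  rw [e1, add_mul, add_mul]
  refine (norm_add_le _ _).trans (add_le_add h1 ?_)
  rw [norm_smul, Real.norm_of_nonneg hd, mul_assoc]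
  refine mul_le_mul_of_nonneg_left (h2.trans ?_) hd
  gcongr

end Differentiation

/-! ### Lowering the exponent by Beta averages of dilates -/

section FractionalIntegration

/-- The weight `r^(d-1) (1-r)^(c-1)`. -/
def betaWeight (d c r : ℝ) : ℝ := r ^ (d - 1) * (1 - r) ^ (c - 1)

variable {d c : ℝ}

lemma betaWeight_nonneg {r : ℝ} (hr : r ∈ Set.Ioo (0 : ℝ) 1) : 0 ≤ betaWeight d c r :=
  mul_nonneg (Real.rpow_nonneg hr.1.le _) (Real.rpow_nonneg (by linarith [hr.2]) _)

lemma integrableOn_betaWeight (hd : 0 < d) (hc : 0 < c) :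
    IntegrableOn (betaWeight d c) (Set.Ioo 0 1) := by
  have h1 := ProbabilityTheory.lintegral_betaPDF_eq_one hd hc
  rw [ProbabilityTheory.lintegral_betaPDF] at h1
  have hb := ProbabilityTheory.beta_pos hd hc
  have h2 : IntegrableOn (fun x : ℝ => 1 / ProbabilityTheory.beta d c * x ^ (d - 1) *
      (1 - x) ^ (c - 1)) (Set.Ioo 0 1) := by
    refine (lintegral_ofReal_ne_top_iff_integrable ?_ ?_).1 (by rw [h1]; simp)
    · exact Measurable.aestronglyMeasurable (by fun_prop)
    · refine (ae_restrict_iff' measurableSet_Ioo).2 (Eventually.of_forall fun r hr => ?_)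
      have := betaWeight_nonneg (d := d) (c := c) hr
      rw [betaWeight] at this
      simp only [Pi.zero_apply]
      rw [mul_assoc]
      positivity
  refine (h2.const_mul (ProbabilityTheory.beta d c)).congr (Eventually.of_forall fun r => ?_)
  simp only [betaWeight]
  field_simp

lemma integral_betaWeight (hd : 0 < d) (hc : 0 < c) :
    ∫ r in Set.Ioo 0 1, betaWeight d c r = Real.Gamma d * Real.Gamma c / Real.Gamma (d + c) := by
  have h1 := ProbabilityTheory.lintegral_betaPDF_eq_one hd hc
  rw [ProbabilityTheory.lintegral_betaPDF] at h1
  have hb := ProbabilityTheory.beta_pos hd hc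
  have h2 : ∫ x in Set.Ioo (0 : ℝ) 1, 1 / ProbabilityTheory.beta d c * betaWeight d c x = 1 := by
    rw [integral_eq_lintegral_of_nonneg_ae]
    · simp only [betaWeight, ← mul_assoc, h1, ENNReal.toReal_one]
    · refine (ae_restrict_iff' measurableSet_Ioo).2 (Eventually.of_forall fun r hr => ?_)
      have := betaWeight_nonneg (d := d) (c := c) hr
      simp only [Pi.zero_apply]
      positivity
    · exact ((integrableOn_betaWeight hd hc).const_mul _).aestronglyMeasurable
  rw [integral_const_mul, one_div, inv_mul_eq_one₀ hb.ne'] at h2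
  rw [← h2, ProbabilityTheory.beta]

/-- Degree k picks up r^k under dilation, so these moments are exactly the multipliers produced by
averaging dilates. -/
lemma integral_pow_mul_betaWeight (hd : 0 < d) (hc : 0 < c) (k : ℕ) :
    ∫ r in Set.Ioo 0 1, r ^ k * betaWeight d c r =
      Real.Gamma c * (Real.Gamma (k + d) / Real.Gamma (k + (d + c))) := by
  have h1 : ∫ r in Set.Ioo 0 1, r ^ k * betaWeight d c r =
      ∫ r in Set.Ioo 0 1, betaWeight (k + d) c r := by
    refine setIntegral_congr_fun measurableSet_Ioo fun r hr => ?_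
    simp only [betaWeight]
    rw [← mul_assoc, ← Real.rpow_natCast, ← Real.rpow_add hr.1, add_sub_assoc]
  rw [h1, integral_betaWeight (by positivity) hc, add_assoc]
  ring

lemma integrableOn_pow_mul_betaWeight (hd : 0 < d) (hc : 0 < c) (k : ℕ) :
    IntegrableOn (fun r => r ^ k * betaWeight d c r) (Set.Ioo 0 1) := by
  refine (integrableOn_betaWeight (by positivity : 0 < k + d) hc).congr_fun (fun r hr => ?_)
    measurableSet_Ioo
  simp only [betaWeight]
  rw [← mul_assoc, ← Real.rpow_natCast, ← Real.rpow_add hr.1, add_sub_assoc]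

lemma abs_Gamma_div_Gamma_le (hd : 0 < d) (hc : 0 < c) (k : ℕ) :
    |Real.Gamma (k + d) / Real.Gamma (k + (d + c))| ≤ Real.Gamma d / Real.Gamma (d + c) := by
  have hk : (0 : ℝ) ≤ k := Nat.cast_nonneg k
  have g1 := Real.Gamma_pos_of_pos (by positivity : 0 < k + d)
  have g2 := Real.Gamma_pos_of_pos (by positivity : 0 < k + (d + c))
  have g3 := Real.Gamma_pos_of_pos hc
  rw [abs_of_pos (by positivity)]
  have h1 : ∫ r in Set.Ioo 0 1, r ^ k * betaWeight d c r ≤ ∫ r in Set.Ioo 0 1, betaWeight d c r := by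
    refine setIntegral_mono_on (integrableOn_pow_mul_betaWeight hd hc k)
      (integrableOn_betaWeight hd hc) measurableSet_Ioo fun r hr => ?_
    exact mul_le_of_le_one_left (betaWeight_nonneg hr) (pow_le_one₀ hr.1.le hr.2.le)
  rw [integral_pow_mul_betaWeight hd hc, integral_betaWeight hd hc, mul_comm (Real.Gamma d),
    mul_div_assoc] at h1
  exact le_of_mul_le_mul_left h1 g3

/-- An integrable majorant of `v^(c-1) min(u^(-A), v^(-A))` on `(0, ∞)`. -/
def splitWeight (A c u : ℝ) (v : ℝ) : ℝ :=
  (Set.Ioc 0 u).indicator (fun v => u ^ (-A) * v ^ (c - 1)) v +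
    (Set.Ioi u).indicator (fun v => v ^ (c - 1 - A)) v

lemma integrable_splitWeight_and_integral {A u : ℝ} (hc : 0 < c) (hA : c < A) (hu : 0 < u) :
    Integrable (splitWeight A c u) ∧
      ∫ v, splitWeight A c u v = (1 / c + 1 / (A - c)) * u ^ (-(A - c)) := by
  have i1 : IntegrableOn (fun v : ℝ => u ^ (-A) * v ^ (c - 1)) (Set.Ioc 0 u) := by
    rw [← intervalIntegrable_iff_integrableOn_Ioc_of_le hu.le]
    exact (intervalIntegral.intervalIntegrable_rpow' (by linarith)).const_mul _
  have i2 : IntegrableOn (fun v : ℝ => v ^ (c - 1 - A)) (Set.Ioi u) :=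
    integrableOn_Ioi_rpow_of_lt (by linarith) hu
  have j1 := (integrable_indicator_iff measurableSet_Ioc).2 i1
  have j2 := (integrable_indicator_iff measurableSet_Ioi).2 i2
  refine ⟨j1.add j2, ?_⟩
  simp only [splitWeight]
  rw [integral_add j1 j2, integral_indicator measurableSet_Ioc, integral_indicator measurableSet_Ioi,
    integral_Ioi_rpow_of_lt (by linarith) hu, ← intervalIntegral.integral_of_le hu.le,
    intervalIntegral.integral_const_mul, integral_rpow (Or.inl (by linarith))]
  have e1 : c - 1 + 1 = c := by ring
  have e2 : c - 1 - A + 1 = -(A - c) := by ring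
  rw [e1, e2, Real.zero_rpow hc.ne', sub_zero, ← mul_div_assoc, ← Real.rpow_add hu, neg_div_neg_eq,
    show -A + c = -(A - c) by ring]
  ring

/-- For r ≤ 1/2 one has 1-rρ ≥ 1/2. For r > 1/2 the factor r^(d-1) is at most 2 even if d < 1, and
1-rρ is at least both 1-r and 1-ρ. -/
lemma betaWeight_mul_le {A ρ r : ℝ} (hd : 0 < d) (hA : 0 < A) (hρ : ρ ∈ Set.Ico (0 : ℝ) 1)
    (hr : r ∈ Set.Ioo (0 : ℝ) 1) :
    betaWeight d c r * (1 - r * ρ) ^ (-A) ≤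
      2 ^ A * betaWeight d c r + 2 * splitWeight A c (1 - ρ) (1 - r) := by
  have hw := betaWeight_nonneg (d := d) (c := c) hr
  have hr1 : 0 < 1 - r := by linarith [hr.2]
  have hu : 0 < 1 - ρ := by linarith [hρ.2]
  have hc1 : 0 ≤ (1 - r) ^ (c - 1) := Real.rpow_nonneg hr1.le _
  have hsp : 0 ≤ splitWeight A c (1 - ρ) (1 - r) := by
    refine add_nonneg (Set.indicator_nonneg (fun v hv => ?_) _)
      (Set.indicator_nonneg (fun v hv => ?_) _)
    · have := hv.1
      positivity
    · have : 0 < v := hu.trans hv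
      positivity
  rcases le_or_gt r (1 / 2) with hr2 | hr2
  · have h1 : (1 - r * ρ) ^ (-A) ≤ 2 ^ A := by
      calc (1 - r * ρ) ^ (-A) ≤ (1 / 2) ^ (-A) :=
            Real.rpow_le_rpow_of_nonpos (by norm_num) (by nlinarith [hρ.1, hρ.2, hr.1]) (by linarith)
        _ = 2 ^ A := by rw [one_div, Real.inv_rpow (by norm_num), Real.rpow_neg (by norm_num), inv_inv]
    nlinarith
  · have h1 : r ^ (d - 1) ≤ 2 := by
      rw [Real.rpow_sub_one hr.1.ne', div_le_iff₀ hr.1]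
      have := Real.rpow_le_one hr.1.le hr.2.le hd.le
      linarith
    have h2 : (1 - r) ^ (c - 1) * (1 - r * ρ) ^ (-A) ≤ splitWeight A c (1 - ρ) (1 - r) := by
      rcases le_or_gt (1 - r) (1 - ρ) with h | h
      · rw [splitWeight, Set.indicator_of_mem (show 1 - r ∈ Set.Ioc 0 (1 - ρ) from ⟨hr1, h⟩),
          Set.indicator_of_notMem (by simp only [Set.mem_Ioi, not_lt]; exact h), add_zero, mul_comm]
        refine mul_le_mul_of_nonneg_right ?_ hc1
        exact Real.rpow_le_rpow_of_nonpos hu (by nlinarith [hρ.1, hr.2]) (by linarith)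
      · rw [splitWeight, Set.indicator_of_notMem (by simp only [Set.mem_Ioc, not_and]; intro; linarith),
          Set.indicator_of_mem (by simpa using h), zero_add, sub_eq_add_neg (c - 1), Real.rpow_add hr1]
        refine mul_le_mul_of_nonneg_left ?_ hc1
        exact Real.rpow_le_rpow_of_nonpos hr1 (by nlinarith [hρ.2, hr.1]) (by linarith)
    have h3 : betaWeight d c r * (1 - r * ρ) ^ (-A) ≤ 2 * splitWeight A c (1 - ρ) (1 - r) := by
      rw [betaWeight, mul_assoc]
      have h4 : 0 ≤ (1 - r * ρ) ^ (-A) := Real.rpow_nonneg (by nlinarith [hρ.1, hρ.2, hr.1, hr.2]) _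
      exact mul_le_mul h1 h2 (mul_nonneg hc1 h4) (by norm_num)
    have h5 : (0 : ℝ) ≤ 2 ^ A := by positivity
    nlinarith

variable {n : ℕ}

lemma exists_norm_le_of_growth {w : E n → ℂ} (hw : ContinuousOn w (ball 0 1)) {A ε : ℝ}
    (hε : 0 < ε) (hg : Growth w A ε) :
    ∃ K : ℝ, 0 ≤ K ∧ ∀ x : E n, ‖x‖ < 1 → ‖w x‖ ≤ ε * (1 - ‖x‖) ^ (-A) + K := by
  obtain ⟨ρ, hρ, h⟩ := eventually_nearSphere_iff.1 hg
  obtain ⟨K, hK⟩ := (isCompact_closedBall (0 : E n) ρ).exists_bound_of_continuousOn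
    (hw.mono (closedBall_subset_ball hρ))
  refine ⟨max K 0, le_max_right _ _, fun x hx => ?_⟩
  have h1 : 0 ≤ ε * (1 - ‖x‖) ^ (-A) := mul_nonneg hε.le (Real.rpow_nonneg (by linarith) _)
  rcases lt_or_ge ρ ‖x‖ with hx2 | hx2
  · have := h x hx2 hx
    have := le_max_right K 0
    linarith
  · have := hK x (by simpa using hx2)
    have := le_max_left K 0
    linarith

lemma tendsto_one_sub_norm_rpow_neg {a : ℝ} (ha : 0 < a) :
    Tendsto (fun x : E n => (1 - ‖x‖) ^ (-a)) (nearSphere n) atTop := by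
  have h1 : Tendsto (fun x : E n => ‖x‖) (nearSphere n) (𝓝[<] 1) := tendsto_comap
  have h2 : Tendsto (fun t : ℝ => 1 - t) (𝓝[<] 1) (𝓝[>] 0) := by
    refine tendsto_nhdsWithin_iff.2 ⟨?_, ?_⟩
    · have : Tendsto (fun t : ℝ => 1 - t) (𝓝 1) (𝓝 (1 - 1)) := tendsto_const_nhds.sub tendsto_id
      rw [sub_self] at this
      exact this.mono_left nhdsWithin_le_nhds
    · filter_upwards [self_mem_nhdsWithin] with t ht
      simpa using ht
  exact (tendsto_rpow_neg_nhdsGT_zero (by linarith)).comp (h2.comp h1)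

lemma multSeries_gamma_eq_integral {f : E n → ℂ} {m : ℕ → ℝ} (hf : f ∈ harmonicSpace n)
    (hm : PolyBdd m) (hd : 0 < d) (hc : 0 < c) {x : E n} (hx : ‖x‖ < 1) :
    Real.Gamma c • multSeries
        (fun k => Real.Gamma (k + d) / Real.Gamma (k + (d + c)) * m k) f x =
      ∫ r in Set.Ioo (0 : ℝ) 1, betaWeight d c r • multSeries m f (r • x) := by
  set F : ℕ → ℝ → ℂ := fun k r => (r ^ k * betaWeight d c r) • (m k • homogPart f k x) with hF
  have hFi : ∀ k, Integrable (F k) (volume.restrict (Set.Ioo 0 1)) := fun k =>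
    (integrableOn_pow_mul_betaWeight hd hc k).smul_const _
  have hn : ∀ k, ∫ r in Set.Ioo (0 : ℝ) 1, ‖F k r‖ ≤
      (∫ r in Set.Ioo (0 : ℝ) 1, betaWeight d c r) * ‖m k • homogPart f k x‖ := by
    intro k
    rw [← integral_mul_const]
    refine setIntegral_mono_on (hFi k).norm ((integrableOn_betaWeight hd hc).mul_const _)
      measurableSet_Ioo fun r hr => ?_
    have hw := betaWeight_nonneg (d := d) (c := c) hr
    have hrk : 0 ≤ r ^ k := pow_nonneg hr.1.le k
    rw [hF, norm_smul, Real.norm_of_nonneg (mul_nonneg hrk hw)]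
    refine mul_le_mul_of_nonneg_right ?_ (norm_nonneg _)
    exact mul_le_of_le_one_left hw (pow_le_one₀ hr.1.le hr.2.le)
  have hs := hasSum_integral_of_summable_integral_norm hFi
    (((summable_norm_mult hf hm hx).mul_left _).of_nonneg_of_le
      (fun k => integral_nonneg fun _ => norm_nonneg _) hn)
  have h1 : ∀ k, ∫ r in Set.Ioo (0 : ℝ) 1, F k r = Real.Gamma c •
      ((Real.Gamma (k + d) / Real.Gamma (k + (d + c)) * m k) • homogPart f k x) := by
    intro k
    simp only [hF]
    rw [integral_smul_const, integral_pow_mul_betaWeight hd hc, smul_smul, smul_smul, mul_assoc]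
  have h2 : ∀ r : ℝ, ∑' k, F k r = betaWeight d c r • multSeries m f (r • x) := by
    intro r
    rw [multSeries_smul, ← tsum_const_smul'']
    simp only [hF, smul_smul]
    refine tsum_congr fun k => ?_
    congr 1
    ring
  simp_rw [h1, h2] at hs
  rw [← hs.tsum_eq, multSeries, tsum_const_smul'']

/-- Averaging (1-r|x|)^(-A) against the Beta weight gains the power c. The condition c < A keeps the
resulting exponent positive. -/
theorem transfer_gamma_div_gamma {A : ℝ} (hd : 0 < d) (hc : 0 < c) (hA : c < A) :
    Transfer n (fun k => Real.Gamma (k + d) / Real.Gamma (k + (d + c))) A (A - c) := by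
  have hΓ := Real.Gamma_pos_of_pos hc
  set B := ∫ r in Set.Ioo (0 : ℝ) 1, betaWeight d c r with hB
  have hB0 : 0 ≤ B := setIntegral_nonneg measurableSet_Ioo fun r hr => betaWeight_nonneg hr
  have hA0 : 0 < A := hc.trans hA
  have hAc : 0 < A - c := by linarith
  set D := 2 ^ A * B + 2 * (1 / c + 1 / (A - c)) with hD
  have hD0 : 0 < D := by positivity
  refine ⟨polyBdd_of_abs_le (abs_Gamma_div_Gamma_le hd hc), (Real.Gamma c)⁻¹ * (D + 1),
    by positivity, fun f hf m hm ε hε hg => ?_⟩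
  obtain ⟨K, hK0, hK⟩ := exists_norm_le_of_growth (continuousOn_multSeries hf hm) hε hg
  -- K depends on the function and must not enter the constant. Since the target weight blows up,
  -- the contribution KB is eventually at most ε times that weight.
  have hlarge := (tendsto_one_sub_norm_rpow_neg (n := n) hAc).eventually_ge_atTop (K * B / ε)
  have h0 : ∀ᶠ x in nearSphere n, ‖x‖ < 1 :=
    eventually_nearSphere_iff.2 ⟨0, one_pos, fun x _ h => h⟩
  filter_upwards [hlarge, h0] with x hxl hx
  have hu : 0 < 1 - ‖x‖ := by linarith
  have hu1 : 1 ≤ (1 - ‖x‖) ^ (-(A - c)) :=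
    Real.one_le_rpow_of_pos_of_le_one_of_nonpos hu (by linarith [norm_nonneg x]) (by linarith)
  obtain ⟨si, se⟩ := integrable_splitWeight_and_integral hc hA hu
  have si' : Integrable fun r => splitWeight A c (1 - ‖x‖) (1 - r) := si.comp_sub_left 1
  have se' : ∫ r, splitWeight A c (1 - ‖x‖) (1 - r) = _ :=
    (integral_sub_left_eq_self (splitWeight A c (1 - ‖x‖)) volume 1).trans se
  have hspn : ∀ v, 0 ≤ splitWeight A c (1 - ‖x‖) v := fun v => by
    refine add_nonneg (Set.indicator_nonneg (fun v hv => ?_) _)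
      (Set.indicator_nonneg (fun v hv => ?_) _)
    · have := hv.1
      positivity
    · have : 0 < v := hu.trans hv
      positivity
  have hw := integrableOn_betaWeight hd hc
  have h1 : ‖∫ r in Set.Ioo (0 : ℝ) 1, betaWeight d c r • multSeries m f (r • x)‖ ≤
      ∫ r in Set.Ioo (0 : ℝ) 1, ((ε * 2 ^ A + K) * betaWeight d c r +
        2 * ε * splitWeight A c (1 - ‖x‖) (1 - r)) := by
    refine norm_integral_le_of_norm_le ((hw.const_mul _).add (si'.integrableOn.const_mul _)) ?_
    refine (ae_restrict_iff' measurableSet_Ioo).2 (Eventually.of_forall fun r hr => ?_)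
    have hwr := betaWeight_nonneg (d := d) (c := c) hr
    rw [norm_smul, Real.norm_of_nonneg hwr]
    have hrx : ‖r • x‖ = r * ‖x‖ := by rw [norm_smul, Real.norm_of_nonneg hr.1.le]
    have h2 := hK (r • x) (by rw [hrx]; nlinarith [hr.1, hr.2, norm_nonneg x])
    rw [hrx] at h2
    have h3 := betaWeight_mul_le (c := c) hd hA0 ⟨norm_nonneg x, hx⟩ hr
    have h4 := mul_le_mul_of_nonneg_left h2 hwr
    have h5 := mul_le_mul_of_nonneg_left h3 hε.le
    linarith
  rw [integral_add (hw.const_mul _) (si'.integrableOn.const_mul _), integral_const_mul,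
    integral_const_mul, ← hB] at h1
  have h6 : ∫ r in Set.Ioo (0 : ℝ) 1, splitWeight A c (1 - ‖x‖) (1 - r) ≤
      (1 / c + 1 / (A - c)) * (1 - ‖x‖) ^ (-(A - c)) := by
    rw [← se']
    exact setIntegral_le_integral si' (Eventually.of_forall fun r => hspn _)
  rw [← multSeries_gamma_eq_integral hf hm hd hc hx, norm_smul, Real.norm_of_nonneg hΓ.le] at h1
  rw [div_le_iff₀ hε] at hxl
  set U := (1 - ‖x‖) ^ (-(A - c)) with hU
  have h7 : Real.Gamma c * ‖multSeries
      (fun k => Real.Gamma (k + d) / Real.Gamma (k + (d + c)) * m k) f x‖ ≤ (D + 1) * ε * U := by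
    refine h1.trans ?_
    have h8 : 2 * ε * ∫ r in Set.Ioo (0 : ℝ) 1, splitWeight A c (1 - ‖x‖) (1 - r) ≤
        2 * ε * ((1 / c + 1 / (A - c)) * U) := by gcongr
    have h9 : ε * 2 ^ A * B ≤ ε * 2 ^ A * B * U := le_mul_of_one_le_right (by positivity) hu1
    rw [hD]
    linarith
  rw [mul_assoc, mul_assoc, inv_mul_eq_div, le_div_iff₀ hΓ, mul_comm ‖_‖]
  linarith

lemma transfer_gamma_add_nat {b A : ℝ} (hb : 0 < b) (hA : 0 < A) (N : ℕ) :
    Transfer n (fun k => Real.Gamma (k + (b + N)) / Real.Gamma (k + b)) A (A + N) := by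
  induction N with
  | zero =>
    have h1 : (fun k : ℕ => Real.Gamma (k + (b + (0 : ℕ))) / Real.Gamma (k + b)) = fun _ => 1 := by
      ext k
      have hk : (0 : ℝ) ≤ k := Nat.cast_nonneg k
      rw [Nat.cast_zero, add_zero, div_self (Real.Gamma_pos_of_pos (by positivity)).ne']
    rw [h1]
    exact (Transfer.one A).congr_exponent rfl (by simp)
  | succ N ih =>
    have h2 := ih.comp (transfer_add_const (d := b + N) (by positivity) (by positivity))
    have h3 : (fun k : ℕ => ((k : ℝ) + (b + N)) * (Real.Gamma (k + (b + N)) / Real.Gamma (k + b))) =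
        fun k : ℕ => Real.Gamma (k + (b + (N + 1 : ℕ))) / Real.Gamma (k + b) := by
      ext k
      have hk : (0 : ℝ) ≤ k := Nat.cast_nonneg k
      rw [← mul_div_assoc, ← Real.Gamma_add_one (by positivity)]
      push_cast
      ring_nf
    rw [h3] at h2
    exact h2.congr_exponent rfl (by push_cast; ring)

/-- Quotients of Gamma functions shift the growth exponent by their order. -/
theorem transfer_gamma_ratio {a b A : ℝ} (ha : 0 < a) (hb : 0 < b) (hA : 0 < A)
    (hAab : 0 < A + (a - b)) :
    Transfer n (fun k => Real.Gamma (k + a) / Real.Gamma (k + b)) A (A + (a - b)) := by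
  -- Raise by N whole steps, then lower by b + N - a > 0: the exponents stay positive throughout.
  obtain ⟨N, hN⟩ := exists_nat_gt (a - b)
  have h1 := (transfer_gamma_add_nat (n := n) hb hA N).comp
    (transfer_gamma_div_gamma (d := a) (c := b + N - a) ha (by linarith) (by linarith))
  have h2 : (fun k : ℕ => Real.Gamma (k + a) / Real.Gamma (k + (a + (b + N - a))) *
      (Real.Gamma (k + (b + N)) / Real.Gamma (k + b))) =
        fun k : ℕ => Real.Gamma (k + a) / Real.Gamma (k + b) := by
    ext k
    have hk : (0 : ℝ) ≤ k := Nat.cast_nonneg k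
    rw [add_sub_cancel, div_mul_div_cancel₀ (Real.Gamma_pos_of_pos (by positivity)).ne']
  rw [h2] at h1
  exact h1.congr_exponent rfl (by ring)

end FractionalIntegration

/-! ### The coefficients γ_k as Gamma quotients -/

section GammaCoeff

variable {n : ℕ}

/-- This puts both branches of the definition in one form. Only the order a - b matters later, and
the last factor cancels in quotients of coefficients. -/
lemma exists_gammaCoeff_eq (hn : 0 < n) (α : ℝ) :
    ∃ c a b : ℝ, 0 < c ∧ 0 < a ∧ 0 < b ∧ a - b = n / 2 + α ∧ ∀ k : ℕ, gammaCoeff n k α =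
      c * (Real.Gamma (k + a) / Real.Gamma (k + b)) *
        (Real.Gamma (k + 1) / Real.Gamma (k + n / 2)) := by
  have hn' : (0 : ℝ) < n / 2 := by positivity
  have g0 := Real.Gamma_pos_of_pos hn'
  have hg (a : ℝ) (ha : 0 < a) (k : ℕ) : 0 < Real.Gamma (k + a) :=
    Real.Gamma_pos_of_pos (by positivity)
  by_cases h : -(1 + (n : ℝ) / 2) < α
  · have ha : 0 < 1 + (n : ℝ) / 2 + α := by linarith
    have g1 := Real.Gamma_pos_of_pos ha
    refine ⟨Real.Gamma (n / 2) / Real.Gamma (1 + n / 2 + α), 1 + n / 2 + α, 1, by positivity, ha,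
      one_pos, by ring, fun k => ?_⟩
    have p1 := hg _ ha k
    have p2 := hg 1 one_pos k
    have p3 := hg _ hn' k
    rw [gammaCoeff, if_pos h, poch, poch, add_comm _ (k : ℝ), add_comm _ (k : ℝ)]
    field_simp
  · have hb : 0 < 1 - ((n : ℝ) / 2 + α) := by linarith
    have g1 := Real.Gamma_pos_of_pos hb
    refine ⟨Real.Gamma (1 - (n / 2 + α)) * Real.Gamma (n / 2), 1, 1 - (n / 2 + α), by positivity,
      one_pos, hb, by ring, fun k => ?_⟩
    have p1 := hg _ hb k
    have p2 := hg 1 one_pos k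
    have p3 := hg _ hn' k
    rw [gammaCoeff, if_neg h, poch, poch, poch, Real.Gamma_one, add_comm _ (k : ℝ),
      add_comm _ (k : ℝ), add_comm _ (k : ℝ)]
    field_simp

lemma gammaCoeff_pos (hn : 0 < n) (k : ℕ) (α : ℝ) : 0 < gammaCoeff n k α := by
  obtain ⟨c, a, b, hc, ha, hb, -, h⟩ := exists_gammaCoeff_eq hn α
  rw [h]
  have g1 := Real.Gamma_pos_of_pos (by positivity : (0 : ℝ) < k + a)
  have g2 := Real.Gamma_pos_of_pos (by positivity : (0 : ℝ) < k + b)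
  have g3 := Real.Gamma_pos_of_pos (by positivity : (0 : ℝ) < k + 1)
  have g4 := Real.Gamma_pos_of_pos (by positivity : (0 : ℝ) < k + n / 2)
  positivity

/-- Two Gamma quotients are applied in turn; `hA₁` keeps the exponent between them positive. -/
lemma transfer_gammaCoeff_div (hn : 0 < n) {α α' A : ℝ} (hA : 0 < A) (hA₁ : 0 < A + (n / 2 + α))
    (hA₂ : 0 < A + (α - α')) :
    Transfer n (fun k => gammaCoeff n k α / gammaCoeff n k α') A (A + (α - α')) := by
  obtain ⟨c, a, b, hc, ha, hb, hab, h⟩ := exists_gammaCoeff_eq hn α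
  obtain ⟨c', a', b', hc', ha', hb', hab', h'⟩ := exists_gammaCoeff_eq hn α'
  have t1 := transfer_gamma_ratio (n := n) ha hb hA (by rw [hab]; exact hA₁)
  have t2 := transfer_gamma_ratio (n := n) hb' ha' (A := A + (a - b)) (by rw [hab]; exact hA₁)
    (by linarith)
  have t3 := (t1.comp t2).comp (transfer_const (c := c / c') (by positivity) _)
  have e : (fun k : ℕ => c / c' * (Real.Gamma (k + b') / Real.Gamma (k + a') *
      (Real.Gamma (k + a) / Real.Gamma (k + b)))) =
        fun k => gammaCoeff n k α / gammaCoeff n k α' := by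
    ext k
    have g1 := Real.Gamma_pos_of_pos (by positivity : (0 : ℝ) < k + a)
    have g2 := Real.Gamma_pos_of_pos (by positivity : (0 : ℝ) < k + b)
    have g3 := Real.Gamma_pos_of_pos (by positivity : (0 : ℝ) < k + 1)
    have g4 := Real.Gamma_pos_of_pos (by positivity : (0 : ℝ) < k + n / 2)
    have g5 := Real.Gamma_pos_of_pos (by positivity : (0 : ℝ) < k + a')
    have g6 := Real.Gamma_pos_of_pos (by positivity : (0 : ℝ) < k + b')
    rw [h, h']
    field_simp
  rw [e] at t3
  exact t3.congr_exponent rfl (by linarith)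

lemma polyBdd_gammaCoeff_div (hn : 0 < n) (α α' : ℝ) :
    PolyBdd fun k => gammaCoeff n k α / gammaCoeff n k α' := by
  have h1 := abs_nonneg α
  have h2 := abs_nonneg α'
  have h3 := neg_abs_le α
  have h4 := le_abs_self α'
  have hn0 : (0 : ℝ) ≤ n / 2 := by positivity
  exact (transfer_gammaCoeff_div hn (α := α) (α' := α') (A := |α| + |α'| + 1) (by linarith)
    (by linarith) (by linarith)).1

/-- The growth of `D^t_s f` controls the growth of `D^t'_s' f`. -/
theorem exists_growth_radialD_of_growth (hn : 0 < n) (s t s' t' : ℝ) {A A' : ℝ} (hA : 0 < A)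
    (hA' : 0 < A') (h : A' = A + (t' - t)) :
    ∃ C : ℝ, 0 < C ∧ ∀ f ∈ harmonicSpace n, ∀ ε : ℝ, 0 < ε →
      Growth (radialD s t f) A ε → Growth (radialD s' t' f) A' (C * ε) := by
  have hn0 : (0 : ℝ) ≤ n / 2 := by positivity
  -- Lifting the exponent by a large N gives room for applying D^t'_s' and undoing D^t_s. The lift
  -- is removed last.
  obtain ⟨N, hN⟩ := exists_nat_gt (|s| + |t| + |s'| + |t'|)
  have hs := abs_nonneg s
  have ht := abs_nonneg t
  have hs' := abs_nonneg s'
  have ht' := abs_nonneg t'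
  have hs1 := neg_abs_le s
  have ht1 := neg_abs_le t
  have hs1' := neg_abs_le s'
  have ht1' := neg_abs_le t'
  have ht2 := le_abs_self t
  have t1 := transfer_gamma_add_nat (n := n) one_pos hA N
  have t2 := transfer_gammaCoeff_div hn (α := s' + t') (α' := s') (A := A + N) (by linarith)
    (by linarith) (by linarith)
  have t3 := transfer_gammaCoeff_div hn (α := s) (α' := s + t) (A := A + N + (s' + t' - s'))
    (by linarith) (by linarith) (by linarith)
  have t4 := transfer_gamma_ratio (n := n) (a := 1) (b := 1 + N)
    (A := A + N + (s' + t' - s') + (s - (s + t))) one_pos (by positivity) (by linarith)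
    (by linarith)
  obtain ⟨-, C, hC, hT⟩ := ((t1.comp t2).comp t3).comp t4
  refine ⟨C, hC, fun f hf ε hε hg => ?_⟩
  have h1 := hT f hf _ (polyBdd_gammaCoeff_div hn (s + t) s) ε hε hg
  have e : multSeries (fun k => (Real.Gamma (k + 1) / Real.Gamma (k + (1 + N)) *
      (gammaCoeff n k s / gammaCoeff n k (s + t) * (gammaCoeff n k (s' + t') / gammaCoeff n k s' *
        (Real.Gamma (k + (1 + N)) / Real.Gamma (k + 1))))) *
          (gammaCoeff n k (s + t) / gammaCoeff n k s)) f = radialD s' t' f := by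
    ext x
    simp only [multSeries, radialD]
    refine tsum_congr fun k => ?_
    congr 1
    have g1 := Real.Gamma_pos_of_pos (by positivity : (0 : ℝ) < k + 1)
    have g2 := Real.Gamma_pos_of_pos (by positivity : (0 : ℝ) < k + (1 + N))
    have c1 := gammaCoeff_pos hn k s
    have c2 := gammaCoeff_pos hn k (s + t)
    have c3 := gammaCoeff_pos hn k s'
    field_simp
  rw [e] at h1
  rw [h]
  convert h1 using 1
  ring

end GammaCoeff

/-! ### Independence of the parameters s and t -/

section Spaces

variable {n : ℕ} {α s t : ℝ} {f g : E n → ℂ}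

lemma hasMeanValue_radialD (hn : 0 < n) (hf : f ∈ harmonicSpace n) (s t : ℝ) :
    HasMeanValue (radialD s t f) :=
  hasMeanValue_multSeries hf (polyBdd_gammaCoeff_div hn _ _)

lemma one_sub_norm_sq_pos {x : E n} (hx : ‖x‖ < 1) : 0 < 1 - ‖x‖ ^ 2 := by
  nlinarith [norm_nonneg x]

lemma one_sub_norm_le {x : E n} (hx : ‖x‖ < 1) : 1 - ‖x‖ ≤ 1 - ‖x‖ ^ 2 := by
  nlinarith [norm_nonneg x]

lemma one_sub_norm_sq_le {x : E n} : 1 - ‖x‖ ^ 2 ≤ 2 * (1 - ‖x‖) := by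
  nlinarith [sq_nonneg (1 - ‖x‖)]

lemma rpow_mul_norm_radialI {x : E n} (hx : ‖x‖ < 1) :
    (1 - ‖x‖ ^ 2) ^ α * ‖radialI s t f x‖ = (1 - ‖x‖ ^ 2) ^ (α + t) * ‖radialD s t f x‖ := by
  have h := one_sub_norm_sq_pos hx
  rw [radialI, norm_smul, Real.norm_of_nonneg (Real.rpow_nonneg h.le _), Real.rpow_add h, mul_assoc]

lemma norm_le_of_rpow_mul_le {x : E n} (hx : ‖x‖ < 1) {a M : ℝ} (ha : 0 < a) {z : ℂ}
    (h : (1 - ‖x‖ ^ 2) ^ a * ‖z‖ ≤ M) : ‖z‖ ≤ M * (1 - ‖x‖) ^ (-a) := by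
  have h0 : 0 < 1 - ‖x‖ := by linarith
  have h1 : (1 - ‖x‖) ^ a ≤ (1 - ‖x‖ ^ 2) ^ a := Real.rpow_le_rpow h0.le (one_sub_norm_le hx) ha.le
  have h2 : 0 < (1 - ‖x‖) ^ a := Real.rpow_pos_of_pos h0 a
  rw [Real.rpow_neg h0.le, ← div_eq_mul_inv, le_div_iff₀ h2, mul_comm]
  exact (mul_le_mul_of_nonneg_right h1 (norm_nonneg z)).trans h

lemma rpow_mul_le_of_norm_le {x : E n} (hx : ‖x‖ < 1) {a M : ℝ} (ha : 0 < a) {z : ℂ}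
    (h : ‖z‖ ≤ M * (1 - ‖x‖) ^ (-a)) : (1 - ‖x‖ ^ 2) ^ a * ‖z‖ ≤ 2 ^ a * M := by
  have h0 : 0 < 1 - ‖x‖ := by linarith
  have h1 : (1 - ‖x‖ ^ 2) ^ a ≤ 2 ^ a * (1 - ‖x‖) ^ a := by
    rw [← Real.mul_rpow (by norm_num) h0.le]
    exact Real.rpow_le_rpow (one_sub_norm_sq_pos hx).le one_sub_norm_sq_le ha.le
  have h2 : 0 < (1 - ‖x‖) ^ a := Real.rpow_pos_of_pos h0 a
  have h3 : (1 - ‖x‖) ^ a * ‖z‖ ≤ M := by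
    rwa [Real.rpow_neg h0.le, ← div_eq_mul_inv, le_div_iff₀ h2, mul_comm] at h
  calc (1 - ‖x‖ ^ 2) ^ a * ‖z‖ ≤ 2 ^ a * (1 - ‖x‖) ^ a * ‖z‖ :=
        mul_le_mul_of_nonneg_right h1 (norm_nonneg z)
    _ = 2 ^ a * ((1 - ‖x‖) ^ a * ‖z‖) := mul_assoc _ _ _
    _ ≤ 2 ^ a * M := by gcongr

lemma eventually_norm_lt_one : ∀ᶠ x in nearSphere n, ‖x‖ < 1 :=
  eventually_nearSphere_iff.2 ⟨0, one_pos, fun _ _ h => h⟩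

lemma le_blochNorm {x : E n} (hx : ‖x‖ < 1) :
    ENNReal.ofReal ((1 - ‖x‖ ^ 2) ^ α * ‖radialI s t f x‖) ≤ blochNorm α s t f :=
  le_iSup₂ (f := fun (x : E n) (_ : x ∈ unitBall n) =>
    ENNReal.ofReal ((1 - ‖x‖ ^ 2) ^ α * ‖radialI s t f x‖)) x (by simpa [unitBall] using hx)

lemma blochNorm_le_ofReal {M : ℝ}
    (h : ∀ x : E n, ‖x‖ < 1 → (1 - ‖x‖ ^ 2) ^ α * ‖radialI s t f x‖ ≤ M) :
    blochNorm α s t f ≤ ENNReal.ofReal M :=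
  iSup₂_le fun x hx => ENNReal.ofReal_le_ofReal (h x (by simpa [unitBall] using hx))

/-- The little Bloch condition with given parameters. -/
def VanishesAtSphere (α s t : ℝ) (f : E n → ℂ) : Prop :=
  Tendsto (fun x : E n => (1 - ‖x‖ ^ 2) ^ α * ‖radialI s t f x‖) (nearSphere n) (𝓝 0)

/-- 1-|x|² and 1-|x| differ by a factor between 1 and 2, which is harmless when ε is arbitrary. -/
lemma vanishesAtSphere_iff_growth (ha : 0 < α + t) :
    VanishesAtSphere α s t f ↔ ∀ ε : ℝ, 0 < ε → Growth (radialD s t f) (α + t) ε := by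
  constructor
  · intro h ε hε
    filter_upwards [h.eventually_lt_const hε, eventually_norm_lt_one] with x h1 hx
    rw [rpow_mul_norm_radialI hx] at h1
    exact norm_le_of_rpow_mul_le hx ha h1.le
  · intro h
    refine Metric.tendsto_nhds.2 fun ε hε => ?_
    have h2 : (0 : ℝ) < 2 ^ (α + t) := by positivity
    filter_upwards [h (ε / 2 / 2 ^ (α + t)) (by positivity), eventually_norm_lt_one] with x h1 hx
    have h3 := rpow_mul_le_of_norm_le hx ha h1
    rw [mul_div_cancel₀ _ h2.ne', ← rpow_mul_norm_radialI hx] at h3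
    have h4 : 0 ≤ (1 - ‖x‖ ^ 2) ^ α * ‖radialI s t f x‖ :=
      mul_nonneg (Real.rpow_nonneg (one_sub_norm_sq_pos hx).le _) (norm_nonneg _)
    rw [Real.dist_eq, sub_zero, abs_of_nonneg h4]
    linarith

/-- The constant C does not depend on ε, so the growth bound may be applied at ε / C. -/
lemma VanishesAtSphere.transfer (hn : 0 < n) (hf : f ∈ harmonicSpace n) (ha : 0 < α + t)
    (h : VanishesAtSphere α s t f) {s' t' : ℝ} (ha' : 0 < α + t') : VanishesAtSphere α s' t' f := by
  rw [vanishesAtSphere_iff_growth ha] at h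
  rw [vanishesAtSphere_iff_growth ha']
  intro ε hε
  obtain ⟨C, hC, hT⟩ := exists_growth_radialD_of_growth hn s t s' t' ha ha' (by ring)
  have h1 := hT f hf (ε / C) (by positivity) (h _ (by positivity))
  rwa [mul_div_cancel₀ _ hC.ne'] at h1

lemma exists_norm_radialD_le_of_bloch (hn : 0 < n) (hf : f ∈ bloch n α) (ha : 0 < α + t) (s : ℝ) :
    ∃ M : ℝ, 0 < M ∧ ∀ x : E n, ‖x‖ < 1 → ‖radialD s t f x‖ ≤ M * (1 - ‖x‖) ^ (-(α + t)) := by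
  obtain ⟨hfh, s₀, t₀, ha₀, hfin⟩ := hf
  have h1 : Growth (radialD s₀ t₀ f) (α + t₀) ((blochNorm α s₀ t₀ f).toReal + 1) := by
    filter_upwards [eventually_norm_lt_one] with x hx
    refine norm_le_of_rpow_mul_le hx ha₀ ?_
    rw [← rpow_mul_norm_radialI hx]
    have := (ENNReal.ofReal_le_iff_le_toReal hfin.ne).1 (le_blochNorm (f := f) (α := α) (s := s₀)
      (t := t₀) hx)
    linarith
  obtain ⟨C, hC, hT⟩ := exists_growth_radialD_of_growth hn s₀ t₀ s t ha₀ ha (by ring)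
  have hB : 0 < (blochNorm α s₀ t₀ f).toReal + 1 := by positivity
  have h2 := hT f hfh _ hB h1
  obtain ⟨K, hK0, hK⟩ := exists_norm_le_of_growth (hasMeanValue_radialD hn hfh s t).continuousOn
    (by positivity) h2
  refine ⟨C * ((blochNorm α s₀ t₀ f).toReal + 1) + K, by positivity, fun x hx => ?_⟩
  have h3 : 1 ≤ (1 - ‖x‖) ^ (-(α + t)) :=
    Real.one_le_rpow_of_pos_of_le_one_of_nonpos (by linarith) (by linarith [norm_nonneg x])
      (by linarith)
  have h4 := le_mul_of_one_le_right hK0 h3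
  rw [add_mul]
  linarith [hK x hx]

lemma littleBloch_iff (hn : 0 < n) (hf : f ∈ bloch n α) (ha : 0 < α + t) :
    f ∈ littleBloch n α ↔ VanishesAtSphere α s t f := by
  constructor
  · rintro ⟨-, s₀, t₀, ha₀, h⟩
    exact VanishesAtSphere.transfer hn hf.1 ha₀ h ha
  · exact fun h => ⟨hf, s, t, ha, h⟩

end Spaces

/-! ### The normalized measure -/

section NormalizedMeasure

variable {n : ℕ}

lemma volume_unitBall_ne_zero : volume (unitBall n) ≠ 0 := (measure_ball_pos _ _ one_pos).ne'

lemma volume_unitBall_ne_top : volume (unitBall n) ≠ ⊤ := measure_ball_lt_top.ne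

instance isFiniteMeasure_nu : IsFiniteMeasure (nu n) := by
  refine ⟨?_⟩
  rw [nu, Measure.smul_apply, Measure.restrict_apply_univ, smul_eq_mul,
    ENNReal.inv_mul_cancel volume_unitBall_ne_zero volume_unitBall_ne_top]
  exact ENNReal.one_lt_top

lemma ae_nu_norm_lt_one : ∀ᵐ x ∂(nu n), ‖x‖ < 1 := by
  refine Measure.ae_smul_measure ?_ _
  filter_upwards [ae_restrict_mem measurableSet_ball] with x hx
  simpa [unitBall] using hx

lemma nu_absolutelyContinuous : nu n ≪ volume.restrict (unitBall n) :=
  Measure.smul_absolutelyContinuous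

lemma volume_restrict_eq_smul_nu :
    volume.restrict (unitBall n) = volume (unitBall n) • nu n := by
  rw [nu, smul_smul, ENNReal.mul_inv_cancel volume_unitBall_ne_zero volume_unitBall_ne_top, one_smul]

lemma nu_ball {x : E n} {r : ℝ} (hr : 0 < r) (h : ‖x‖ + r ≤ 1) :
    nu n (ball x r) = ENNReal.ofReal (r ^ n) := by
  have hsub : ball x r ⊆ unitBall n := ball_subset_ball' (by rw [dist_zero_right]; linarith)
  rw [nu, Measure.smul_apply, Measure.restrict_apply measurableSet_ball,
    Set.inter_eq_left.2 hsub, Measure.addHaar_ball_of_pos _ _ hr, smul_eq_mul, finrank_euclideanSpace_fin,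
    mul_left_comm]
  change _ * (_ * volume (unitBall n)) = _
  rw [ENNReal.inv_mul_cancel volume_unitBall_ne_zero volume_unitBall_ne_top, mul_one]

/-- A finite measure on the ball has small mass near the sphere. -/
lemma exists_measure_lt_norm_lt (μ : Measure (E n)) [IsFiniteMeasure μ]
    (h : ∀ᵐ x ∂μ, ‖x‖ < 1) {ε : ℝ≥0∞} (hε : 0 < ε) :
    ∃ ρ : ℝ, ρ < 1 ∧ μ {x | ρ < ‖x‖} < ε := by
  set T : ℕ → Set (E n) := fun j => {x | 1 - 1 / ((j : ℝ) + 1) < ‖x‖} with hT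
  have hanti : Antitone T := fun i j hij x hx => by
    have h1 : 1 / ((j : ℝ) + 1) ≤ 1 / ((i : ℝ) + 1) := by
      have : (i : ℝ) ≤ j := by exact_mod_cast hij
      gcongr
    simp only [hT, Set.mem_ofPred_eq] at hx ⊢
    linarith
  have hmeas : ∀ j, NullMeasurableSet (T j) μ := fun j =>
    (measurableSet_lt measurable_const measurable_norm).nullMeasurableSet
  have hlim := tendsto_measure_iInter_atTop hmeas hanti ⟨0, measure_ne_top μ _⟩
  have h0 : μ (⋂ j, T j) = 0 := by
    refine measure_mono_null ?_ (ae_iff.1 h)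
    intro x hx
    simp only [Set.mem_ofPred_eq, not_lt]
    by_contra! hlt
    obtain ⟨j, hj⟩ := exists_nat_one_div_lt (sub_pos.2 hlt)
    have := Set.mem_iInter.1 hx j
    simp only [hT, Set.mem_ofPred_eq] at this
    linarith
  rw [h0] at hlim
  obtain ⟨j, hj⟩ := (hlim.eventually_lt_const hε).exists
  refine ⟨1 - 1 / ((j : ℝ) + 1), ?_, hj⟩
  have : (0 : ℝ) < 1 / ((j : ℝ) + 1) := by positivity
  linarith

end NormalizedMeasure

/-! ### Level sets and the weight (1-|x|²)^(-n) -/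

section LevelSets

variable {n : ℕ} {α s t : ℝ} {f : E n → ℂ}

lemma lintegral_levelSet_lt_top (h : VanishesAtSphere α s t f) {ε : ℝ} (hε : 0 < ε) :
    ∫⁻ x in levelSet α s t ε f, ENNReal.ofReal ((1 - ‖x‖ ^ 2) ^ (-(n : ℝ))) ∂(nu n) < ⊤ := by
  obtain ⟨ρ, hρ, hsub⟩ := eventually_nearSphere_iff.1 (h.eventually_lt_const hε)
  set σ := max ρ 0 with hσ
  have hσ1 : σ < 1 := max_lt hρ one_pos
  have hσ0 : 0 ≤ σ := le_max_right _ _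
  have hσ2 : 0 < 1 - σ ^ 2 := by nlinarith
  have hL : levelSet α s t ε f ⊆ closedBall 0 σ := by
    rintro x ⟨hx, hle⟩
    rw [mem_closedBall_zero_iff]
    by_contra! hlt
    exact absurd (hsub x ((le_max_left _ _).trans_lt hlt) (by simpa [unitBall] using hx)) hle.not_gt
  calc ∫⁻ x in levelSet α s t ε f, ENNReal.ofReal ((1 - ‖x‖ ^ 2) ^ (-(n : ℝ))) ∂(nu n)
      ≤ ∫⁻ x in closedBall 0 σ, ENNReal.ofReal ((1 - ‖x‖ ^ 2) ^ (-(n : ℝ))) ∂(nu n) :=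
        lintegral_mono_set hL
    _ ≤ ∫⁻ _ in closedBall 0 σ, ENNReal.ofReal ((1 - σ ^ 2) ^ (-(n : ℝ))) ∂(nu n) := by
        refine setLIntegral_mono' measurableSet_closedBall fun x hx => ENNReal.ofReal_le_ofReal ?_
        have hx' : ‖x‖ ≤ σ := by simpa [unitBall] using hx
        exact Real.rpow_le_rpow_of_nonpos hσ2 (by nlinarith [norm_nonneg x]) (by simp)
    _ < ⊤ := by
        rw [setLIntegral_const]
        exact ENNReal.mul_lt_top ENNReal.ofReal_lt_top (measure_lt_top _ _)

/-- With u = 1-|x|, the ball has ν-measure (ηu)^n and 1-|y|² ≤ 3u on it. The powers of u cancel, so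
the lower bound is independent of x. -/
lemma ofReal_le_lintegral_ball {x : E n} {η : ℝ} (hx : ‖x‖ < 1) (hη : 0 < η) (hη' : η ≤ 1 / 4) :
    ENNReal.ofReal ((η / 3) ^ n) ≤
      ∫⁻ y in ball x (η * (1 - ‖x‖)), ENNReal.ofReal ((1 - ‖y‖ ^ 2) ^ (-(n : ℝ))) ∂(nu n) := by
  set u := 1 - ‖x‖ with hu
  have hu0 : 0 < u := by linarith
  have hηu : η * u ≤ u / 4 := by nlinarith
  calc ENNReal.ofReal ((η / 3) ^ n)
      = ∫⁻ _ in ball x (η * u), ENNReal.ofReal ((3 * u) ^ (-(n : ℝ))) ∂(nu n) := by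
        rw [setLIntegral_const, nu_ball (by positivity) (by linarith), Real.rpow_neg (by positivity),
          Real.rpow_natCast, ← ENNReal.ofReal_mul (by positivity), ← inv_pow, ← mul_pow]
        congr 2
        field_simp
    _ ≤ _ := by
        refine setLIntegral_mono' measurableSet_ball fun y hy => ENNReal.ofReal_le_ofReal ?_
        have h1 : ‖y - x‖ < η * u := by simpa [dist_eq_norm] using hy
        have h2 := norm_sub_norm_le y x
        have h3 := norm_sub_norm_le x y
        rw [norm_sub_rev] at h3
        refine Real.rpow_le_rpow_of_nonpos (one_sub_norm_sq_pos (by linarith)) ?_ (by simp)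
        linarith [one_sub_norm_sq_le (x := y)]

/-- The Bloch bound and the Lipschitz estimate let D^t_s f vary by at most half its lower bound at x
across a ball of radius proportional to 1-|x|. -/
lemma exists_ball_subset_levelSet (hn : 0 < n) (hf : f ∈ bloch n α) (ha : 0 < α + t) {ε : ℝ}
    (hε : 0 < ε) :
    ∃ η ε' : ℝ, 0 < η ∧ η ≤ 1 / 4 ∧ 0 < ε' ∧ ∀ x : E n, ‖x‖ < 1 →
      ε * (1 - ‖x‖) ^ (-(α + t)) ≤ ‖radialD s t f x‖ →
        ball x (η * (1 - ‖x‖)) ⊆ levelSet α s t ε' f := by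
  obtain ⟨M, hM0, hM⟩ := exists_norm_radialD_le_of_bloch hn hf ha s
  obtain ⟨C, hC0, hC⟩ := exists_norm_sub_le_of_hasMeanValue n
  set a := α + t with hadef
  have h2a : (0 : ℝ) < 2 ^ a := by positivity
  -- The second term makes the variation at most ε/2 times (1-|x|)^(-a). The factor (1/2)^a pays for
  -- 1-|y| being possibly half of 1-|x|.
  refine ⟨min (1 / 4) (ε / (8 * C * M * 2 ^ a)), (1 / 2) ^ a * (ε / 2), by positivity,
    min_le_left _ _, by positivity, fun x hx hxε y hy => ?_⟩
  set u := 1 - ‖x‖ with hu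
  set η := min (1 / 4) (ε / (8 * C * M * 2 ^ a)) with hη
  have hη0 : 0 < η := by positivity
  have hη1 : η ≤ 1 / 4 := min_le_left _ _
  have hη2 : 8 * C * M * 2 ^ a * η ≤ ε := by
    rw [← le_div_iff₀' (by positivity)]
    exact min_le_right _ _
  have hu0 : 0 < u := by linarith
  have hua : 0 < u ^ (-a) := by positivity
  have hηu : η * u ≤ u / 4 := by nlinarith
  have near (z : E n) (r : ℝ) (hz : ‖z - x‖ ≤ r) : u - r ≤ 1 - ‖z‖ := by
    have := norm_sub_norm_le z x
    linarith
  have h1 : ‖y - x‖ < η * u := by simpa [dist_eq_norm] using hy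
  have hy1 : u / 2 ≤ 1 - ‖y‖ := by linarith [near y _ h1.le]
  have hy2 : ‖y‖ < 1 := by linarith
  have h2 := hC _ (hasMeanValue_radialD hn hf.1 s t) x y (u / 4) (M * (u / 2) ^ (-a)) (by positivity)
    (by linarith) (by linarith) fun z hz => by
      have hz1 := near z (u / 2) (by
        have := mem_closedBall.1 hz
        rw [dist_eq_norm] at this
        linarith)
      refine (hM z (by linarith)).trans (mul_le_mul_of_nonneg_left ?_ hM0.le)
      exact Real.rpow_le_rpow_of_nonpos (by linarith) (by linarith) (by linarith)
  have e3 : (u / 2) ^ (-a) = 2 ^ a * u ^ (-a) := by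
    rw [Real.div_rpow hu0.le (by norm_num), Real.rpow_neg (by norm_num : (0 : ℝ) ≤ 2), div_inv_eq_mul,
      mul_comm]
  have h4 : ‖radialD s t f y - radialD s t f x‖ ≤ ε / 2 * u ^ (-a) := by
    refine h2.trans ?_
    have h5 : ‖y - x‖ / (u / 4) ≤ 4 * η := by
      rw [div_le_iff₀ (by positivity)]
      linarith
    calc C * (M * (u / 2) ^ (-a)) * (‖y - x‖ / (u / 4))
        ≤ C * (M * (u / 2) ^ (-a)) * (4 * η) := by gcongr
      _ = (8 * C * M * 2 ^ a * η) / 2 * u ^ (-a) := by rw [e3]; ring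
      _ ≤ ε / 2 * u ^ (-a) := by gcongr
  have h6 : ε / 2 * u ^ (-a) ≤ ‖radialD s t f y‖ := by
    have := norm_sub_norm_le (radialD s t f x) (radialD s t f y)
    rw [norm_sub_rev] at this
    linarith
  refine ⟨by simpa [unitBall] using hy2, ?_⟩
  rw [rpow_mul_norm_radialI hy2]
  have h7 : (u / 2) ^ a ≤ (1 - ‖y‖ ^ 2) ^ a :=
    Real.rpow_le_rpow (by positivity) (hy1.trans (one_sub_norm_le hy2)) ha.le
  calc (1 / 2) ^ a * (ε / 2) = (u / 2) ^ a * (ε / 2 * u ^ (-a)) := by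
        rw [div_eq_mul_one_div u, Real.mul_rpow hu0.le (by norm_num), Real.rpow_neg hu0.le]
        field_simp
    _ ≤ _ := by
        have := one_sub_norm_sq_pos hy2
        gcongr

lemma vanishesAtSphere_of_lintegral_levelSet (hn : 0 < n) (hf : f ∈ bloch n α) (ha : 0 < α + t)
    (h : ∀ ε : ℝ, 0 < ε →
      ∫⁻ x in levelSet α s t ε f, ENNReal.ofReal ((1 - ‖x‖ ^ 2) ^ (-(n : ℝ))) ∂(nu n) < ⊤) :
    VanishesAtSphere α s t f := by
  rw [vanishesAtSphere_iff_growth ha]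
  intro ε hε
  obtain ⟨η, ε', hη0, hη1, hε', hsub⟩ := exists_ball_subset_levelSet (s := s) hn hf ha hε
  set L := levelSet α s t ε' f with hL
  -- A finite measure, hence with small mass near the sphere. A bad point there would bring a ball
  -- of mass at least (η/3)^n inside the level set.
  set μ := ((nu n).restrict L).withDensity fun x => ENNReal.ofReal ((1 - ‖x‖ ^ 2) ^ (-(n : ℝ)))
    with hμ
  have : IsFiniteMeasure μ := isFiniteMeasure_withDensity (h ε' hε').ne
  have hae : ∀ᵐ x ∂μ, ‖x‖ < 1 :=
    (withDensity_absolutelyContinuous _ _).ae_le (ae_restrict_of_ae ae_nu_norm_lt_one)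
  obtain ⟨ρ, hρ, hlt⟩ := exists_measure_lt_norm_lt μ hae
    (ENNReal.ofReal_pos.2 (by positivity : 0 < (η / 3) ^ n))
  refine eventually_nearSphere_iff.2 ⟨(ρ + 1) / 2, by linarith, fun x hx1 hx2 => ?_⟩
  by_contra! hgt
  have hu0 : 0 < 1 - ‖x‖ := by linarith
  have hB := hsub x hx2 hgt.le
  refine hlt.not_ge ((ofReal_le_lintegral_ball hx2 hη0 hη1).trans ?_)
  have hBT : ball x (η * (1 - ‖x‖)) ⊆ {x | ρ < ‖x‖} := fun y hy => by
    have h1 : ‖y - x‖ < η * (1 - ‖x‖) := by simpa [dist_eq_norm] using hy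
    have h3 := norm_sub_norm_le x y
    rw [norm_sub_rev] at h3
    simp only [Set.mem_ofPred_eq]
    nlinarith
  refine le_trans (le_of_eq ?_) (measure_mono hBT)
  rw [hμ, withDensity_apply _ measurableSet_ball, Measure.restrict_restrict measurableSet_ball,
    Set.inter_eq_left.2 hB]

end LevelSets

/-! ### Dilates as approximants in the Bergman–Besov space -/

section BergmanBesov

variable {n : ℕ} {α s t : ℝ} {f g : E n → ℂ}

lemma continuousOn_radialI (hn : 0 < n) (hf : f ∈ harmonicSpace n) (s t : ℝ) :
    ContinuousOn (radialI s t f) (unitBall n) := by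
  have h1 : ContinuousOn (fun x : E n => (1 - ‖x‖ ^ 2) ^ t) (unitBall n) :=
    ContinuousOn.rpow_const (by fun_prop) fun x hx =>
      Or.inl (one_sub_norm_sq_pos (by simpa [unitBall] using hx)).ne'
  exact h1.smul (hasMeanValue_radialD hn hf s t).continuousOn

lemma norm_radialI_rpow_mul {p β : ℝ} {x : E n} (hx : ‖x‖ < 1) :
    (1 - ‖x‖ ^ 2) ^ β * ‖radialI s t f x‖ ^ p =
      (1 - ‖x‖ ^ 2) ^ (β + p * t) * ‖radialD s t f x‖ ^ p := by
  have h := one_sub_norm_sq_pos hx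
  rw [radialI, norm_smul, Real.norm_of_nonneg (Real.rpow_nonneg h.le _),
    Real.mul_rpow (Real.rpow_nonneg h.le _) (norm_nonneg _), ← Real.rpow_mul h.le, Real.rpow_add h,
    mul_comm t p, mul_assoc]

lemma memLp_radialI_iff (hn : 0 < n) (hf : f ∈ harmonicSpace n) {p : ℝ} (hp : 0 < p) (β : ℝ) :
    MemLp (radialI s t f) (ENNReal.ofReal p) (nuWeighted n β) ↔
      ∫⁻ x, ENNReal.ofReal ((weightConst n β)⁻¹ *
        ((1 - ‖x‖ ^ 2) ^ (β + p * t) * ‖radialD s t f x‖ ^ p)) ∂(nu n) < ⊤ := by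
  have hae : AEStronglyMeasurable (radialI s t f) (nuWeighted n β) :=
    ((continuousOn_radialI hn hf s t).aestronglyMeasurable measurableSet_ball).mono_ac
      ((withDensity_absolutelyContinuous _ _).trans nu_absolutelyContinuous)
  have hp0 : ENNReal.ofReal p ≠ 0 := by simpa using hp
  rw [MemLp, and_iff_right hae,
    eLpNorm_lt_top_iff_lintegral_rpow_enorm_lt_top hp0 ENNReal.ofReal_ne_top,
    ENNReal.toReal_ofReal hp.le, nuWeighted, lintegral_withDensity_eq_lintegral_mul_non_measurable _
      (by fun_prop) (Eventually.of_forall fun _ => ENNReal.ofReal_lt_top)]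
  refine iff_of_eq (congrArg (· < ⊤) (lintegral_congr_ae ?_))
  filter_upwards [ae_nu_norm_lt_one] with x hx
  rw [Pi.mul_apply, ← ofReal_norm, ENNReal.ofReal_rpow_of_nonneg (norm_nonneg _) hp.le,
    ← ENNReal.ofReal_mul' (by positivity), mul_assoc, norm_radialI_rpow_mul hx]

lemma comp_smul_mem_harmonicSpace (hf : f ∈ harmonicSpace n) {r : ℝ} (hr : |r| ≤ 1) :
    (fun y => f (r • y)) ∈ harmonicSpace n := by
  intro y hy
  have hy' : ‖y‖ < 1 := by simpa [unitBall] using hy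
  have h1 : r • y ∈ unitBall n := by
    rw [unitBall, mem_ball_zero_iff, norm_smul, Real.norm_eq_abs]
    nlinarith [norm_nonneg y, abs_nonneg r]
  simpa using harmonicAt_comp_dilation (x₀ := (0 : E n)) (by simpa using hf _ h1)

lemma radialD_comp_smul {r : ℝ} (hr : r ≠ 0) (s t : ℝ) (f : E n → ℂ) (x : E n) :
    radialD s t (fun y => f (r • y)) x = radialD s t f (r • x) :=
  multSeries_comp_smul hr _ f x

lemma radialD_sub (hn : 0 < n) (hf : f ∈ harmonicSpace n) (hg : g ∈ harmonicSpace n) {x : E n}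
    (hx : ‖x‖ < 1) : radialD s t (f - g) x = radialD s t f x - radialD s t g x :=
  multSeries_sub hf hg (polyBdd_gammaCoeff_div hn _ _) hx

lemma comp_smul_mem_bergmanBesov (hn : 0 < n) (hf : f ∈ harmonicSpace n) {r p : ℝ} (hr : 0 < r)
    (hr1 : r < 1) (hp : 1 ≤ p) (β : ℝ) : (fun y => f (r • y)) ∈ bergmanBesov n p β := by
  have hfr := comp_smul_mem_harmonicSpace hf (abs_le.2 ⟨by linarith, hr1.le⟩)
  have hb : 0 ≤ β + p * |β| := by nlinarith [abs_nonneg β, neg_abs_le β]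
  -- Since p ≥ 1, t = |β| makes β + pt nonnegative. The weight is then at most 1, and the dilated
  -- series is bounded.
  refine ⟨hfr, 0, |β|, by linarith, (memLp_radialI_iff hn hfr (by linarith) β).2 ?_⟩
  obtain ⟨K, hK⟩ := (isCompact_closedBall (0 : E n) r).exists_bound_of_continuousOn
    ((hasMeanValue_radialD hn hf 0 |β|).continuousOn.mono (closedBall_subset_ball hr1))
  refine lt_of_le_of_lt (lintegral_mono_ae (g := fun _ =>
    ENNReal.ofReal (|(weightConst n β)⁻¹| * K ^ p)) ?_) ?_
  · filter_upwards [ae_nu_norm_lt_one] with x hx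
    have h0 := one_sub_norm_sq_pos hx
    have h1 : (1 - ‖x‖ ^ 2) ^ (β + p * |β|) ≤ 1 :=
      Real.rpow_le_one h0.le (by nlinarith [sq_nonneg ‖x‖]) hb
    have h2 : ‖radialD 0 |β| f (r • x)‖ ≤ K := hK _ (by
      rw [mem_closedBall_zero_iff, norm_smul, Real.norm_of_nonneg hr.le]
      nlinarith)
    have h3 : ‖radialD 0 |β| f (r • x)‖ ^ p ≤ K ^ p := by gcongr
    rw [radialD_comp_smul hr.ne']
    refine ENNReal.ofReal_le_ofReal ?_
    have h4 := Real.rpow_nonneg (norm_nonneg (radialD 0 |β| f (r • x))) p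
    exact mul_le_mul (le_abs_self _) ((mul_le_of_le_one_left h4 h1).trans h3)
      (mul_nonneg (Real.rpow_nonneg h0.le _) h4) (abs_nonneg _)
  · rw [lintegral_const]
    exact ENNReal.mul_lt_top ENNReal.ofReal_lt_top (measure_lt_top _ _)

/-- If a continuous function on the ball is `o((1 - |x|²)^(-a))` at the sphere, its dilations
approximate it in the corresponding weighted norm. -/
lemma exists_dilation_close {w : E n → ℂ} (hw : ContinuousOn w (ball 0 1)) {a : ℝ} (ha : 0 < a)
    (h : Tendsto (fun x : E n => (1 - ‖x‖ ^ 2) ^ a * ‖w x‖) (nearSphere n) (𝓝 0)) {ε : ℝ}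
    (hε : 0 < ε) :
    ∃ r : ℝ, 0 < r ∧ r < 1 ∧ ∀ x : E n, ‖x‖ < 1 →
      (1 - ‖x‖ ^ 2) ^ a * ‖w x - w (r • x)‖ ≤ ε := by
  obtain ⟨ρ, hρ, hsmall⟩ := eventually_nearSphere_iff.1
    (h.eventually_lt_const (by positivity : 0 < ε / 2))
  -- Inside radius σ uniform continuity applies. Outside it, r close to 1 gives rσ > ρ, so both x
  -- and rx lie where the weighted function is small.
  set σ := (max ρ 0 + 1) / 2 with hσ
  have hm0 : 0 ≤ max ρ 0 := le_max_right _ _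
  have hm1 : max ρ 0 < 1 := max_lt hρ one_pos
  have hρm : ρ ≤ max ρ 0 := le_max_left _ _
  have hσ1 : σ < 1 := by linarith
  have hσ0 : 0 < σ := by linarith
  have hρσ : ρ < σ := by linarith
  obtain ⟨δ, hδ, hunif⟩ := Metric.uniformContinuousOn_iff.1
    ((isCompact_closedBall (0 : E n) σ).uniformContinuousOn_of_continuous
      (hw.mono (closedBall_subset_ball hσ1))) ε hε
  have hev : ∀ᶠ r : ℝ in 𝓝[<] 1, 0 < r ∧ ρ < r * σ ∧ 1 - δ < r ∧ r < 1 := by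
    have h1 : Tendsto (fun r : ℝ => r * σ) (𝓝[<] 1) (𝓝 (1 * σ)) :=
      (tendsto_nhdsWithin_of_tendsto_nhds tendsto_id).mul_const _
    have h2 : Tendsto (fun r : ℝ => r) (𝓝[<] 1) (𝓝 1) :=
      tendsto_nhdsWithin_of_tendsto_nhds tendsto_id
    filter_upwards [h2.eventually_const_lt one_pos, h1.eventually_const_lt (by linarith : ρ < 1 * σ),
      h2.eventually_const_lt (by linarith : 1 - δ < 1), self_mem_nhdsWithin] with r a1 a2 a3 a4
    exact ⟨a1, a2, a3, a4⟩
  obtain ⟨r, hr0, hrσ, hrδ, hr1⟩ := hev.exists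
  refine ⟨r, hr0, hr1, fun x hx => ?_⟩
  have h0 := one_sub_norm_sq_pos hx
  have hrx : ‖r • x‖ = r * ‖x‖ := by rw [norm_smul, Real.norm_of_nonneg hr0.le]
  have hrx1 : r * ‖x‖ ≤ ‖x‖ := mul_le_of_le_one_left (norm_nonneg x) hr1.le
  rcases le_or_gt ‖x‖ σ with hxσ | hxσ
  · have h1 : dist x (r • x) < δ := by
      rw [dist_eq_norm, show x - r • x = (1 - r) • x by rw [sub_smul, one_smul], norm_smul,
        Real.norm_of_nonneg (by linarith)]
      nlinarith [norm_nonneg x]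
    have h2 := hunif x (by simpa using hxσ) (r • x) (by simp only [mem_closedBall_zero_iff]; linarith) h1
    rw [dist_eq_norm] at h2
    have h3 : (1 - ‖x‖ ^ 2) ^ a ≤ 1 :=
      Real.rpow_le_one h0.le (by nlinarith [sq_nonneg ‖x‖]) ha.le
    exact (mul_le_of_le_one_left (norm_nonneg _) h3).trans h2.le
  · have hlt : ‖r • x‖ < 1 := by linarith
    have h1 := hsmall x (by linarith) hx
    have h2 := hsmall (r • x) (by nlinarith) hlt
    have h3 : (1 - ‖x‖ ^ 2) ^ a ≤ (1 - ‖r • x‖ ^ 2) ^ a := by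
      refine Real.rpow_le_rpow h0.le ?_ ha.le
      rw [hrx]
      nlinarith [mul_nonneg hr0.le (norm_nonneg x)]
    have h4 : (1 - ‖x‖ ^ 2) ^ a * ‖w x - w (r • x)‖ ≤
        (1 - ‖x‖ ^ 2) ^ a * ‖w x‖ + (1 - ‖x‖ ^ 2) ^ a * ‖w (r • x)‖ := by
      rw [← mul_add]
      exact mul_le_mul_of_nonneg_left (norm_sub_le _ _) (Real.rpow_nonneg h0.le _)
    have h5 := mul_le_mul_of_nonneg_right h3 (norm_nonneg (w (r • x)))
    linarith

lemma mem_blochClosure_of_vanishesAtSphere (hn : 0 < n) (hf : f ∈ bloch n α) (ha : 0 < α + t)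
    (h : VanishesAtSphere α s t f) {p : ℝ} (hp : 1 ≤ p) (β : ℝ) :
    f ∈ blochClosure α s t (bergmanBesov n p β) := by
  refine ⟨hf, fun ε hε => ?_⟩
  have h1 : Tendsto (fun x : E n => (1 - ‖x‖ ^ 2) ^ (α + t) * ‖radialD s t f x‖) (nearSphere n)
      (𝓝 0) := by
    refine h.congr' ?_
    filter_upwards [eventually_norm_lt_one] with x hx using rpow_mul_norm_radialI hx
  obtain ⟨r, hr0, hr1, hr⟩ := exists_dilation_close (hasMeanValue_radialD hn hf.1 s t).continuousOn
    ha h1 (half_pos hε)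
  have hfr := comp_smul_mem_harmonicSpace hf.1 (abs_le.2 ⟨by linarith, hr1.le⟩)
  refine ⟨_, comp_smul_mem_bergmanBesov hn hf.1 hr0 hr1 hp β, ?_⟩
  refine (blochNorm_le_ofReal fun x hx => ?_).trans_lt
    ((ENNReal.ofReal_lt_ofReal_iff hε).2 (half_lt_self hε))
  rw [rpow_mul_norm_radialI hx, radialD_sub hn hf.1 hfr hx, radialD_comp_smul hr0.ne']
  exact hr x hx

end BergmanBesov

/-! ### Sub-mean-value inequality for |w|^p -/

section SubMeanValue

variable {n : ℕ} {w : E n → ℂ} {p : ℝ}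

/-- The tangent line at c lies below the convex function v^p; this is Bernoulli's inequality
rescaled. -/
lemma rpow_add_mul_sub_le_rpow (hp : 1 ≤ p) {c v : ℝ} (hc : 0 < c) (hv : 0 ≤ v) :
    c ^ p + p * (c ^ p / c) * (v - c) ≤ v ^ p := by
  have h := one_add_mul_self_le_rpow_one_add (s := v / c - 1) (by linarith [div_nonneg hv hc.le]) hp
  rw [add_sub_cancel, Real.div_rpow hv hc.le, le_div_iff₀ (by positivity)] at h
  refine le_trans (le_of_eq ?_) h
  field_simp

/-- Jensen's inequality: the tangent line at c = ‖w x‖ is integrated against the kernel. -/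
lemma bumpMass_mul_rpow_norm_le (hw : HasMeanValue w) (hp : 1 ≤ p) {x : E n} {δ : ℝ} (hδ : 0 ≤ δ)
    (hx : ‖x‖ + δ < 1) :
    bumpMass (E n) * ‖w x‖ ^ p ≤ ∫ y, bumpKernel y • ‖w (x + δ • y)‖ ^ p := by
  have hp0 : 0 < p := by linarith
  have hmass := bumpMass_pos (V := E n)
  rcases (norm_nonneg (w x)).eq_or_lt with h0 | hc
  · rw [← h0, Real.zero_rpow hp0.ne', mul_zero]
    exact integral_nonneg fun y => smul_nonneg (bumpKernel_nonneg y) (by positivity)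
  set c := ‖w x‖ with hcdef
  have hcont : ContinuousOn (fun y => ‖w (x + δ • y)‖) (closedBall (0 : E n) 1) := by
    refine (hw.continuousOn.comp (by fun_prop) fun y hy => ?_).norm
    exact closedBall_subset_ball' (by rw [dist_zero_right]; linarith)
      (add_smul_mem_closedBall (abs_of_nonneg hδ).le hy)
  have i1 := integrable_smul_of_continuousOn_closedBall (continuous_bumpKernel (V := E n))
    support_bumpKernel_subset hcont
  have i2 := integrable_smul_of_continuousOn_closedBall (continuous_bumpKernel (V := E n))
    support_bumpKernel_subset (hcont.rpow_const fun _ _ => Or.inr hp0.le)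
  have h1 : bumpMass (E n) * c ≤ ∫ y, bumpKernel y • ‖w (x + δ • y)‖ := by
    have h2 := norm_integral_le_integral_norm (μ := volume) fun y : E n => bumpKernel y • w (x + δ • y)
    rw [hw.mean_value x δ hδ hx, norm_smul, Real.norm_of_nonneg hmass.le] at h2
    refine h2.trans_eq (integral_congr_ae (Eventually.of_forall fun y => ?_))
    simp only [norm_smul, Real.norm_of_nonneg (bumpKernel_nonneg y), smul_eq_mul]
  set q := p * (c ^ p / c) with hq
  have hq0 : 0 ≤ q := by positivity
  have h3 : ∫ y : E n, ((c ^ p - q * c) * bumpKernel y + q * (bumpKernel y • ‖w (x + δ • y)‖)) ≤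
      ∫ y, bumpKernel y • ‖w (x + δ • y)‖ ^ p := by
    refine integral_mono ((integrable_bumpKernel.const_mul _).add (i1.const_mul _)) i2 fun y => ?_
    have h4 := rpow_add_mul_sub_le_rpow hp hc (norm_nonneg (w (x + δ • y)))
    have h5 := mul_le_mul_of_nonneg_left h4 (bumpKernel_nonneg y)
    simp only [smul_eq_mul]
    refine le_trans (le_of_eq ?_) h5
    ring
  rw [integral_add (integrable_bumpKernel.const_mul _) (i1.const_mul _), integral_const_mul,
    integral_const_mul] at h3
  change (c ^ p - q * c) * bumpMass (E n) + _ ≤ _ at h3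
  nlinarith [mul_le_mul_of_nonneg_left h1 hq0]

lemma exists_rpow_norm_le_setIntegral (n : ℕ) : ∃ C : ℝ, 0 < C ∧ ∀ w : E n → ℂ, HasMeanValue w →
    ∀ p : ℝ, 1 ≤ p → ∀ (x : E n) (δ : ℝ), 0 < δ → ‖x‖ + δ < 1 →
      ‖w x‖ ^ p ≤ C * (δ ^ n)⁻¹ * ∫ z in closedBall x δ, ‖w z‖ ^ p := by
  obtain ⟨K, hK0, hK⟩ := exists_bumpKernel_le (V := E n)
  have hmass := bumpMass_pos (V := E n)
  refine ⟨K / bumpMass (E n), by positivity, fun w hw p hp x δ hδ hx => ?_⟩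
  have hp0 : 0 < p := by linarith
  have h1 := bumpMass_mul_rpow_norm_le hw hp hδ.le hx
  rw [integral_bumpKernel_smul_eq (fun z => ‖w z‖ ^ p) x hδ, finrank_euclideanSpace_fin,
    smul_eq_mul] at h1
  have hcont : ContinuousOn (fun z => ‖w z‖ ^ p) (closedBall x δ) :=
    (hw.continuousOn.mono (closedBall_subset_ball' (by rw [dist_zero_right]; linarith))).norm.rpow_const
      fun _ _ => Or.inr hp0.le
  have h2 : ∫ z, bumpKernel (δ⁻¹ • (z - x)) • ‖w z‖ ^ p ≤
      K * ∫ z in closedBall x δ, ‖w z‖ ^ p := by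
    rw [← integral_const_mul, ← integral_indicator measurableSet_closedBall]
    refine integral_mono_of_nonneg (Eventually.of_forall fun z => smul_nonneg (bumpKernel_nonneg _)
      (by positivity)) ?_ (Eventually.of_forall fun z => ?_)
    · exact (integrable_indicator_iff measurableSet_closedBall).2
        ((hcont.integrableOn_compact (isCompact_closedBall x δ)).const_mul K)
    · by_cases hz : z ∈ closedBall x δ
      · simp only [Set.indicator_of_mem hz, smul_eq_mul]
        exact mul_le_mul_of_nonneg_right (hK _) (by positivity)
      · simp only [Set.indicator_of_notMem hz]
        rw [bumpKernel_eq_zero, zero_smul]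
        rw [mem_closedBall, not_le, dist_eq_norm] at hz
        rw [norm_smul, norm_inv, Real.norm_of_nonneg hδ.le, ← div_eq_inv_mul, one_le_div hδ]
        exact hz.le
  have h3 : bumpMass (E n) * ‖w x‖ ^ p ≤ (δ ^ n)⁻¹ * (K * ∫ z in closedBall x δ, ‖w z‖ ^ p) :=
    h1.trans (mul_le_mul_of_nonneg_left h2 (by positivity))
  rw [← le_div_iff₀' hmass] at h3
  refine h3.trans_eq ?_
  ring

/-- Weighted `L^p` functions with the mean value property are `o` of the critical growth. -/
lemma eventually_rpow_mul_rpow_norm_le (hw : HasMeanValue w) (hp : 1 ≤ p) (b : ℝ)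
    (hfin : ∫⁻ x, ENNReal.ofReal ((1 - ‖x‖ ^ 2) ^ b * ‖w x‖ ^ p) ∂(nu n) < ⊤) {ε : ℝ} (hε : 0 < ε) :
    ∀ᶠ x in nearSphere n, (1 - ‖x‖) ^ (n + b) * ‖w x‖ ^ p ≤ ε := by
  obtain ⟨C, hC0, hC⟩ := exists_rpow_norm_le_setIntegral n
  have hp0 : 0 < p := by linarith
  set Φ : E n → ℝ := fun x => (1 - ‖x‖ ^ 2) ^ b * ‖w x‖ ^ p with hΦ
  -- On the ball of radius u/2 about x, 1-|z|² lies between u/2 and 3u. The minimum covers both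
  -- signs of b.
  set cb : ℝ := min ((1 / 2) ^ b) (3 ^ b) with hcb
  have hcb0 : 0 < cb := by positivity
  have hcmp : ∀ u v : ℝ, 0 < u → u / 2 ≤ v → v ≤ 3 * u → cb * u ^ b ≤ v ^ b := by
    intro u v hu h1 h2
    rcases le_total 0 b with hb | hb
    · calc cb * u ^ b ≤ (1 / 2) ^ b * u ^ b := by gcongr; exact min_le_left _ _
        _ = (u / 2) ^ b := by rw [← Real.mul_rpow (by norm_num) hu.le]; congr 1; ring
        _ ≤ v ^ b := Real.rpow_le_rpow (by positivity) h1 hb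
    · calc cb * u ^ b ≤ 3 ^ b * u ^ b := by gcongr; exact min_le_right _ _
        _ = (3 * u) ^ b := by rw [← Real.mul_rpow (by norm_num) hu.le]
        _ ≤ v ^ b := Real.rpow_le_rpow_of_nonpos (by linarith) h2 hb
  set μ := (volume.restrict (unitBall n)).withDensity fun x => ENNReal.ofReal (Φ x) with hμ
  have hμfin : IsFiniteMeasure μ := by
    refine isFiniteMeasure_withDensity ?_
    rw [volume_restrict_eq_smul_nu, lintegral_smul_measure, smul_eq_mul]
    exact ENNReal.mul_ne_top volume_unitBall_ne_top hfin.ne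
  have hae : ∀ᵐ x ∂μ, ‖x‖ < 1 := by
    refine (withDensity_absolutelyContinuous _ _).ae_le ?_
    filter_upwards [ae_restrict_mem measurableSet_ball] with x hx
    simpa [unitBall] using hx
  set K : ℝ := C * 2 ^ n * cb⁻¹ with hK
  have hK0 : 0 < K := by positivity
  obtain ⟨ρ, hρ, hlt⟩ := exists_measure_lt_norm_lt μ hae
    (ENNReal.ofReal_pos.2 (by positivity : 0 < ε / K))
  refine eventually_nearSphere_iff.2 ⟨(2 * ρ + 1) / 3, by linarith, fun x hx1 hx2 => ?_⟩
  set u := 1 - ‖x‖ with hu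
  have hu0 : 0 < u := by linarith
  have hsub : closedBall x (u / 2) ⊆ unitBall n :=
    closedBall_subset_ball' (by rw [dist_zero_right]; linarith)
  have hnear : ∀ z ∈ closedBall x (u / 2), u / 2 ≤ 1 - ‖z‖ ∧ 1 - ‖z‖ ≤ 3 / 2 * u := by
    intro z hz
    rw [mem_closedBall, dist_eq_norm] at hz
    have h2 := norm_sub_norm_le z x
    have h3 := norm_sub_norm_le x z
    rw [norm_sub_rev] at h3
    exact ⟨by linarith, by linarith⟩
  have hwc : ContinuousOn (fun z => ‖w z‖ ^ p) (closedBall x (u / 2)) :=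
    (hw.continuousOn.mono hsub).norm.rpow_const fun _ _ => Or.inr hp0.le
  have hΦc : ContinuousOn Φ (closedBall x (u / 2)) :=
    (ContinuousOn.rpow_const (by fun_prop) fun z hz => Or.inl
      (one_sub_norm_sq_pos (by simpa [unitBall] using hsub hz)).ne').mul hwc
  have hΦ0 : ∀ z ∈ closedBall x (u / 2), 0 ≤ Φ z := fun z hz =>
    mul_nonneg (Real.rpow_nonneg
      (one_sub_norm_sq_pos (by simpa [unitBall] using hsub hz)).le _) (by positivity)
  have h1 : ∫ z in closedBall x (u / 2), Φ z ≤ ε / K := by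
    rw [← ENNReal.ofReal_le_ofReal_iff (by positivity),
      ofReal_integral_eq_lintegral_ofReal (hΦc.integrableOn_compact (isCompact_closedBall _ _))
        ((ae_restrict_iff' measurableSet_closedBall).2 (Eventually.of_forall hΦ0))]
    refine le_trans (le_of_eq ?_) ((measure_mono (μ := μ)
      (s := closedBall x (u / 2)) fun z hz => ?_).trans hlt.le)
    · rw [hμ, withDensity_apply _ measurableSet_closedBall,
        Measure.restrict_restrict measurableSet_closedBall, Set.inter_eq_left.2 hsub]
    · have := (hnear z hz).2
      simp only [Set.mem_ofPred_eq]
      linarith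
  have h2 : cb * u ^ b * ∫ z in closedBall x (u / 2), ‖w z‖ ^ p ≤ ε / K := by
    refine le_trans ?_ h1
    rw [← integral_const_mul]
    refine setIntegral_mono_on
      ((hwc.integrableOn_compact (isCompact_closedBall _ _)).const_mul _)
      (hΦc.integrableOn_compact (isCompact_closedBall _ _)) measurableSet_closedBall fun z hz => ?_
    obtain ⟨h3, h4⟩ := hnear z hz
    refine mul_le_mul_of_nonneg_right (hcmp _ _ hu0 (h3.trans (one_sub_norm_le (by linarith))) ?_)
      (by positivity)
    linarith [one_sub_norm_sq_le (x := z)]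
  have h3 := hC w hw p hp x (u / 2) (by positivity) (by linarith)
  have hub : 0 < u ^ b := by positivity
  calc u ^ (n + b) * ‖w x‖ ^ p
      ≤ u ^ (n + b) * (C * ((u / 2) ^ n)⁻¹ * ∫ z in closedBall x (u / 2), ‖w z‖ ^ p) := by gcongr
    _ = K * (cb * u ^ b * ∫ z in closedBall x (u / 2), ‖w z‖ ^ p) := by
        rw [Real.rpow_add hu0, Real.rpow_natCast, hK, div_pow]
        field_simp
    _ ≤ K * (ε / K) := by gcongr
    _ = ε := mul_div_cancel₀ _ hK0.ne'

end SubMeanValue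

/-! ### Positivity of the normalizing constant -/

section Weights

variable {n : ℕ}

lemma integrable_one_sub_norm_sq_rpow (hn : 0 < n) {β : ℝ} (hβ : -1 < β) :
    Integrable (fun x : E n => (1 - ‖x‖ ^ 2) ^ β) (nu n) := by
  have : Nontrivial (E n) := by
    have : Nonempty (Fin n) := ⟨⟨0, hn⟩⟩
    infer_instance
  suffices h : Integrable (fun x : E n => (Set.Iio 1).indicator (fun r : ℝ => (1 - r ^ 2) ^ β) ‖x‖) by
    have h1 : IntegrableOn (fun x : E n => (1 - ‖x‖ ^ 2) ^ β) (unitBall n) := by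
      refine (h.integrableOn (s := unitBall n)).congr_fun (fun x hx => ?_) measurableSet_ball
      have hx' : ‖x‖ ∈ Set.Iio (1 : ℝ) := by simpa [unitBall] using hx
      simp only [Set.indicator_of_mem hx']
    exact h1.smul_measure (ENNReal.inv_ne_top.2 volume_unitBall_ne_zero)
  rw [integrable_fun_norm_addHaar]
  have hb : IntegrableOn (fun r : ℝ => 2 ^ |β| * betaWeight 1 (β + 1) r) (Set.Ioo 0 1) :=
    (integrableOn_betaWeight one_pos (by linarith)).const_mul _
  have h2 : IntegrableOn (fun r : ℝ => r ^ (Module.finrank ℝ (E n) - 1) *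
      (1 - r ^ 2) ^ β) (Set.Ioo 0 1) := by
    refine hb.mono' (Measurable.aestronglyMeasurable (by fun_prop)) ?_
    refine (ae_restrict_iff' measurableSet_Ioo).2 (Eventually.of_forall fun r hr => ?_)
    have hr0 := hr.1
    have h1r : 0 < 1 - r := by linarith [hr.2]
    have e1 : (1 - r ^ 2) ^ β = (1 + r) ^ β * (1 - r) ^ β := by
      rw [← Real.mul_rpow (by positivity) h1r.le]
      congr 1
      ring
    have e2 : (1 + r) ^ β ≤ 2 ^ |β| :=
      (Real.rpow_le_rpow_of_exponent_le (by linarith) (le_abs_self β)).trans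
        (Real.rpow_le_rpow (by positivity) (by linarith [hr.2]) (abs_nonneg β))
    rw [betaWeight, sub_self, Real.rpow_zero, one_mul, add_sub_cancel_right, e1,
      Real.norm_of_nonneg (by positivity)]
    calc r ^ (Module.finrank ℝ (E n) - 1) * ((1 + r) ^ β * (1 - r) ^ β)
        ≤ 1 * ((1 + r) ^ β * (1 - r) ^ β) := by
          gcongr
          exact pow_le_one₀ hr0.le hr.2.le
      _ ≤ 2 ^ |β| * (1 - r) ^ β := by
          rw [one_mul]
          gcongr
  have h3 : IntegrableOn ((Set.Iio 1).indicator fun r : ℝ => r ^ (Module.finrank ℝ (E n) - 1) *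
      (1 - r ^ 2) ^ β) (Set.Ioi 0) := by
    rw [IntegrableOn, integrable_indicator_iff measurableSet_Iio, IntegrableOn,
      Measure.restrict_restrict measurableSet_Iio, Set.inter_comm, Set.Ioi_inter_Iio]
    exact h2
  refine h3.congr_fun (fun r _ => ?_) measurableSet_Ioi
  simp only [smul_eq_mul, Set.indicator_apply, mul_ite, mul_zero]

/-- Were the constant 0, its inverse would make the weighted measure zero and membership in b^p_β
would carry no information. Integrability for β > -1 is needed because otherwise the integral
defaults to 0. -/
lemma weightConst_pos (hn : 0 < n) (β : ℝ) : 0 < weightConst n β := by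
  rw [weightConst]
  split_ifs with h
  · have hpos : ∀ᵐ x ∂(nu n), 0 < (1 - ‖x‖ ^ 2) ^ β := by
      filter_upwards [ae_nu_norm_lt_one] with x hx
      exact Real.rpow_pos_of_pos (one_sub_norm_sq_pos hx) _
    rw [integral_pos_iff_support_of_nonneg_ae (hpos.mono fun x hx => hx.le)
      (integrable_one_sub_norm_sq_rpow hn h)]
    have h1 : nu n (Function.support fun x : E n => (1 - ‖x‖ ^ 2) ^ β) = nu n Set.univ :=
      measure_congr (by
        filter_upwards [hpos] with x hx
        exact propext ⟨fun _ => trivial, fun _ => hx.ne'⟩)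
    rw [h1, nu, Measure.smul_apply, Measure.restrict_apply_univ, smul_eq_mul,
      ENNReal.inv_mul_cancel volume_unitBall_ne_zero volume_unitBall_ne_top]
    exact one_pos
  · exact one_pos

end Weights

/-! ### From the closure of b^p_β to the little Bloch condition -/

section Closure

variable {n : ℕ} {α s t p β : ℝ} {f g : E n → ℂ}

lemma vanishesAtSphere_of_mem_bergmanBesov (hn : 0 < n) (hp : 1 ≤ p) (hβ : β ≤ p * α - n)
    (hg : g ∈ bergmanBesov n p β) (ha : 0 < α + t) : VanishesAtSphere α s t g := by
  obtain ⟨hgh, σ, τ, hb, hmem⟩ := hg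
  have hp0 : 0 < p := by linarith
  have hn1 : (1 : ℝ) ≤ n := by exact_mod_cast hn
  have hA : n + (β + p * τ) ≤ (α + τ) * p := by linarith
  -- From β + pτ > -1 and n ≥ 1 the left side of `hA` is positive. The pair in the definition of
  -- b^p_β is therefore admissible for the Bloch condition.
  have hA0 : 0 < α + τ := pos_of_mul_pos_left (by linarith : 0 < (α + τ) * p) hp0.le
  refine VanishesAtSphere.transfer hn hgh hA0 (s := σ) ?_ ha
  have hV := weightConst_pos hn β
  have hfin : ∫⁻ x, ENNReal.ofReal ((1 - ‖x‖ ^ 2) ^ (β + p * τ) * ‖radialD σ τ g x‖ ^ p) ∂(nu n) < ⊤ := by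
    have h1 := (memLp_radialI_iff hn hgh hp0 β).1 hmem
    simp only [ENNReal.ofReal_mul (inv_nonneg.2 hV.le)] at h1
    rw [lintegral_const_mul' _ _ ENNReal.ofReal_ne_top] at h1
    exact ENNReal.lt_top_of_mul_ne_top_right h1.ne (ENNReal.ofReal_pos.2 (inv_pos.2 hV)).ne'
  rw [vanishesAtSphere_iff_growth hA0]
  intro ε hε
  filter_upwards [eventually_rpow_mul_rpow_norm_le (hasMeanValue_radialD hn hgh σ τ) hp _ hfin
    (by positivity : 0 < ε ^ p), eventually_norm_lt_one] with x h1 hx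
  have hu0 : 0 < 1 - ‖x‖ := by linarith
  have h2 : ((1 - ‖x‖) ^ (α + τ) * ‖radialD σ τ g x‖) ^ p ≤ ε ^ p := by
    rw [Real.mul_rpow (by positivity) (norm_nonneg _), ← Real.rpow_mul hu0.le]
    refine le_trans (mul_le_mul_of_nonneg_right ?_ (by positivity)) h1
    exact Real.rpow_le_rpow_of_exponent_ge hu0 (by linarith [norm_nonneg x]) hA
  rw [Real.rpow_le_rpow_iff (by positivity) hε.le hp0, ← le_div_iff₀' (by positivity)] at h2
  rwa [Real.rpow_neg hu0.le, ← div_eq_mul_inv]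

/-- Vanishing at the sphere survives uniform limits in the weighted norm. -/
lemma vanishesAtSphere_of_mem_blochClosure (hn : 0 < n) (hp : 1 ≤ p) (hβ : β ≤ p * α - n)
    (ha : 0 < α + t) (h : f ∈ blochClosure α s t (bergmanBesov n p β)) :
    VanishesAtSphere α s t f := by
  obtain ⟨hf, h⟩ := h
  refine Metric.tendsto_nhds.2 fun ε hε => ?_
  obtain ⟨g, hg, hfg⟩ := h (ε / 2) (by positivity)
  have hgv := vanishesAtSphere_of_mem_bergmanBesov (s := s) hn hp hβ hg ha
  filter_upwards [hgv.eventually_lt_const (half_pos hε), eventually_norm_lt_one] with x h1 hx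
  have h2 := (ENNReal.ofReal_lt_ofReal_iff (half_pos hε)).1 ((le_blochNorm hx).trans_lt hfg)
  have h0 := Real.rpow_nonneg (one_sub_norm_sq_pos hx).le (α + t)
  rw [rpow_mul_norm_radialI hx] at h1 h2 ⊢
  rw [radialD_sub hn hf.1 hg.1 hx] at h2
  have h3 := mul_le_mul_of_nonneg_left (norm_le_norm_sub_add (radialD s t f x) (radialD s t g x)) h0
  rw [Real.dist_eq, sub_zero, abs_of_nonneg (mul_nonneg h0 (norm_nonneg _))]
  linarith

end Closure

end HarmonicBloch

end

theorem theorem1p2 (n : ℕ) (hn : 2 ≤ n) (p α β : ℝ) (hp : 1 ≤ p)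
    (hβ : β ≤ p * α - n)
    -- the parameters of the level sets
    (s t : ℝ) (ht : 0 < α + t)
    -- the parameters of the norm in which the closure is taken
    (s' t' : ℝ) (ht' : 0 < α + t')
    (f : HarmonicBloch.E n → ℂ) (hf : f ∈ HarmonicBloch.bloch n α) :
    List.TFAE [
      f ∈ HarmonicBloch.littleBloch n α,
      f ∈ HarmonicBloch.blochClosure α s' t' (HarmonicBloch.bergmanBesov n p β),
      ∀ ε : ℝ, 0 < ε →
        ∫⁻ x in HarmonicBloch.levelSet α s t ε f,
          ENNReal.ofReal ((1 - ‖x‖ ^ 2) ^ (-(n : ℝ))) ∂(HarmonicBloch.nu n) < ⊤] := by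
  have hn0 : 0 < n := by omega
  tfae_have 1 → 2 := fun h => HarmonicBloch.mem_blochClosure_of_vanishesAtSphere hn0 hf ht'
    ((HarmonicBloch.littleBloch_iff hn0 hf ht').1 h) hp β
  tfae_have 2 → 1 := fun h => (HarmonicBloch.littleBloch_iff hn0 hf ht').2
    (HarmonicBloch.vanishesAtSphere_of_mem_blochClosure hn0 hp hβ ht' h)
  tfae_have 1 → 3 := fun h ε hε =>
    HarmonicBloch.lintegral_levelSet_lt_top ((HarmonicBloch.littleBloch_iff hn0 hf ht).1 h) hε
  tfae_have 3 → 1 := fun h => (HarmonicBloch.littleBloch_iff hn0 hf ht).2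
    (HarmonicBloch.vanishesAtSphere_of_lintegral_levelSet hn0 hf ht h)
  tfae_finish
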